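/- **Setting.** Let $T$ be a tomographically local generalized probabilistic theory (GPT) with finite-dimensional systems: states, effects and transformations are real vectors and matrices, composite systems are tensor products, states and effects span, discarding is the unique deterministic effect, classical probability theory is the subtheory on the classical systems, and operations may be classically controlled. A *symmetry* of $T$ is a representation $F$ of a finite group $G$ on the vector spaces of the elementary systems, trivial on classical systems, whose collective action $F_g^{S_1}\otimes\dots\otimes F_g^{S_n}$ maps (by conjugation) operations of $T$ to operations of $T$. The *symmetrized world* is the subtheory of all operations that are covariant (states and effects: invariant) under the collective action. If the symmetry is nonphysical, i.e. some $F_g$ is not an operation of $T$, this is the *swirled world* $sT$. We assume, as always when reference frames are used, that $T$ has a perfect reference frame for $F$: a state $\omega$ of some system such that the states $F_g\omega$, for group elements $g$ acting differently, are perfectly distinguishable by one measurement. A *causal structure* (with unrestricted gates) is a finite acyclic circuit shape: gates, latent wires for GPT systems, latent classical wires, and observed classical wires (open inputs, i.e. settings, and outputs; classical wires may be copied). Its $T$-realizable correlations are all conditional distributions of the observed outputs given the settings that arise by assigning systems of $T$ to the latent GPT wires, finite classical systems to the classical wires, and operations of $T$ to the gates. The structure *admits an $sT$–$T$ gap* if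 the set of its $sT$-realizable correlations is a strict subset of the set of its $T$-realizable correlations. Its *districts* are the fragments that remain connected when all observed wires are cut. A bipartite state $\rho^{AB}$ is a *shared reference frame state* if its twirl $\frac1{|G|}\sum_g (F_g^A\otimes F_g^B)\rho^{AB}$ is not invariant under the relational action $\{I^A\otimes F_g^B\}_{g\in G}$. A causal structure *allows the preparation of a shared reference frame state among all latent GPT systems* if there is a circuit of $sT$, compatible with the causal structure, in which every gate preparing a latent GPT wire $e$ may also put out a token system for $e$ that is set aside, such that for some values of the settings the reduced joint state of the tokens of any two different latent GPT wires (all other tokens discarded, all outputs averaged over) is a shared reference frame state. **Proposition.** Let $T$, $F$ be as above, with $F$ nonphysical, and consider a causal structure that has only one district. If it admits an $sT$–$T$ gap, then it does not allow the preparation of a shared reference frame state among all latent GPT systems. Moreover, for every $n$, the $n$-partite Bell scenario (one source sends a latent system to each of $n$ parties, each of whom has a setting and an outcome) admits no RQT–QT gap. Here QT is finite-dimensional quantum theory (completely positive trace-preserving maps, including classical systems), and RQT is its subtheory of operations with real Choi matrix in fixed bases. -/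

import Mathlib

open scoped Classical

/-! ## Systems and theories -/

/-- The non-classical elementary system types of a theory.  `qix q` indexes a basis of the finite
dimensional real vector space `ℝ ^ (qix q)` in which states of the system `q` live. -/
structure Signature where
  Q : Type
  qix : Q → Type
  qfin : ∀ q, Fintype (qix q)

/-- Elementary systems: the classical system with `n + 1` levels, or a non-classical one. -/
inductive Sys (σ : Signature) : Type
  | cl (n : ℕ) : Sys σ
  | gpt (q : σ.Q) : Sys σ

/-- Basis labels of the vector space of an elementary system; the basis vectors of a classical
system are the point distributions. -/
def Sys.ix {σ : Signature} : Sys σ → Type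
  | .cl n => Fin (n + 1)
  | .gpt q => σ.qix q

instance Sys.ixFintype {σ : Signature} : ∀ A : Sys σ, Fintype A.ix
  | .cl n => inferInstanceAs (Fintype (Fin (n + 1)))
  | .gpt q => σ.qfin q

/-- A composite system is a finite family of elementary systems.  Its vector space is the tensor
product of the elementary ones, so its basis is labelled by families of labels. -/
def Idx {σ : Signature} {α : Type} (a : α → Sys σ) : Type := ∀ i, (a i).ix

noncomputable instance Idx.fintype {σ : Signature} {α : Type} [Fintype α] (a : α → Sys σ) :
    Fintype (Idx a) :=
  inferInstanceAs (Fintype (∀ i, (a i).ix))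

/-- The matrix of a linear map from the composite system `a` to the composite system `b`
(first argument: output label, second argument: input label). -/
abbrev Tensor {σ : Signature} {α β : Type} (a : α → Sys σ) (b : β → Sys σ) : Type :=
  Idx b → Idx a → ℝ

/-- A theory over a signature: the discarding functional of every system, and the deterministic
operations (channels, instruments with classical outcomes, classically controlled operations, ...)
between composite systems.  A state is an operation without input systems; a measurement is an
operation with classical output systems only. -/
structure OpTheory (σ : Signature) where
  disc : ∀ A : Sys σ, A.ix → ℝ
  proc : ∀ {α β : Type} [Fintype α] [Fintype β] (a : α → Sys σ) (b : β → Sys σ), Set (Tensor a b)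

/-- Sequential composition. -/
noncomputable def seqComp {σ : Signature} {α β γ : Type} [Fintype β]
    {a : α → Sys σ} {b : β → Sys σ} {c : γ → Sys σ}
    (N : Tensor b c) (M : Tensor a b) : Tensor a c :=
  fun z x => ∑ y : Idx b, N z y * M y x

/-- Parallel composition. -/
def parComp {σ : Signature} {α β α' β' : Type}
    {a : α → Sys σ} {b : β → Sys σ} {a' : α' → Sys σ} {b' : β' → Sys σ}
    (M : Tensor a b) (M' : Tensor a' b') : Tensor (Sum.elim a a') (Sum.elim b b') :=
  fun y x => M (fun j => y (Sum.inl j)) (fun i => x (Sum.inl i)) *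
    M' (fun j => y (Sum.inr j)) (fun i => x (Sum.inr i))

/-- Tomographically local generalized probabilistic theories (with classical probability theory
as the subtheory on the classical systems). -/
structure OpTheory.IsGPT {σ : Signature} (T : OpTheory σ) : Prop where
  /-- The names and the order of the subsystems are immaterial. -/
  reindex : ∀ {α β α' β' : Type} [Fintype α] [Fintype β] [Fintype α'] [Fintype β']
    (e : α ≃ α') (f : β ≃ β') (a : α' → Sys σ) (b : β' → Sys σ)
    (M : Tensor (fun i => a (e i)) (fun j => b (f j))),
    M ∈ T.proc (fun i => a (e i)) (fun j => b (f j)) →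
    (fun y x => M (fun j => y (f j)) (fun i => x (e i)) : Tensor a b) ∈ T.proc a b
  ident : ∀ {α : Type} [Fintype α] (a : α → Sys σ),
    (fun y x => if y = x then 1 else 0 : Tensor a a) ∈ T.proc a a
  seq : ∀ {α β γ : Type} [Fintype α] [Fintype β] [Fintype γ]
    (a : α → Sys σ) (b : β → Sys σ) (c : γ → Sys σ) (N : Tensor b c) (M : Tensor a b),
    N ∈ T.proc b c → M ∈ T.proc a b → seqComp N M ∈ T.proc a c
  par : ∀ {α β α' β' : Type} [Fintype α] [Fintype β] [Fintype α'] [Fintype β']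
    (a : α → Sys σ) (b : β → Sys σ) (a' : α' → Sys σ) (b' : β' → Sys σ)
    (M : Tensor a b) (M' : Tensor a' b'), M ∈ T.proc a b → M' ∈ T.proc a' b' →
    parComp M M' ∈ T.proc (Sum.elim a a') (Sum.elim b b')
  /-- On classical systems the operations are exactly the stochastic maps. -/
  classical : ∀ {α β : Type} [Fintype α] [Fintype β] (n : α → ℕ) (m : β → ℕ)
    (M : Tensor (fun i => (Sys.cl (n i) : Sys σ)) (fun j => (Sys.cl (m j) : Sys σ))),
    M ∈ T.proc (fun i => Sys.cl (n i)) (fun j => Sys.cl (m j)) ↔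
      (∀ y x, 0 ≤ M y x) ∧ ∀ x, ∑ y, M y x = 1
  /-- Causality: discarding is the unique deterministic effect. -/
  discard : ∀ {α β : Type} [Fintype α] [Fintype β] [IsEmpty β] (a : α → Sys σ) (b : β → Sys σ)
    (M : Tensor a b), M ∈ T.proc a b ↔ M = fun _ x => ∏ i, T.disc (a i) (x i)
  /-- An operation may be chosen according to the value of a classical system. -/
  control : ∀ {α β : Type} [Fintype α] [Fintype β] (n : ℕ) (a : α → Sys σ) (b : β → Sys σ)
    (M : Fin (n + 1) → Tensor a b), (∀ k, M k ∈ T.proc a b) →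
    (fun y x => M (x none) y (fun i => x (some i)) :
      Tensor (fun o : Option α => o.elim (Sys.cl n) a) b) ∈
        T.proc (fun o : Option α => o.elim (Sys.cl n) a) b
  /-- The states of an elementary system span its vector space. -/
  states_span : ∀ (A : Sys σ) (f : A.ix → ℝ),
    (∀ M ∈ T.proc (fun i : Empty => (i.elim : Sys σ)) (fun _ : Unit => A),
      ∑ x, f x * M (fun _ => x) (fun i => i.elim) = 0) → f = 0
  /-- The effects of an elementary system span the dual space.  As the vector space of a composite
  is the tensor product, product effects therefore separate the states of a composite. -/
  effects_span : ∀ (A : Sys σ) (v : A.ix → ℝ),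
    (∀ (n : ℕ), ∀ M ∈ T.proc (fun _ : Unit => A) (fun _ : Unit => (Sys.cl n : Sys σ)),
      ∀ k : Fin (n + 1), ∑ x, M (fun _ => k) (fun _ => x) * v x = 0) → v = 0

/-! ## Symmetries and symmetrized worlds -/

/-- For each group element and elementary system, a real matrix (output label first). -/
abbrev SymAction (σ : Signature) (G : Type) : Type := G → ∀ A : Sys σ, A.ix → A.ix → ℝ

/-- The collective action on a composite system. -/
noncomputable def collective {σ : Signature} {G : Type} (F : SymAction σ G) (g : G)
    {α : Type} [Fintype α] (a : α → Sys σ) : Tensor a a :=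
  fun y x => ∏ i, F g (a i) (y i) (x i)

/-- `F` is a symmetry of `T`: a representation, trivial on classical systems, whose
collective action maps operations of `T` to operations of `T` (in particular states to states and
measurements to measurements, preserving all probabilities). -/
structure IsSymmetry {σ : Signature} (T : OpTheory σ) {G : Type} [Group G]
    (F : SymAction σ G) : Prop where
  one : ∀ (A : Sys σ) (y x : A.ix), F 1 A y x = if y = x then 1 else 0
  mul : ∀ (g h : G) (A : Sys σ) (y x : A.ix), F (g * h) A y x = ∑ z, F g A y z * F h A z x
  trivial_classical : ∀ (g : G) (n : ℕ) (y x : (Sys.cl n : Sys σ).ix),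
    F g (Sys.cl n) y x = if y = x then 1 else 0
  conj : ∀ (g : G) {α β : Type} [Fintype α] [Fintype β] (a : α → Sys σ) (b : β → Sys σ),
    ∀ M ∈ T.proc a b,
      seqComp (collective F g b) (seqComp M (collective F g⁻¹ a)) ∈ T.proc a b

/-- Every symmetry transformation is an operation of the theory. -/
def IsPhysical {σ : Signature} (T : OpTheory σ) {G : Type} (F : SymAction σ G) : Prop :=
  ∀ (g : G) (A : Sys σ),
    (fun y x => F g A (y ()) (x ()) : Tensor (fun _ : Unit => A) (fun _ : Unit => A)) ∈
      T.proc (fun _ : Unit => A) (fun _ : Unit => A)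

/-- Covariance with respect to the collective action (invariance, for states and effects). -/
def IsCovariant {σ : Signature} {G : Type} (F : SymAction σ G)
    {α β : Type} [Fintype α] [Fintype β] {a : α → Sys σ} {b : β → Sys σ} (M : Tensor a b) : Prop :=
  ∀ g : G, seqComp M (collective F g a) = seqComp (collective F g b) M

/-- The symmetrized world: the subtheory of all covariant operations.  It is called the swirled
world when the symmetry is not physical. -/
def swirl {σ : Signature} (T : OpTheory σ) {G : Type} (F : SymAction σ G) : OpTheory σ where
  disc := T.disc
  proc a b := {M | M ∈ T.proc a b ∧ IsCovariant F M}

/-- There is a (composite) system of `T` carrying a perfect reference frame state: a state `ω` such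
that the states `F g ω`, for group elements `g` that act differently, are perfectly
distinguished by one measurement (whose outcome `lab g` flags `F g ω`). -/
def HasPerfectFrame {σ : Signature} (T : OpTheory σ) {G : Type} (F : SymAction σ G) : Prop :=
  ∃ (n : ℕ) (r : Fin n → Sys σ) (N : ℕ),
    ∃ ω ∈ T.proc (fun i : Empty => (i.elim : Sys σ)) r,
    ∃ m ∈ T.proc r (fun _ : Unit => (Sys.cl N : Sys σ)),
    ∃ lab : G → Fin (N + 1), ∀ g h : G,
      seqComp m (seqComp (collective F h r) ω) (fun _ => lab g) (fun i => i.elim) =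
        if F g = F h then 1 else 0

/-- The twirling map on the states of a bipartite system (the bipartition into the composite
systems `a` and `b`): averaging over the collective action. -/
noncomputable def twirl {σ : Signature} {G : Type} [Fintype G] (F : SymAction σ G)
    {α β : Type} [Fintype α] [Fintype β] {a : α → Sys σ} {b : β → Sys σ}
    (ρ : Idx a → Idx b → ℝ) : Idx a → Idx b → ℝ :=
  fun y y' => (Fintype.card G : ℝ)⁻¹ * ∑ g : G, ∑ z : Idx a, ∑ z' : Idx b,
    collective F g a y z * collective F g b y' z' * ρ z z'

/-- The relational action: the group element acts on the second party only. -/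
noncomputable def relational {σ : Signature} {G : Type} (F : SymAction σ G) (g : G)
    {α β : Type} [Fintype β] {a : α → Sys σ} {b : β → Sys σ}
    (ρ : Idx a → Idx b → ℝ) : Idx a → Idx b → ℝ :=
  fun y y' => ∑ z' : Idx b, collective F g b y' z' * ρ y z'

/-- A bipartite state is a shared reference frame state if its twirled image is not invariant under
the relational group action. -/
def IsSharedFrame {σ : Signature} {G : Type} [Fintype G] (F : SymAction σ G)
    {α β : Type} [Fintype α] [Fintype β] {a : α → Sys σ} {b : β → Sys σ}
    (ρ : Idx a → Idx b → ℝ) : Prop :=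
  ∃ g : G, relational F g (twirl F ρ) ≠ twirl F ρ

/-! ## Causal structures -/

/-- A causal structure with unrestricted gates.  `GW`: latent wires for systems of the theory;
each leaves one gate and enters one gate (or is discarded, if `gtgt` is `none`).
`LW`: latent classical wires.  `OW`: observed classical wires; those with `osrc = none` are the open
inputs (settings), all the others are outputs.  Classical wires may be copied to several gates. -/
structure CausalStructure where
  Gate : Type
  GW : Type
  LW : Type
  OW : Type
  gateFin : Fintype Gate
  gwFin : Fintype GW
  lwFin : Fintype LW
  owFin : Fintype OW
  gsrc : GW → Gate
  gtgt : GW → Option Gate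
  lsrc : LW → Gate
  lread : LW → Set Gate
  osrc : OW → Option Gate
  oread : OW → Set Gate
  acyclic : ∀ v : Gate, ¬ Relation.TransGen (fun u w : Gate =>
    (∃ e, gsrc e = u ∧ gtgt e = some w) ∨ (∃ l, lsrc l = u ∧ w ∈ lread l) ∨
      (∃ o, osrc o = some u ∧ w ∈ oread o)) v v

attribute [instance] CausalStructure.gateFin CausalStructure.gwFin CausalStructure.lwFin
  CausalStructure.owFin

namespace CausalStructure

/-- Two gates are joined by a latent wire. -/
def LatentLink (C : CausalStructure) (u w : C.Gate) : Prop :=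
  (∃ e, C.gsrc e = u ∧ C.gtgt e = some w) ∨ (∃ l, C.lsrc l = u ∧ w ∈ C.lread l)

/-- The districts: the fragments (sets of gates) that remain connected when all observed wires are
cut, i.e. the classes of the equivalence relation generated by `LatentLink`. -/
def District (C : CausalStructure) : Type := Quot C.LatentLink

def OneDistrict (C : CausalStructure) : Prop := Nat.card C.District = 1

/-- The causal structure in which the gate preparing a latent wire `e` of the theory
can, together with the system on `e`, put out a further system (the token `Sum.inr e`) that is set
aside instead of being sent to the next gate. -/
def withTokens (C : CausalStructure) : CausalStructure where
  Gate := C.Gate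
  GW := C.GW ⊕ C.GW
  LW := C.LW
  OW := C.OW
  gateFin := inferInstance
  gwFin := inferInstance
  lwFin := inferInstance
  owFin := inferInstance
  gsrc := Sum.elim C.gsrc C.gsrc
  gtgt := Sum.elim C.gtgt (fun _ => none)
  lsrc := C.lsrc
  lread := C.lread
  osrc := C.osrc
  oread := C.oread
  acyclic := by
    intro v hv
    refine C.acyclic v (Relation.TransGen.mono (r := _) (p := _) ?_ _ _ hv)
    rintro u w (⟨e | e, h1, h2⟩ | h | h)
    · exact Or.inl ⟨e, h1, h2⟩
    · simp at h2
    · exact Or.inr (Or.inl h)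
    · exact Or.inr (Or.inr h)

end CausalStructure

/-! ## Circuits -/

/-- An assignment of systems to the wires of a causal structure: composite systems of the theory to
the `GW` wires, classical systems to the others. -/
structure Labelling (σ : Signature) (C : CausalStructure) where
  k : C.GW → ℕ
  gsys : ∀ e : C.GW, Fin (k e) → Sys σ
  lcard : C.LW → ℕ
  ocard : C.OW → ℕ

namespace Labelling

variable {σ : Signature} {C : CausalStructure}

/-- All elementary systems in the circuit. -/
abbrev Atom (L : Labelling σ C) : Type := (Σ e : C.GW, Fin (L.k e)) ⊕ (C.LW ⊕ C.OW)

def sysOf (L : Labelling σ C) : L.Atom → Sys σ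
  | .inl p => L.gsys p.1 p.2
  | .inr (.inl l) => Sys.cl (L.lcard l)
  | .inr (.inr o) => Sys.cl (L.ocard o)

/-- The system is an input of the gate. -/
def IsIn (L : Labelling σ C) (v : C.Gate) : L.Atom → Prop
  | .inl p => C.gtgt p.1 = some v
  | .inr (.inl l) => v ∈ C.lread l
  | .inr (.inr o) => v ∈ C.oread o

/-- The system is an output of the gate. -/
def IsOut (L : Labelling σ C) (v : C.Gate) : L.Atom → Prop
  | .inl p => C.gsrc p.1 = v
  | .inr (.inl l) => C.lsrc l = v
  | .inr (.inr o) => C.osrc o = some v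

/-- The system sits on the `GW` wire `f`. -/
def OnWire (L : Labelling σ C) (f : C.GW) : L.Atom → Prop
  | .inl p => p.1 = f
  | .inr _ => False

/-- The system sits on a `GW` wire that does not enter a gate. -/
def IsOpen (L : Labelling σ C) : L.Atom → Prop
  | .inl p => C.gtgt p.1 = none
  | .inr _ => False

def inSys (L : Labelling σ C) (v : C.Gate) : {s : L.Atom // L.IsIn v s} → Sys σ :=
  fun s => L.sysOf s.1

def outSys (L : Labelling σ C) (v : C.Gate) : {s : L.Atom // L.IsOut v s} → Sys σ :=
  fun s => L.sysOf s.1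

end Labelling

/-- A circuit of the theory `T` compatible with the causal structure `C`: an operation of `T`, from
all input systems to all output systems, for every gate. -/
structure Circuit {σ : Signature} (T : OpTheory σ) (C : CausalStructure) extends Labelling σ C where
  op : ∀ v : C.Gate, Tensor (toLabelling.inSys v) (toLabelling.outSys v)
  op_mem : ∀ v : C.Gate, op v ∈ T.proc (toLabelling.inSys v) (toLabelling.outSys v)

namespace Circuit

variable {σ : Signature} {T : OpTheory σ} {C : CausalStructure}

/-- The term of the tensor contraction belonging to a choice of basis labels for all systems. -/
noncomputable def term (c : Circuit T C) (X : Idx c.sysOf) : ℝ :=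
  ∏ v : C.Gate, c.op v (fun j => X j.1) (fun i => X i.1)

/-- The conditional distribution `P(outputs | settings)` of the circuit, as a function of the values
of all observed variables: all wires are contracted, open `GW` wires being discarded. -/
noncomputable def behaviour (c : Circuit T C) (x : ∀ o, Fin (c.ocard o + 1)) : ℝ :=
  ∑ X : Idx c.sysOf, if ∀ o, X (.inr (.inr o)) = x o then
    c.term X * ∏ s : {s : c.Atom // c.IsOpen s}, T.disc (c.sysOf s.1) (X s.1) else 0

/-- The reduced joint state that the circuit prepares on two different open `GW` wires `f`, `f'`,
when the settings take the values `x`: all the other open wires are discarded, and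
all observed outputs are averaged over. -/
noncomputable def jointState (c : Circuit T C) (x : ∀ o, Fin (c.ocard o + 1)) (f f' : C.GW) :
    Idx (c.gsys f) → Idx (c.gsys f') → ℝ := fun y y' =>
  ∑ X : Idx c.sysOf, if (∀ o, C.osrc o = none → X (.inr (.inr o)) = x o) ∧
      (∀ i, X (.inl ⟨f, i⟩) = y i) ∧ (∀ i, X (.inl ⟨f', i⟩) = y' i) then
    c.term X * ∏ s : {s : c.Atom // c.IsOpen s ∧ ¬ c.OnWire f s ∧ ¬ c.OnWire f' s},
      T.disc (c.sysOf s.1) (X s.1) else 0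

end Circuit

/-- The set of `T`-realizable correlations of a causal structure (for all finite numbers of values
of the observed variables). -/
def Correlations {σ : Signature} (T : OpTheory σ) (C : CausalStructure) :
    Set (Σ card : C.OW → ℕ, ((∀ o, Fin (card o + 1)) → ℝ)) :=
  Set.range fun c : Circuit T C => ⟨c.ocard, c.behaviour⟩

/-- The causal structure admits of an `S`-`T` gap. -/
def HasGap {σ : Signature} (S T : OpTheory σ) (C : CausalStructure) : Prop :=
  Correlations S C ⊂ Correlations T C

/-- The causal structure allows, in the symmetrized world, for the preparation of a shared reference
frame state among all latent systems of the theory: some circuit compatible with it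
equips the latent systems with tokens such that any two of them hold a shared
reference frame state. -/
def AllowsSharedFrame {σ : Signature} (T : OpTheory σ) {G : Type} [Fintype G]
    (F : SymAction σ G) (C : CausalStructure) : Prop :=
  ∃ (c : Circuit (swirl T F) C.withTokens) (x : ∀ o, Fin (c.ocard o + 1)),
    ∀ e e' : C.GW, e ≠ e' →
      IsSharedFrame F (c.jointState x (Sum.inr e) (Sum.inr e'))

/-! ## Quantum theory, real-amplitude quantum theory, Bell scenarios -/

/-- Quantum systems: one for every Hilbert space dimension `q + 1`; the `(q + 1) ^ 2` labels index an
orthonormal basis of the real space of Hermitian operators. -/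
def qSig : Signature where
  Q := ℕ
  qix q := Fin (q + 1) × Fin (q + 1)
  qfin _ := inferInstance

/-- The Hilbert space dimension is `lev A + 1`; the states of a classical system are the diagonal
density matrices. -/
def lev : Sys qSig → ℕ
  | .cl n => n
  | .gpt q => q

/-- The Hermitian operator with the given label. -/
noncomputable def basisOp : ∀ A : Sys qSig, A.ix → Matrix (Fin (lev A + 1)) (Fin (lev A + 1)) ℂ
  | .cl _, k => Matrix.single k k 1
  | .gpt _, (i, j) =>
    if i = j then Matrix.single i i 1
    else if i < j then ((Real.sqrt 2 : ℂ)⁻¹) • (Matrix.single i j 1 + Matrix.single j i 1)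
    else (Complex.I * (Real.sqrt 2 : ℂ)⁻¹) • (Matrix.single i j 1 - Matrix.single j i 1)

/-- The computational basis labels of a composite system. -/
def HIdx {α : Type} (a : α → Sys qSig) : Type := ∀ i, Fin (lev (a i) + 1)

noncomputable instance HIdx.fintype {α : Type} [Fintype α] (a : α → Sys qSig) :
    Fintype (HIdx a) :=
  inferInstanceAs (Fintype (∀ i, Fin (lev (a i) + 1)))

/-- The tensor product of the Hermitian operators with the given labels. -/
noncomputable def tensorOp {α : Type} [Fintype α] (a : α → Sys qSig) (x : Idx a) :
    Matrix (HIdx a) (HIdx a) ℂ :=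
  Matrix.of fun r c => ∏ i, basisOp (a i) (x i) (r i) (c i)

/-- Quantum theory: the operations are the completely positive (given by Kraus operators) trace
preserving maps. -/
noncomputable def QT : OpTheory qSig where
  disc A x := (basisOp A x).trace.re
  proc {_ _} _ _ a b := {M |
    (∃ (m : ℕ) (K : Fin m → Matrix (HIdx b) (HIdx a) ℂ), ∀ x : Idx a,
      ∑ y : Idx b, (M y x : ℂ) • tensorOp b y =
        ∑ l, K l * tensorOp a x * (K l).conjTranspose) ∧
    ∀ x : Idx a, ∑ y : Idx b, (M y x : ℂ) * (tensorOp b y).trace = (tensorOp a x).trace}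

/-- The Choi matrix of a superoperator. -/
noncomputable def choi {α β : Type} [Fintype α] [Fintype β] {a : α → Sys qSig} {b : β → Sys qSig}
    (M : Tensor a b) : Matrix (HIdx b × HIdx a) (HIdx b × HIdx a) ℂ :=
  ∑ y : Idx b, ∑ x : Idx a,
    (M y x : ℂ) • Matrix.kroneckerMap (· * ·) (tensorOp b y) (tensorOp a x).transpose

/-- Real-amplitude quantum theory: the operations of quantum theory with real Choi matrix. -/
noncomputable def RQT : OpTheory qSig where
  disc := QT.disc
  proc a b := {M | M ∈ QT.proc a b ∧ ∀ r c, star (choi M r c) = choi M r c}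

/-- The `n`-partite Bell scenario: a source (the gate `none`) sends one latent system to each
party `i`, who chooses a setting (`Sum.inl i`) and gets an outcome (`Sum.inr i`). -/
def bell (n : ℕ) : CausalStructure where
  Gate := Option (Fin n)
  GW := Fin n
  LW := Empty
  OW := Fin n ⊕ Fin n
  gateFin := inferInstance
  gwFin := inferInstance
  lwFin := inferInstance
  owFin := inferInstance
  gsrc _ := none
  gtgt i := some (some i)
  lsrc l := l.elim
  lread l := l.elim
  osrc := Sum.elim (fun _ => none) (fun i => some (some i))
  oread := Sum.elim (fun i => {some i}) (fun _ => ∅)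
  acyclic := by
    have key : ∀ u w : Option (Fin n), Relation.TransGen (fun u w : Option (Fin n) =>
        (∃ e : Fin n, none = u ∧ some (some e) = some w) ∨
        (∃ l : Empty, (l.elim : Option (Fin n)) = u ∧ w ∈ (l.elim : Set (Option (Fin n)))) ∨
        (∃ o : Fin n ⊕ Fin n, Sum.elim (fun _ => none) (fun i => some (some i)) o = some u ∧
          w ∈ (Sum.elim (fun i => {some i}) (fun _ => ∅) o : Set (Option (Fin n))))) u w →
        u = none ∧ w ≠ none := by
      intro u w h
      induction h with
      | single h =>
        rcases h with ⟨e, h1, h2⟩ | ⟨l, -⟩ | ⟨o | o, h1, h2⟩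
        · exact ⟨h1.symm, by rintro rfl; simp at h2⟩
        · exact l.elim
        · simp at h1
        · simp at h2
      | tail _ h ih =>
        rcases h with ⟨e, h1, h2⟩ | ⟨l, -⟩ | ⟨o | o, h1, h2⟩
        · exact ⟨ih.1, by rintro rfl; simp at h2⟩
        · exact l.elim
        · simp at h1
        · simp at h2
    intro v hv
    exact (key v v hv).2 (key v v hv).1

/-! ## Intertwining of networks -/

/-! Both claims come from one simulation: `T` and its symmetrized world have the same correlations
as soon as all latent systems emitted by gates that receive no latent system have one common source
(`correlations_subset_swirl`).

The simulation attaches a copy of a perfect frame state to every latent wire. A gate that receives a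
frame measures it, learns the orientation `g`, applies the original operation conjugated by `F g`
and hands on fresh frames of the same orientation (`exists_intertwining_of_frame`). Twirling such a
gate makes it covariant, and it still simulates the original gate for every `g`. A gate without
latent systems is classical and needs no change. The source, however, becomes under twirling a
uniform mixture over `g` of sources that prepare systems and frames with orientation `g`. Since
there is only one source, the whole network is an average over `g` of networks in which all
orientations agree, and each of these has the original behaviour. With two sources the orientations
would be independent.

Shared frame states force the source to be unique (`AllowsSharedFrame.root_unique`). Of two distinct
sources at least one does not influence the other, by acyclicity. Its inputs are classical, so
covariance makes its joint output invariant; by causality everything downstream can be erased. Hence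
its token is invariant even jointly with the other token (`Circuit.jointState_invariant`), and the
twirled pair is invariant under the relational action.

Both arguments compare two tensor networks of the same shape by pushing linear maps on the wires
through the gates (`Network.sum_eq_of_intertwine`). As classical wires may be copied, the maps on
them must be functions of the classical value.

A Bell scenario has a single source by definition. Transposition generates a symmetry of order two
of quantum theory, the qubit states `|±i⟩` are a perfect frame for it, and covariant operations have
a real Choi matrix. Thus real quantum theory contains the symmetrized world and realizes all quantum
Bell correlations. -/

/-- The assignments that agree with `Y₀` outside of `P`. -/
noncomputable def agreeOff {S : Type} [Fintype S] {J : S → Type} [∀ s, Fintype (J s)]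
    (P : S → Prop) (Y₀ : ∀ s, J s) : Finset (∀ s, J s) :=
  Finset.univ.filter fun Y => ∀ s, ¬ P s → Y s = Y₀ s

section agreeOff

variable {S : Type} [Fintype S] {J : S → Type} [∀ s, Fintype (J s)]

theorem mem_agreeOff {P : S → Prop} {Y₀ Y : ∀ s, J s} :
    Y ∈ agreeOff P Y₀ ↔ ∀ s, ¬ P s → Y s = Y₀ s := by
  simp [agreeOff]

theorem sum_agreeOff_or (P Q : S → Prop) (hPQ : ∀ s, P s → ¬ Q s) (Y₀ : ∀ s, J s)
    (f : (∀ s, J s) → ℝ) :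
    ∑ Y ∈ agreeOff (fun s => P s ∨ Q s) Y₀, f Y =
      ∑ Y₁ ∈ agreeOff Q Y₀, ∑ Y ∈ agreeOff P Y₁, f Y := by
  rw [← Finset.sum_fiberwise_of_maps_to (t := agreeOff Q Y₀)
    (g := fun Y s => if Q s then Y s else Y₀ s)]
  · refine Finset.sum_congr rfl fun Y₁ hY₁ => Finset.sum_congr ?_ fun _ _ => rfl
    rw [mem_agreeOff] at hY₁
    ext Y
    simp only [Finset.mem_filter, mem_agreeOff, not_or]
    constructor
    · rintro ⟨h1, rfl⟩ s hs
      by_cases hQ : Q s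
      · simp [hQ]
      · simp [hQ, h1 s ⟨hs, hQ⟩]
    · intro h
      refine ⟨fun s hs => (h s hs.1).trans (hY₁ s hs.2), funext fun s => ?_⟩
      by_cases hQ : Q s
      · have hP : ¬ P s := fun hP => hPQ s hP hQ
        simp [hQ, h s hP]
      · simp [hQ, hY₁ s hQ]
  · intro Y _
    rw [mem_agreeOff]
    intro s hs
    simp [hs]

theorem agreeOff_of_forall_not {P : S → Prop} (hP : ∀ s, ¬ P s) (Y₀ : ∀ s, J s) :
    agreeOff P Y₀ = {Y₀} := by
  ext Y
  simp [mem_agreeOff, hP, funext_iff]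

theorem agreeOff_of_forall {P : S → Prop} (hP : ∀ s, P s) (Y₀ : ∀ s, J s) :
    agreeOff P Y₀ = Finset.univ := by
  ext Y
  simp [mem_agreeOff, hP]

/-- Summation over the assignments to a part of the wires. -/
theorem sum_agreeOff (P : S → Prop) [Fintype (∀ s : {s // P s}, J s.1)] (Y₀ : ∀ s, J s) (f : (∀ s : {s // P s}, J s.1) → ℝ) :
    ∑ Y ∈ agreeOff P Y₀, f (fun s => Y s.1) = ∑ y, f y := by
  refine Finset.sum_bij' (fun Y _ => fun s => Y s.1)
    (fun y _ => fun s => if h : P s then y ⟨s, h⟩ else Y₀ s) ?_ ?_ ?_ ?_ ?_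
  · intros; exact Finset.mem_univ _
  · intro y _
    rw [mem_agreeOff]
    intro s hs
    simp [hs]
  · intro Y hY
    rw [mem_agreeOff] at hY
    funext s
    by_cases hs : P s
    · simp [hs]
    · simp [hs, hY s hs]
  · intro y _
    funext s
    simp [s.2]
  · intros; rfl

theorem sum_agreeOff_prod (P : S → Prop) (Y₀ : ∀ s, J s) (h : ∀ s, J s → ℝ) :
    ∑ Y ∈ agreeOff P Y₀, ∏ s with P s, h s (Y s) = ∏ s with P s, ∑ y, h s y := by
  have h1 : ∀ Y : ∀ s, J s, ∏ s with P s, h s (Y s) = ∏ s : {s // P s}, h s.1 (Y s.1) := by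
    intro Y
    exact (Finset.prod_subtype _ (by simp) _)
  simp_rw [h1]
  rw [sum_agreeOff P Y₀ (fun y => ∏ s : {s // P s}, h s.1 (y s)),
    Finset.prod_subtype (p := P) _ (by simp) (fun s => ∑ y, h s y), Finset.prod_univ_sum]
  rw [Fintype.piFinset_univ]

end agreeOff

/-- The shape of a network: every wire leaves one gate; classical wires may be read by many gates,
the other ones by exactly one. -/
structure Network (V S : Type) where
  src : S → V
  In : V → S → Prop
  rank : V → ℕ
  rank_lt : ∀ v s, In v s → rank (src s) < rank v
  cl : S → Prop
  unique : ∀ s v w, ¬ cl s → In v s → In w s → v = w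
  read : ∀ s, ¬ cl s → ∃ v, In v s

namespace Network

variable {V S : Type} [Fintype V] [Fintype S] (N : Network V S)
  {I J : S → Type} [∀ s, Fintype (I s)] [∀ s, Fintype (J s)]

/-- Non-classical wires read by a gate in `A`. -/
def Inner (A : Finset V) (s : S) : Prop := ¬ N.cl s ∧ ∃ v ∈ A, N.In v s

/-- Wires that leave a gate of `A` and are not inner wires. -/
def Cross (A : Finset V) (s : S) : Prop := N.src s ∈ A ∧ ¬ N.Inner A s

variable (T : ∀ s, J s → I s → ℝ)
  (hT : ∀ s, N.cl s → ∃ t : I s → J s, ∀ y x, T s y x = if y = t x then 1 else 0)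

include hT in
omit [Fintype V] [∀ s, Fintype (I s)] in
-- If the prefactor is nonzero, the deterministic maps force the classical inputs of `v` to have the
-- values `Y₀`, so a sum that also runs over them has no further nonzero terms. This accounts for
-- copying: a classical wire can be summed at one gate and held fixed for the others.
theorem sum_classical_inputs (v : V) (q : (∀ s, J s) → ℝ) (Y₀ : ∀ s, J s) (X : ∀ s, I s) :
    (∏ s with N.In v s ∧ N.cl s, T s (Y₀ s) (X s)) *
        ∑ Y ∈ agreeOff (fun s => ¬ N.cl s ∧ N.In v s) Y₀,
          q Y * ∏ s with ¬ N.cl s ∧ N.In v s, T s (Y s) (X s) =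
      (∏ s with N.In v s ∧ N.cl s, T s (Y₀ s) (X s)) *
        ∑ Y ∈ agreeOff (N.In v) Y₀, q Y * ∏ s with N.In v s, T s (Y s) (X s) := by
  by_cases h0 : ∏ s with N.In v s ∧ N.cl s, T s (Y₀ s) (X s) = 0
  · rw [h0]; simp
  congr 1
  have hcl : ∀ s, N.In v s → N.cl s → ∀ y, T s y (X s) = if y = Y₀ s then 1 else 0 := by
    intro s hs hc y
    obtain ⟨t, ht⟩ := hT s hc
    have h1 : T s (Y₀ s) (X s) ≠ 0 := by
      intro h
      exact h0 (Finset.prod_eq_zero (i := s) (by simp [hs, hc]) h)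
    rw [ht] at h1 ⊢
    have : Y₀ s = t (X s) := by by_contra h; simp [h] at h1
    rw [this]
  have hsplit : ∀ Y : ∀ s, J s, ∏ s with N.In v s, T s (Y s) (X s) =
      (∏ s with N.In v s ∧ N.cl s, T s (Y s) (X s)) *
        ∏ s with ¬ N.cl s ∧ N.In v s, T s (Y s) (X s) := by
    intro Y
    rw [← Finset.prod_filter_mul_prod_filter_not _ (fun s => N.cl s), Finset.filter_filter,
      Finset.filter_filter]
    simp only [and_comm]
  symm
  refine (Finset.sum_subset_zero_on_sdiff ?_ ?_ ?_).symm
  · intro Y hY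
    rw [mem_agreeOff] at hY ⊢
    exact fun s hs => hY s fun h => hs h.2
  · intro Y hY
    rw [Finset.mem_sdiff, mem_agreeOff, mem_agreeOff] at hY
    obtain ⟨h1, h2⟩ := hY
    push Not at h2
    obtain ⟨s, hs, hne⟩ := h2
    have hin : N.In v s := by by_contra h; exact hne (h1 s h)
    have hc : N.cl s := by by_contra h; exact hs h hin
    rw [hsplit, Finset.prod_eq_zero (i := s) (by simp [hin, hc]), zero_mul, mul_zero]
    rw [hcl s hin hc, if_neg hne]
  · intro Y hY
    rw [mem_agreeOff] at hY
    rw [hsplit, Finset.prod_eq_one (s := Finset.univ.filter fun s => N.In v s ∧ N.cl s), one_mul]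
    intro s hs
    simp only [Finset.mem_filter, Finset.mem_univ, true_and] at hs
    rw [hcl s hs.1 hs.2, if_pos (hY s (fun h => h.1 hs.2))]

variable (p : V → (∀ s, I s) → ℝ) (q : V → (∀ s, J s) → ℝ)
  (hp : ∀ v X X', (∀ s, N.src s = v ∨ N.In v s → X s = X' s) → p v X = p v X')
  (hq : ∀ v Y Y', (∀ s, N.src s = v ∨ N.In v s → Y s = Y' s) → q v Y = q v Y')
  -- Mapping the inputs and then applying `q v` equals applying `p v` and then mapping the outputs;
  -- `Y₀` fixes the outputs of `q v`, and `X₀` the inputs of `p v`.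
  (hint : ∀ v Y₀ X₀,
    ∑ Y ∈ agreeOff (N.In v) Y₀, q v Y * ∏ s with N.In v s, T s (Y s) (X₀ s) =
      ∑ X ∈ agreeOff (fun s => N.src s = v) X₀,
        p v X * ∏ s with N.src s = v, T s (Y₀ s) (X s))
include hT hp hq hint

omit [Fintype V] in

-- Induction over predecessor-closed sets of gates, adding a gate of maximal rank. Trading the gates
-- `q` of `A` for `p` leaves the maps `T` on the wires that cross the boundary. A classical wire
-- keeps crossing after it has been read, because other gates may read it later.
theorem prefix_intertwine (A : Finset V) :
    (∀ v ∈ A, ∀ s, N.In v s → N.src s ∈ A) → ∀ Y₀ X₀,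
    ∑ Y ∈ agreeOff (N.Inner A) Y₀, ∏ v ∈ A, q v Y =
      ∑ X ∈ agreeOff (fun s => N.src s ∈ A) X₀,
        (∏ v ∈ A, p v X) * ∏ s with N.Cross A s, T s (Y₀ s) (X s) := by
  induction A using Finset.induction_on_max_value N.rank with
  | empty =>
    intro _ Y₀ X₀
    rw [agreeOff_of_forall_not (by simp [Inner]), agreeOff_of_forall_not (by simp)]
    simp [Cross]
  | insert v A hv hmax ih =>
    intro hA Y₀ X₀
    have hclosed : ∀ w ∈ A, ∀ s, N.In w s → N.src s ∈ A := by
      intro w hw s hs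
      rcases Finset.mem_insert.1 (hA w (Finset.mem_insert_of_mem hw) s hs) with h | h
      · have := N.rank_lt w s hs
        have := hmax w hw
        rw [h] at *
        omega
      · exact h
    have hself : ∀ s, N.In v s → N.src s ≠ v := fun s hs h => by
      have := N.rank_lt v s hs
      rw [h] at this
      exact lt_irrefl _ this
    have hinsrc : ∀ s, N.In v s → N.src s ∈ A := fun s hs =>
      (Finset.mem_insert.1 (hA v (Finset.mem_insert_self _ _) s hs)).resolve_left (hself s hs)
    have hout : ∀ s, N.src s = v → ¬ N.Inner (insert v A) s := by
      rintro s rfl ⟨_, w, hw, hs⟩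
      rcases Finset.mem_insert.1 hw with rfl | hw
      · exact hself s hs rfl
      · exact hv (hclosed w hw s hs)
    have hInner : N.Inner (insert v A) = fun s => N.Inner A s ∨ (¬ N.cl s ∧ N.In v s) := by
      funext s
      simp only [Inner, Finset.mem_insert, exists_eq_or_imp]
      rw [and_or_left, or_comm]
    have hdisj : ∀ s, N.Inner A s → ¬ (¬ N.cl s ∧ N.In v s) := by
      rintro s ⟨h1, w, hw, hs⟩ ⟨_, h3⟩
      exact hv (N.unique s w v h1 hs h3 ▸ hw)
    -- crossing wires that persist
    set R : S → Prop := fun s => N.Cross A s ∧ ¬ (¬ N.cl s ∧ N.In v s) with hR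
    have hRcl : ∀ s, N.In v s ∧ N.cl s → R s := fun s h =>
      ⟨⟨hinsrc s h.1, fun h' => h'.1 h.2⟩, fun h' => h'.1 h.2⟩
    have hcross : ∀ f : S → ℝ, ∏ s with N.Cross A s, f s =
        (∏ s with R s, f s) * ∏ s with ¬ N.cl s ∧ N.In v s, f s := by
      intro f
      rw [← Finset.prod_filter_mul_prod_filter_not _ (fun s => ¬ N.cl s ∧ N.In v s),
        Finset.filter_filter, Finset.filter_filter, mul_comm]
      congr 1
      refine Finset.prod_congr (Finset.filter_congr fun s _ => ?_) fun _ _ => rfl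
      exact ⟨fun h => h.2, fun h => ⟨⟨hinsrc s h.2, fun h' => hdisj s h' h⟩, h⟩⟩
    have hcross' : ∀ f : S → ℝ, ∏ s with N.Cross (insert v A) s, f s =
        (∏ s with R s, f s) * ∏ s with N.src s = v, f s := by
      intro f
      rw [← Finset.prod_filter_mul_prod_filter_not _ (fun s => N.src s = v),
        Finset.filter_filter, Finset.filter_filter, mul_comm]
      congr 1
      · refine Finset.prod_congr (Finset.filter_congr fun s _ => ?_) fun _ _ => rfl
        constructor
        · rintro ⟨⟨h1, h2⟩, h3⟩
          rw [hInner] at h2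
          push Not at h2
          exact ⟨⟨(Finset.mem_insert.1 h1).resolve_left h3, h2.1⟩, fun h => h2.2 h.1 h.2⟩
        · rintro ⟨⟨h1, h2⟩, h3⟩
          refine ⟨⟨Finset.mem_insert_of_mem h1, ?_⟩, fun h => hv (h ▸ h1)⟩
          rw [hInner]
          exact fun h => h.elim h2 h3
      · refine Finset.prod_congr (Finset.filter_congr fun s _ => ?_) fun _ _ => rfl
        exact ⟨fun h => h.2, fun h => ⟨⟨h ▸ Finset.mem_insert_self _ _, hout s h⟩, h⟩⟩
    -- The classical inputs of `v` are among the persisting wires; their factor is what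
    -- `sum_classical_inputs` needs.
    have hRprod : ∀ f : S → ℝ, ∃ c, ∏ s with R s, f s =
        c * ∏ s with N.In v s ∧ N.cl s, f s := by
      intro f
      refine ⟨∏ s with R s ∧ ¬ (N.In v s ∧ N.cl s), f s, ?_⟩
      rw [← Finset.prod_filter_mul_prod_filter_not _ (fun s => N.In v s ∧ N.cl s),
        Finset.filter_filter, Finset.filter_filter, mul_comm]
      congr 1
      refine Finset.prod_congr (Finset.filter_congr fun s _ => ?_) fun _ _ => rfl
      exact ⟨fun h => h.2, fun h => ⟨hRcl s h, h⟩⟩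
    simp_rw [hcross', Finset.prod_insert hv]
    rw [hInner, sum_agreeOff_or _ _ hdisj]
    -- No wire at `v` is inner to `A`, so `q v` is constant in the inner sum and the induction
    -- hypothesis applies with base point `Y₁`.
    have lhs : ∀ Y₁ ∈ agreeOff (fun s => ¬ N.cl s ∧ N.In v s) Y₀,
        ∑ Y ∈ agreeOff (N.Inner A) Y₁, q v Y * ∏ w ∈ A, q w Y =
          ∑ X ∈ agreeOff (fun s => N.src s ∈ A) X₀, (∏ w ∈ A, p w X) *
            (∏ s with R s, T s (Y₀ s) (X s)) *
              (q v Y₁ * ∏ s with ¬ N.cl s ∧ N.In v s, T s (Y₁ s) (X s)) := by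
      intro Y₁ hY₁
      have h1 : ∀ Y ∈ agreeOff (N.Inner A) Y₁, q v Y = q v Y₁ := by
        intro Y hY
        rw [mem_agreeOff] at hY
        refine hq v _ _ fun s hs => hY s ?_
        rcases hs with hs | hs
        · intro h
          apply hout s hs
          rw [hInner]
          exact Or.inl h
        · intro h
          exact hdisj s h ⟨h.1, hs⟩
      rw [Finset.sum_congr rfl fun Y hY => by rw [h1 Y hY], ← Finset.mul_sum, ih hclosed Y₁ X₀,
        Finset.mul_sum]
      refine Finset.sum_congr rfl fun X _ => ?_
      rw [hcross]
      have h2 : ∏ s with R s, T s (Y₁ s) (X s) = ∏ s with R s, T s (Y₀ s) (X s) := by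
        refine Finset.prod_congr rfl fun s hs => ?_
        simp only [Finset.mem_filter, Finset.mem_univ, true_and, hR] at hs
        rw [mem_agreeOff] at hY₁
        rw [hY₁ s hs.2]
      rw [h2]
      ring
    rw [Finset.sum_congr rfl lhs, Finset.sum_comm]
    have hsrcins : (fun s => N.src s ∈ insert v A) = fun s => N.src s = v ∨ N.src s ∈ A := by
      funext s
      simp
    rw [hsrcins, sum_agreeOff_or _ _ (fun s (h : N.src s = v) h' => hv (h ▸ h'))]
    refine Finset.sum_congr rfl fun X₁ _ => ?_
    rw [← Finset.mul_sum]
    have rhs : ∀ X ∈ agreeOff (fun s => N.src s = v) X₁,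
        (p v X * ∏ w ∈ A, p w X) * ((∏ s with R s, T s (Y₀ s) (X s)) *
          ∏ s with N.src s = v, T s (Y₀ s) (X s)) =
        (∏ w ∈ A, p w X₁) * (∏ s with R s, T s (Y₀ s) (X₁ s)) *
          (p v X * ∏ s with N.src s = v, T s (Y₀ s) (X s)) := by
      intro X hX
      rw [mem_agreeOff] at hX
      have h1 : ∏ w ∈ A, p w X = ∏ w ∈ A, p w X₁ := by
        refine Finset.prod_congr rfl fun w hw => hp w _ _ fun s hs => hX s ?_
        rintro rfl
        rcases hs with hs | hs
        · exact hv (hs ▸ hw)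
        · exact hv (hclosed w hw s hs)
      have h2 : ∏ s with R s, T s (Y₀ s) (X s) = ∏ s with R s, T s (Y₀ s) (X₁ s) := by
        refine Finset.prod_congr rfl fun s hs => ?_
        simp only [Finset.mem_filter, Finset.mem_univ, true_and, hR] at hs
        rw [hX s]
        rintro rfl
        exact hv hs.1.1
      rw [h1, h2]
      ring
    rw [Finset.sum_congr rfl rhs, ← Finset.mul_sum, ← hint v Y₀ X₁]
    obtain ⟨c, hc⟩ := hRprod fun s => T s (Y₀ s) (X₁ s)
    rw [hc]
    -- The two sides now differ only in whether the classical inputs of `v` are summed over.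
    have := N.sum_classical_inputs T hT v (q v) Y₀ X₁
    linear_combination (∏ w ∈ A, p w X₁) * c * this

/-- Once all gates are included only classical wires cross, and every column of a deterministic map
sums to one. `X₀` and `Y₀` are mere base points of partial sums. -/
theorem sum_eq_of_intertwine' (X₀ : ∀ s, I s) (Y₀ : ∀ s, J s) :
    ∑ Y, ∏ v, q v Y = ∑ X, ∏ v, p v X := by
  have h := N.prefix_intertwine T hT p q hp hq hint Finset.univ (by simp)
  have hInner : N.Inner Finset.univ = fun s => ¬ N.cl s := by
    funext s
    simp only [Inner, Finset.mem_univ, true_and]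
    exact propext ⟨fun h => h.1, fun h => ⟨h, N.read s h⟩⟩
  have hCross : N.Cross Finset.univ = N.cl := by
    funext s
    simp [Cross, hInner]
  rw [hInner] at h
  simp only [hCross, Finset.mem_univ, agreeOff_of_forall, implies_true] at h
  rw [← agreeOff_of_forall (P := fun s => ¬ N.cl s ∨ N.cl s) (fun s => (em _).symm) Y₀,
    sum_agreeOff_or _ _ (fun _ h => h)]
  simp_rw [fun Y₁ => h Y₁ X₀]
  rw [Finset.sum_comm]
  refine Finset.sum_congr rfl fun X _ => ?_
  rw [← Finset.mul_sum, sum_agreeOff_prod N.cl Y₀ (fun s y => T s y (X s))]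
  convert mul_one _
  refine Finset.prod_eq_one fun s hs => ?_
  obtain ⟨t, ht⟩ := hT s (by simpa using hs)
  simp [ht]

omit hint in
/-- If all gates of two networks of the same shape are intertwined by maps between their wires,
the networks have the same value. -/
theorem sum_eq_of_intertwine (Out : V → S → Prop) (hOut : ∀ v s, Out v s ↔ N.src s = v)
    (hint : ∀ v Y₀ X₀,
      ∑ Y ∈ agreeOff (N.In v) Y₀, q v Y * ∏ s with N.In v s, T s (Y s) (X₀ s) =
        ∑ X ∈ agreeOff (Out v) X₀, p v X * ∏ s with Out v s, T s (Y₀ s) (X s))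
    (X₀ : ∀ s, I s) (Y₀ : ∀ s, J s) :
    ∑ Y, ∏ v, q v Y = ∑ X, ∏ v, p v X := by
  obtain rfl : Out = fun v s => N.src s = v := by
    funext v s
    exact propext (hOut v s)
  exact N.sum_eq_of_intertwine' T hT p q hp hq hint X₀ Y₀

end Network

/-! ## Closure properties of theories -/

/-! ### Label sets of composite systems. -/

section Index

variable {σ : Signature}

/-- Joining index families of two composite systems. -/
def Idx.join {α β : Type} {a : α → Sys σ} {b : β → Sys σ} (x : Idx a) (y : Idx b) :
    Idx (Sum.elim a b) :=
  fun i => match i with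
    | .inl i => x i
    | .inr j => y j

@[simp] theorem Idx.join_inl {α β : Type} {a : α → Sys σ} {b : β → Sys σ} (x : Idx a) (y : Idx b)
    (i : α) : (Idx.join x y) (.inl i) = x i := rfl

@[simp] theorem Idx.join_inr {α β : Type} {a : α → Sys σ} {b : β → Sys σ} (x : Idx a) (y : Idx b)
    (j : β) : (Idx.join x y) (.inr j) = y j := rfl

def Idx.joinEquiv {α β : Type} (a : α → Sys σ) (b : β → Sys σ) :
    Idx a × Idx b ≃ Idx (Sum.elim a b) where
  toFun p := Idx.join p.1 p.2
  invFun z := (fun i => z (.inl i), fun j => z (.inr j))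
  left_inv _ := rfl
  right_inv z := by funext i; cases i <;> rfl

theorem Idx.exists_join {α β : Type} {a : α → Sys σ} {b : β → Sys σ} (z : Idx (Sum.elim a b)) :
    ∃ x y, z = Idx.join x y :=
  ⟨_, _, ((Idx.joinEquiv a b).right_inv z).symm⟩

theorem Idx.ext_iff {α : Type} {a : α → Sys σ} {x y : Idx a} : x = y ↔ ∀ i, x i = y i :=
  funext_iff

theorem Idx.sum_join {α β : Type} [Fintype α] [Fintype β] {a : α → Sys σ} {b : β → Sys σ}
    (f : Idx (Sum.elim a b) → ℝ) :
    ∑ z, f z = ∑ x : Idx a, ∑ y : Idx b, f (Idx.join x y) := by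
  rw [← Fintype.sum_prod_type' (f := fun (x : Idx a) (y : Idx b) => f (Idx.join x y))]
  exact (Equiv.sum_comp (Idx.joinEquiv a b) f).symm

theorem Idx.sum_prod_apply {α : Type} [Fintype α] {a : α → Sys σ} (f : ∀ i, (a i).ix → ℝ) :
    ∑ z : Idx a, ∏ i, f i (z i) = ∏ i, ∑ x, f i x := by
  rw [Finset.prod_univ_sum, Fintype.piFinset_univ]
  rfl

theorem Idx.sum_unit {A : Sys σ} (f : Idx (fun _ : Unit => A) → ℝ) :
    ∑ z, f z = ∑ x : A.ix, f (fun _ => x) :=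
  Fintype.sum_equiv (ι := Idx (fun _ : Unit => A)) (Equiv.funUnique Unit A.ix) _ _ fun _ => rfl

theorem Idx.sum_isEmpty {α : Type} [Fintype α] [IsEmpty α] {a : α → Sys σ} (f : Idx a → ℝ)
    (x : Idx a) : ∑ z, f z = f x := by
  have : Unique (Idx a) := ⟨⟨x⟩, fun y => funext fun i => isEmptyElim i⟩
  rw [Fintype.sum_unique]
  congr 1
  exact Subsingleton.elim _ _

/-- Index families of matching composite systems correspond to each other. -/
theorem Idx.exists_equiv {α α' : Type} (e : α' ≃ α) {a : α → Sys σ} {a' : α' → Sys σ}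
    (h : ∀ i, a' i = a (e i)) :
    ∃ Θ : Idx a' ≃ Idx a, ∀ X i, HEq (X i) (Θ X (e i)) := by
  obtain rfl : a' = fun i => a (e i) := funext h
  refine ⟨Equiv.piCongrLeft (fun i => (a i).ix) e, fun X i => heq_of_eq ?_⟩
  exact (Equiv.piCongrLeft_apply_apply (fun i => (a i).ix) e X i).symm

end Index

section SeqComp

variable {σ : Signature} {α β γ δ : Type} [Fintype β] [Fintype γ]
  {a : α → Sys σ} {b : β → Sys σ} {c : γ → Sys σ} {d : δ → Sys σ}

theorem seqComp_assoc (L : Tensor c d) (N : Tensor b c) (M : Tensor a b) :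
    seqComp (seqComp L N) M = seqComp L (seqComp N M) := by
  funext z x
  simp only [seqComp, Finset.sum_mul, Finset.mul_sum]
  rw [Finset.sum_comm]
  simp only [mul_assoc]

theorem seqComp_one (M : Tensor b d) :
    seqComp M (fun y x => if y = x then 1 else 0 : Tensor b b) = M := by
  funext z x
  simp [seqComp]

theorem one_seqComp (M : Tensor a b) :
    seqComp (fun y x => if y = x then 1 else 0 : Tensor b b) M = M := by
  funext z x
  simp [seqComp]

end SeqComp

/-- Closure under renaming the subsystems. -/
structure OpTheory.Reindexable {σ : Signature} (T : OpTheory σ) : Prop where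
  reindex : ∀ {α β α' β' : Type} [Fintype α] [Fintype β] [Fintype α'] [Fintype β']
    (e : α ≃ α') (f : β ≃ β') (a : α' → Sys σ) (b : β' → Sys σ)
    (M : Tensor (fun i => a (e i)) (fun j => b (f j))),
    M ∈ T.proc (fun i => a (e i)) (fun j => b (f j)) →
    (fun y x => M (fun j => y (f j)) (fun i => x (e i)) : Tensor a b) ∈ T.proc a b

/-- The closure properties of a theory under composition and classical control. -/
structure OpTheory.Closed {σ : Signature} (T : OpTheory σ) : Prop extends T.Reindexable where
  ident : ∀ {α : Type} [Fintype α] (a : α → Sys σ),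
    (fun y x => if y = x then 1 else 0 : Tensor a a) ∈ T.proc a a
  seq : ∀ {α β γ : Type} [Fintype α] [Fintype β] [Fintype γ]
    (a : α → Sys σ) (b : β → Sys σ) (c : γ → Sys σ) (N : Tensor b c) (M : Tensor a b),
    N ∈ T.proc b c → M ∈ T.proc a b → seqComp N M ∈ T.proc a c
  par : ∀ {α β α' β' : Type} [Fintype α] [Fintype β] [Fintype α'] [Fintype β']
    (a : α → Sys σ) (b : β → Sys σ) (a' : α' → Sys σ) (b' : β' → Sys σ)
    (M : Tensor a b) (M' : Tensor a' b'), M ∈ T.proc a b → M' ∈ T.proc a' b' →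
    parComp M M' ∈ T.proc (Sum.elim a a') (Sum.elim b b')
  stochastic : ∀ {α β : Type} [Fintype α] [Fintype β] (n : α → ℕ) (m : β → ℕ)
    (M : Tensor (fun i => (Sys.cl (n i) : Sys σ)) (fun j => (Sys.cl (m j) : Sys σ))),
    (∀ y x, 0 ≤ M y x) → (∀ x, ∑ y, M y x = 1) →
      M ∈ T.proc (fun i => Sys.cl (n i)) (fun j => Sys.cl (m j))
  control : ∀ {α β : Type} [Fintype α] [Fintype β] (n : ℕ) (a : α → Sys σ) (b : β → Sys σ)
    (M : Fin (n + 1) → Tensor a b), (∀ k, M k ∈ T.proc a b) →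
    (fun y x => M (x none) y (fun i => x (some i)) :
      Tensor (fun o : Option α => o.elim (Sys.cl n) a) b) ∈
        T.proc (fun o : Option α => o.elim (Sys.cl n) a) b

theorem OpTheory.IsGPT.closed {σ : Signature} {T : OpTheory σ} (hT : T.IsGPT) : T.Closed where
  reindex := hT.reindex
  ident := hT.ident
  seq := hT.seq
  par := hT.par
  stochastic n m M h1 h2 := (hT.classical n m M).2 ⟨h1, h2⟩
  control := hT.control

namespace OpTheory

variable {σ : Signature} {T : OpTheory σ}

/-- Two families of systems that match along `e` and `f` have label types that are equal only
propositionally. Heterogeneous equality of labels expresses the correspondence without casts; after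
substitution it is the renaming axiom. -/
theorem Reindexable.transport (hT : T.Reindexable) {α β α' β' : Type}
    [Fintype α] [Fintype β] [Fintype α'] [Fintype β'] (e : α' ≃ α) (f : β' ≃ β)
    {a : α → Sys σ} {b : β → Sys σ} {a' : α' → Sys σ} {b' : β' → Sys σ}
    (ha : ∀ i, a' i = a (e i)) (hb : ∀ j, b' j = b (f j))
    {M : Tensor a b} (hM : M ∈ T.proc a b) :
    ∃ N ∈ T.proc a' b', ∀ Y X Y' X', (∀ j, HEq (Y' j) (Y (f j))) →
      (∀ i, HEq (X' i) (X (e i))) → N Y' X' = M Y X := by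
  obtain rfl : a' = fun i => a (e i) := funext ha
  obtain rfl : b' = fun j => b (f j) := funext hb
  have key : ∀ (a₂ : α → Sys σ) (b₂ : β → Sys σ), a₂ = a → b₂ = b →
      ∃ M₂ ∈ T.proc a₂ b₂, ∀ Y X Y₂ X₂, (∀ j, HEq (Y₂ j) (Y j)) →
        (∀ i, HEq (X₂ i) (X i)) → M₂ Y₂ X₂ = M Y X := by
    rintro _ _ rfl rfl
    refine ⟨M, hM, fun Y X Y₂ X₂ h1 h2 => ?_⟩
    rw [funext fun j => eq_of_heq (h1 j), funext fun i => eq_of_heq (h2 i)]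
  obtain ⟨M₂, hM₂, h⟩ := key (fun i => a (e (e.symm i))) (fun j => b (f (f.symm j)))
    (by simp) (by simp)
  refine ⟨_, hT.reindex e.symm f.symm (fun i => a (e i)) (fun j => b (f j)) M₂ hM₂, ?_⟩
  intro Y X Y' X' h1 h2
  refine h _ _ _ _ (fun j => ?_) (fun i => ?_)
  · obtain ⟨j, rfl⟩ := f.surjective j
    exact (congr_arg_heq Y' (f.symm_apply_apply j)).trans (h1 j)
  · obtain ⟨i, rfl⟩ := e.surjective i
    exact (congr_arg_heq X' (e.symm_apply_apply i)).trans (h2 i)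

/-- Every label is matched by one on the other side, so the values on matching labels determine the
tensor. In this form a tensor given by a formula is recognized as an operation. -/
theorem Reindexable.transport_eq (hT : T.Reindexable) {α β α' β' : Type}
    [Fintype α] [Fintype β] [Fintype α'] [Fintype β'] (e : α' ≃ α) (f : β' ≃ β)
    {a : α → Sys σ} {b : β → Sys σ} {a' : α' → Sys σ} {b' : β' → Sys σ}
    (ha : ∀ i, a' i = a (e i)) (hb : ∀ j, b' j = b (f j))
    {M : Tensor a b} (hM : M ∈ T.proc a b) (N : Tensor a' b')
    (hN : ∀ Y X Y' X', (∀ j, HEq (Y' j) (Y (f j))) →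
      (∀ i, HEq (X' i) (X (e i))) → N Y' X' = M Y X) : N ∈ T.proc a' b' := by
  obtain ⟨N', hN', h⟩ := hT.transport e f ha hb hM
  obtain ⟨Θ, hΘ⟩ := Idx.exists_equiv e ha
  obtain ⟨Ξ, hΞ⟩ := Idx.exists_equiv f hb
  convert hN'
  funext Y X
  rw [hN (Ξ Y) (Θ X) Y X (hΞ Y) (hΘ X), h (Ξ Y) (Θ X) Y X (hΞ Y) (hΘ X)]

namespace Closed

variable (hT : T.Closed)
include hT

/-- Measuring one system and operating on another one according to the outcome. -/
theorem measure_control {α β α' : Type} [Fintype α] [Fintype β] [Fintype α']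
    {a' : α' → Sys σ} {a : α → Sys σ} {b : β → Sys σ} {n : ℕ}
    {E : Tensor a' (fun _ : Unit => (Sys.cl n : Sys σ))} (hE : E ∈ T.proc a' (fun _ : Unit => Sys.cl n))
    {M : Fin (n + 1) → Tensor a b} (hM : ∀ k, M k ∈ T.proc a b) :
    (fun y x => ∑ k, E (fun _ => k) (fun i => x (.inr i)) * M k y (fun i => x (.inl i)) :
      Tensor (Sum.elim a a') b) ∈ T.proc (Sum.elim a a') b := by
  have h1 := hT.control n a b M hM
  -- The control axiom has the control at `none`; here it moves to the right summand, where the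
  -- measurement outcome arrives.
  have h2 : (fun y x => M (x (.inr ())) y (fun i => x (.inl i)) :
      Tensor (Sum.elim a (fun _ : Unit => (Sys.cl n : Sys σ))) b) ∈ T.proc _ b := by
    refine hT.toReindexable.transport_eq ((Equiv.optionEquivSumPUnit α).symm) (Equiv.refl β)
      ?_ (fun _ => rfl) h1 _ ?_
    · rintro (i | i) <;> rfl
    · intro Y X Y' X' hY hX
      have e1 : X' (.inr ()) = X none := eq_of_heq (hX (.inr ()))
      have e2 : (fun i => X' (.inl i)) = fun i => X (some i) :=
        funext fun i => eq_of_heq (hX (.inl i))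
      have e3 : Y' = Y := funext fun j => eq_of_heq (hY j)
      rw [e1, e2, e3]
  have h3 := hT.seq _ _ _ _ _ h2 (hT.par a a _ _ _ E (hT.ident a) hE)
  convert h3
  rename_i y x
  obtain ⟨⟨x₁, x₂⟩, rfl⟩ := (Idx.joinEquiv a a').surjective x
  simp only [seqComp, Idx.sum_join]
  simp_rw [Idx.sum_unit]
  refine Eq.trans ?_ (Finset.sum_eq_single x₁ ?_ ?_).symm
  · refine Finset.sum_congr rfl fun k _ => ?_
    change E (fun _ => k) x₂ * M k y x₁ =
      M k y x₁ * ((if x₁ = x₁ then 1 else 0) * E (fun _ => k) x₂)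
    rw [if_pos rfl, one_mul, mul_comm]
  · intro z _ hz
    refine Finset.sum_eq_zero fun k _ => ?_
    change M k y z * ((if z = x₁ then 1 else 0) * E (fun _ => k) x₂) = 0
    rw [if_neg hz, zero_mul, mul_zero]
  · exact fun h => absurd (Finset.mem_univ _) h

/-- A random choice between operations. -/
theorem mix {α β : Type} [Fintype α] [Fintype β] {a : α → Sys σ} {b : β → Sys σ}
    {G : Type} [Fintype G] [Nonempty G] {M : G → Tensor a b} (hM : ∀ g, M g ∈ T.proc a b) :
    (fun y x => (Fintype.card G : ℝ)⁻¹ * ∑ g, M g y x : Tensor a b) ∈ T.proc a b := by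
  -- The system `cl n` has `n + 1` levels, so the random element of `G` needs `n` one below the
  -- order. The randomness is a measurement of no system with uniformly distributed outcome.
  obtain ⟨n, hn⟩ := Nat.exists_eq_succ_of_ne_zero (Fintype.card_ne_zero (α := G))
  let ε : Fin (n + 1) ≃ G := (Fintype.equivFinOfCardEq hn).symm
  have hE := hT.stochastic (fun i : Empty => (i.elim : ℕ)) (fun _ : Unit => n)
    (fun _ _ => (Fintype.card G : ℝ)⁻¹) (fun _ _ => by positivity)
    (fun _ => by
      rw [Idx.sum_unit, Finset.sum_const, nsmul_eq_mul]
      change ((Fintype.card (Fin (n + 1)) : ℕ) : ℝ) * _ = 1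
      rw [Fintype.card_fin, hn]
      field_simp)
  refine hT.toReindexable.transport_eq (Equiv.sumEmpty α Empty).symm (Equiv.refl β)
    (fun _ => rfl) (fun _ => rfl) (hT.measure_control hE fun k => hM (ε k)) _ ?_
  intro Y X Y' X' hY hX
  rw [show Y' = Y from funext fun j => eq_of_heq (hY j),
    show X' = fun i => X (.inl i) from funext fun i => eq_of_heq (hX i), ← Finset.mul_sum,
    ← ε.sum_comp]
  rfl

/-- Independent copies of an operation. -/
theorem power {α β : Type} [Fintype α] [Fintype β] {a : α → Sys σ} {b : β → Sys σ}
    {M : Tensor a b} (hM : M ∈ T.proc a b) (Q : Type) [Fintype Q] :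
    (fun y x => ∏ q : Q, M (fun j => y (q, j)) (fun i => x (q, i)) :
      Tensor (fun p : Q × α => a p.2) (fun p : Q × β => b p.2)) ∈ T.proc _ _ := by
  refine Fintype.induction_empty_option (P := fun Q _ =>
    (fun y x => ∏ q : Q, M (fun j => y (q, j)) (fun i => x (q, i)) :
      Tensor (fun p : Q × α => a p.2) (fun p : Q × β => b p.2)) ∈ T.proc _ _) ?_ ?_ ?_ Q
  · intro Q Q' _ e ih
    let _ := Fintype.ofEquiv Q' e.symm
    refine hT.toReindexable.transport_eq (Equiv.prodCongr e.symm (Equiv.refl α))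
      (Equiv.prodCongr e.symm (Equiv.refl β)) (fun _ => rfl) (fun _ => rfl) ih _ ?_
    intro Y X Y' X' hY hX
    rw [← e.symm.prod_comp]
    refine Finset.prod_congr rfl fun q _ => ?_
    congr 1
    · exact funext fun j => eq_of_heq (hY (q, j))
    · exact funext fun i => eq_of_heq (hX (q, i))
  · refine hT.toReindexable.transport_eq (Equiv.equivOfIsEmpty _ PEmpty)
      (Equiv.equivOfIsEmpty _ PEmpty) (fun i => isEmptyElim i.1) (fun j => isEmptyElim j.1)
      (hT.stochastic (fun i : PEmpty => (i.elim : ℕ)) (fun i : PEmpty => (i.elim : ℕ))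
        (fun _ _ => 1) (fun _ _ => zero_le_one) fun x => ?_) _ ?_
    · rw [Idx.sum_isEmpty _ fun i => i.elim]
    · intros
      simp
  · intro Q _ ih
    refine hT.toReindexable.transport_eq (α := α ⊕ Q × α) (β := β ⊕ Q × β)
      optionProdEquiv optionProdEquiv ?_ ?_ (hT.par _ _ _ _ _ _ hM ih) _ ?_
    · rintro ⟨_ | q, i⟩ <;> rfl
    · rintro ⟨_ | q, i⟩ <;> rfl
    · intro Y X Y' X' hY hX
      rw [Fintype.prod_option]
      simp only [parComp]
      congr 1
      · congr 1
        · exact funext fun j => eq_of_heq (hY (none, j))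
        · exact funext fun i => eq_of_heq (hX (none, i))
      · refine Finset.prod_congr rfl fun q _ => ?_
        congr 1
        · exact funext fun j => eq_of_heq (hY (some q, j))
        · exact funext fun i => eq_of_heq (hX (some q, i))

end Closed

end OpTheory

/-! ## Symmetries, twirling and frames -/

section Collective

variable {σ : Signature} {T : OpTheory σ} {G : Type} [Group G] {F : SymAction σ G}

omit [Group G] in
theorem collective_join {α β : Type} [Fintype α] [Fintype β] {a : α → Sys σ} {b : β → Sys σ}
    (g : G) (y x : Idx a) (y' x' : Idx b) :
    collective F g (Sum.elim a b) (Idx.join y y') (Idx.join x x') =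
      collective F g a y x * collective F g b y' x' := by
  rw [collective, Fintype.prod_sum_type]
  rfl

theorem Idx.sum_power {α P : Type} [Fintype α] [Fintype P] {a : α → Sys σ}
    (f : P → Idx a → ℝ) :
    ∑ Z : Idx (fun p : P × α => a p.2), ∏ p, f p (fun j => Z (p, j)) = ∏ p, ∑ w, f p w := by
  rw [Finset.prod_univ_sum, Fintype.piFinset_univ]
  exact Fintype.sum_equiv (ι := Idx (fun p : P × α => a p.2)) (κ := P → Idx a)
    ⟨fun Z p j => Z (p, j), fun Z p => Z p.1 p.2, fun _ => rfl, fun _ => rfl⟩ _ _ fun _ => rfl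

omit [Group G] in
theorem collective_power {ι P : Type} [Fintype ι] [Fintype P] {r : ι → Sys σ} (g : G)
    (z w : Idx fun p : P × ι => r p.2) :
    collective F g (fun p : P × ι => r p.2) z w =
      ∏ p, collective F g r (fun j => z (p, j)) (fun j => w (p, j)) :=
  Fintype.prod_prod_type _

variable (hF : IsSymmetry T F)
include hF

theorem collective_one {α : Type} [Fintype α] (a : α → Sys σ) :
    collective F 1 a = fun y x => if y = x then 1 else 0 := by
  funext y x
  simp only [collective, hF.one]
  rw [Finset.prod_ite_zero]
  simp [Idx.ext_iff]

theorem collective_mul {α : Type} [Fintype α] (a : α → Sys σ) (g h : G) :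
    seqComp (collective F g a) (collective F h a) = collective F (g * h) a := by
  funext y x
  simp only [collective, seqComp, hF.mul, ← Finset.prod_mul_distrib]
  exact Idx.sum_prod_apply fun i z => F g (a i) (y i) z * F h (a i) z (x i)

/-- A conjugate of the discarding effect is a deterministic effect, hence discarding itself by
uniqueness. Conjugation by `g⁻¹` composes the effect with `F g`. -/
theorem IsSymmetry.sum_disc (hT : T.IsGPT) (g : G) (A : Sys σ) (x : A.ix) :
    ∑ y, T.disc A y * F g A y x = T.disc A x := by
  have h1 := (hT.discard (fun _ : Unit => A) (fun i : Empty => (i.elim : Sys σ)) _).2 rfl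
  have h2 := (hT.discard (fun _ : Unit => A) (fun i : Empty => (i.elim : Sys σ)) _).1
    (hF.conj g⁻¹ _ _ _ h1)
  have h3 := congrFun (congrFun h2 fun i => i.elim) fun _ => x
  simp only [seqComp, Idx.sum_unit, inv_inv] at h3
  rw [Idx.sum_isEmpty _ fun i => i.elim] at h3
  simpa [collective] using h3

end Collective

/-! ### Conjugation and twirling of operations. -/

section Twirl

variable {σ : Signature} {T : OpTheory σ} {G : Type} [Group G] {F : SymAction σ G}
  {α β : Type} [Fintype α] [Fintype β] {a : α → Sys σ} {b : β → Sys σ}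

/-- Conjugation by the collective action. -/
noncomputable def conjOp (F : SymAction σ G) (g : G) (M : Tensor a b) : Tensor a b :=
  seqComp (collective F g b) (seqComp M (collective F g⁻¹ a))

/-- Averaging over all conjugates. -/
noncomputable def twirlOp [Fintype G] (F : SymAction σ G) (M : Tensor a b) : Tensor a b :=
  fun y x => (Fintype.card G : ℝ)⁻¹ * ∑ g, conjOp F g M y x

theorem twirlOp_seqComp [Fintype G] {γ : Type} {c : γ → Sys σ} (M : Tensor a b) (N : Tensor c a) :
    seqComp (twirlOp F M) N =
      fun y x => (Fintype.card G : ℝ)⁻¹ * ∑ g, seqComp (conjOp F g M) N y x := by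
  funext y x
  simp only [seqComp, twirlOp, mul_assoc, ← Finset.mul_sum, Finset.sum_mul]
  rw [Finset.sum_comm]

theorem seqComp_twirlOp [Fintype G] {γ : Type} {c : γ → Sys σ} (M : Tensor a b) (N : Tensor b c) :
    seqComp N (twirlOp F M) =
      fun y x => (Fintype.card G : ℝ)⁻¹ * ∑ g, seqComp N (conjOp F g M) y x := by
  funext y x
  simp only [seqComp, twirlOp, mul_left_comm _ (Fintype.card G : ℝ)⁻¹, ← Finset.mul_sum]
  rw [Finset.sum_comm]
  simp only [Finset.mul_sum]

theorem conjOp_one (hF : IsSymmetry T F) (M : Tensor a b) : conjOp F 1 M = M := by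
  simp only [conjOp, inv_one, collective_one hF, seqComp_one, one_seqComp]

/-- Moving a rotation through a conjugate shifts its label by `g⁻¹`. The average over all labels
does not see the shift, which is why twirled operations are covariant. -/
theorem conjOp_seqComp_collective (hF : IsSymmetry T F) (g h : G) (M : Tensor a b) :
    seqComp (conjOp F h M) (collective F g a) =
      seqComp (collective F g b) (conjOp F (g⁻¹ * h) M) := by
  simp only [conjOp, ← seqComp_assoc, collective_mul hF]
  simp only [seqComp_assoc, collective_mul hF]
  simp

theorem isCovariant_twirlOp [Fintype G] (hF : IsSymmetry T F) (M : Tensor a b) :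
    IsCovariant F (twirlOp F M) := by
  intro g
  rw [twirlOp_seqComp, seqComp_twirlOp]
  simp only [conjOp_seqComp_collective hF]
  funext y x
  congr 1
  exact Fintype.sum_equiv (Equiv.mulLeft g⁻¹) _ _ fun _ => rfl

theorem twirlOp_mem_swirl [Fintype G] (hT : T.Closed) (hF : IsSymmetry T F) {M : Tensor a b}
    (hM : M ∈ T.proc a b) : twirlOp F M ∈ (swirl T F).proc a b :=
  ⟨hT.mix fun g => hF.conj g a b M hM, isCovariant_twirlOp hF M⟩

end Twirl

/-- A perfect reference frame: the states `F h ω` are perfectly distinguished by `m`. -/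
structure IsPerfectFrame {σ : Signature} (T : OpTheory σ) {G : Type} [Group G] (F : SymAction σ G)
    {ι : Type} [Fintype ι] (r : ι → Sys σ) {N : ℕ} (ω : Idx r → ℝ)
    (m : Tensor r (fun _ : Unit => (Sys.cl N : Sys σ))) (lab : G → Fin (N + 1)) : Prop where
  state_mem : (fun y _ => ω y : Tensor (fun i : Empty => (i.elim : Sys σ)) r) ∈ T.proc _ r
  meas_mem : m ∈ T.proc r _
  meas_eq : ∀ (h : G) (k : Fin (N + 1)),
    ∑ z, m (fun _ => k) z * ∑ w, collective F h r z w * ω w = if k = lab h then 1 else 0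
  eq_of_lab : ∀ g h, lab g = lab h → F g = F h
  disc_eq : ∑ z : Idx r, (∏ j, T.disc (r j) (z j)) * ω z = 1

/-! ### Simulating a single gate with frames on its wires. -/

section Frame

variable {σ : Signature} {T : OpTheory σ} {G : Type} [Group G] {F : SymAction σ G}
  {ι : Type} [Fintype ι] {r : ι → Sys σ} {N : ℕ} {ω : Idx r → ℝ}
  {m : Tensor r (fun _ : Unit => (Sys.cl N : Sys σ))} {lab : G → Fin (N + 1)}

/-- The frame state rotated by `g`. -/
noncomputable def frameState (F : SymAction σ G) (ω : Idx r → ℝ) (g : G) : Idx r → ℝ :=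
  fun z => ∑ w, collective F g r z w * ω w

theorem collective_frameState (hF : IsSymmetry T F) (g h : G) (z : Idx r) :
    ∑ w, collective F g r z w * frameState F ω h w = frameState F ω (g * h) z := by
  simp only [frameState, ← collective_mul hF, seqComp, Finset.mul_sum, Finset.sum_mul]
  rw [Finset.sum_comm]
  simp only [mul_assoc]

theorem sum_disc_frameState (hω : IsPerfectFrame T F r ω m lab)
    (hd : ∀ g A x, ∑ y, T.disc A y * F g A y x = T.disc A x) (g : G) :
    ∑ z : Idx r, (∏ j, T.disc (r j) (z j)) * frameState F ω g z = 1 := by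
  simp only [frameState, Finset.mul_sum]
  rw [Finset.sum_comm, ← hω.disc_eq]
  refine Finset.sum_congr rfl fun w _ => ?_
  simp only [← mul_assoc, ← Finset.sum_mul, collective, ← Finset.prod_mul_distrib]
  rw [Idx.sum_prod_apply fun j z => T.disc (r j) z * F g (r j) z (w j)]
  simp only [hd]

/-- Rotating a composite system and attaching rotated frame states. -/
noncomputable def attach (F : SymAction σ G) (ω : Idx r → ℝ) (g : G) {α : Type} [Fintype α]
    (a : α → Sys σ) (P : Type) [Fintype P] :
    Tensor a (Sum.elim a fun p : P × ι => r p.2) :=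
  fun Z x => collective F g a (fun i => Z (.inl i)) x *
    ∏ p, frameState F ω g fun j => Z (.inr (p, j))

variable {α β : Type} [Fintype α] [Fintype β] {a : α → Sys σ} {b : β → Sys σ}
  {P Q : Type} [Fintype P] [Fintype Q]

/-- Rotating the system together with its frames only changes the common orientation, by the
representation property applied to each tensor factor. -/
theorem collective_attach (hF : IsSymmetry T F) (g h : G) :
    seqComp (collective F h _) (attach F ω g a P) = attach F ω (h * g) a P := by
  funext Z x
  obtain ⟨z₁, z₂, rfl⟩ := Idx.exists_join Z
  simp only [seqComp, Idx.sum_join, attach, Idx.join_inl, Idx.join_inr, collective_join]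
  have h1 : ∀ (y : Idx a) (w : Idx fun p : P × ι => r p.2),
      collective F h a z₁ y * collective F h _ z₂ w *
        (collective F g a y x * ∏ p, frameState F ω g fun j => w (p, j)) =
      (collective F h a z₁ y * collective F g a y x) *
        ∏ p, (collective F h r (fun j => z₂ (p, j)) (fun j => w (p, j)) *
          frameState F ω g fun j => w (p, j)) := by
    intro y w
    rw [Finset.prod_mul_distrib, collective_power]
    ring
  refine (Finset.sum_congr rfl fun y _ => Finset.sum_congr rfl fun w _ => h1 y w).trans ?_
  simp only [← Finset.mul_sum, ← Finset.sum_mul]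
  congr 1
  · exact congrFun (congrFun (collective_mul hF a h g) z₁) x
  · rw [Idx.sum_power (fun p w => collective F h r (fun j => z₂ (p, j)) w * frameState F ω g w)]
    exact Finset.prod_congr rfl fun p _ => collective_frameState hF h g fun j => z₂ (p, j)

theorem conjOp_attach (hF : IsSymmetry T F) (g h : G)
    (M : Tensor (Sum.elim a fun p : P × ι => r p.2) (Sum.elim b fun p : Q × ι => r p.2)) :
    seqComp (conjOp F h M) (attach F ω g a P) =
      seqComp (collective F h _) (seqComp M (attach F ω (h⁻¹ * g) a P)) := by
  simp only [conjOp, seqComp_assoc, collective_attach hF]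

omit [Group G] [Fintype α] in
theorem attach_seqComp (g : G) (op : Tensor a b) (y : Idx b)
    (w : Idx fun p : Q × ι => r p.2) (x : Idx a) :
    seqComp (attach F ω g b Q) op (Idx.join y w) x =
      seqComp (collective F g b) op y x * ∏ q, frameState F ω g fun j => w (q, j) := by
  simp only [seqComp, attach, Finset.sum_mul]
  refine Finset.sum_congr rfl fun z _ => ?_
  simp only [Idx.join_inl, Idx.join_inr]
  ring

/-- Preparing frame states next to an operation. -/
theorem OpTheory.Closed.prepare_frames (hT : T.Closed) {op : Tensor a b} (hop : op ∈ T.proc a b)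
    {ω : Idx r → ℝ}
    (hω : (fun y _ => ω y : Tensor (fun i : Empty => (i.elim : Sys σ)) r) ∈ T.proc _ r)
    (Q : Type) [Fintype Q] :
    (fun y x => op (fun j => y (.inl j)) x * ∏ q, ω fun j => y (.inr (q, j)) :
      Tensor a (Sum.elim b fun p : Q × ι => r p.2)) ∈ T.proc _ _ := by
  refine hT.toReindexable.transport_eq (Equiv.sumEmpty α (Q × Empty)).symm (Equiv.refl _)
    (fun _ => rfl) (fun _ => rfl) (hT.par _ _ _ _ _ _ hop (hT.power hω Q)) _ ?_
  intro Y X Y' X' hY hX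
  rw [show Y' = Y from funext fun j => eq_of_heq (hY j),
    show X' = fun i => X (.inl i) from funext fun i => eq_of_heq (hX i)]
  rfl

theorem frameState_mem (hF : IsSymmetry T F) (hω : IsPerfectFrame T F r ω m lab) (g : G) :
    (fun y _ => frameState F ω g y : Tensor (fun i : Empty => (i.elim : Sys σ)) r) ∈
      T.proc _ r := by
  have h := hF.conj g _ _ _ hω.state_mem
  convert h
  rename_i y x
  simp only [seqComp, frameState]
  refine Finset.sum_congr rfl fun w _ => ?_
  rw [Idx.sum_isEmpty _ x]
  simp [collective]

/-- A gate with an incoming frame simulates an operation. -/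
theorem exists_intertwining_of_frame (hT : T.Closed) (hF : IsSymmetry T F)
    (hω : IsPerfectFrame T F r ω m lab) {op : Tensor a b} (hop : op ∈ T.proc a b)
    (p₀ : P) :
    ∃ M ∈ T.proc (Sum.elim a fun p : P × ι => r p.2) (Sum.elim b fun p : Q × ι => r p.2),
      ∀ g, seqComp M (attach F ω g a P) = seqComp (attach F ω g b Q) op := by
  -- All incoming frames have to be consumed, so all are measured; only the outcome at `p₀` is kept.
  let sel : Tensor (fun _ : P × Unit => (Sys.cl N : Sys σ)) (fun _ : Unit => (Sys.cl N : Sys σ)) :=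
    fun k K => if k () = K (p₀, ()) then 1 else 0
  have hsel : sel ∈ T.proc _ _ := by
    refine hT.stochastic (fun _ => N) (fun _ => N) sel (fun y x => ?_) fun x => ?_
    · simp only [sel]; split_ifs <;> norm_num
    · rw [Idx.sum_unit]
      simp [sel]
  -- The measurement tells group elements apart only up to equality of their action, so `rep`
  -- recovers `g` up to `F`, which suffices.
  let rep : Fin (N + 1) → G := fun k => if h : ∃ g, lab g = k then h.choose else 1
  have hrep : ∀ g, F (rep (lab g)) = F g := by
    intro g
    have h : ∃ g', lab g' = lab g := ⟨g, rfl⟩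
    apply hω.eq_of_lab
    simp only [rep, dif_pos h]
    exact h.choose_spec
  have hE := hT.seq _ _ _ _ _ hsel (hT.power hω.meas_mem P)
  -- On outcome `k` the conjugate of `op` is applied and fresh frames of the orientation just found
  -- are prepared.
  have hM := hT.measure_control hE fun k =>
    hT.prepare_frames (hF.conj (rep k) _ _ _ hop) (frameState_mem hF hω (rep k)) Q
  refine ⟨_, hM, fun g => ?_⟩
  -- On frames of orientation `g` the outcome is `lab g` with certainty.
  have hmeas : ∀ k : Fin (N + 1), ∑ z : Idx fun p : P × ι => r p.2,
      seqComp sel (fun y x => ∏ p : P, m (fun j => y (p, j)) (fun i => x (p, i))) (fun _ => k) z *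
        ∏ p, frameState F ω g (fun j => z (p, j)) = if k = lab g then 1 else 0 := by
    intro k
    simp only [seqComp, Finset.sum_mul]
    rw [Finset.sum_comm]
    let c : Idx fun _ : P × Unit => (Sys.cl N : Sys σ) := fun _ => lab g
    have h1 : ∀ K : Idx fun _ : P × Unit => (Sys.cl N : Sys σ),
        ∑ z : Idx fun p : P × ι => r p.2,
          sel (fun _ => k) K * (∏ p, m (fun j => K (p, j)) fun i => z (p, i)) *
            ∏ p, frameState F ω g (fun j => z (p, j)) =
          if K = c then sel (fun _ => k) K else 0 := by
      intro K
      simp only [mul_assoc, ← Finset.prod_mul_distrib, ← Finset.mul_sum]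
      rw [Idx.sum_power fun p w => m (fun j => K (p, j)) w * frameState F ω g w]
      have h2 : ∀ p, ∑ w, m (fun j => K (p, j)) w * frameState F ω g w =
          if K (p, ()) = c (p, ()) then 1 else 0 :=
        fun p => (hω.meas_eq g (K (p, ()))).trans <| by
          by_cases e : K (p, ()) = c (p, ())
          · exact (if_pos e).trans (if_pos e).symm
          · exact (if_neg e).trans (if_neg e).symm
      simp only [h2]
      rw [Finset.prod_ite_zero]
      simp only [Finset.prod_const_one, mul_ite, mul_one, mul_zero, Finset.mem_univ, true_imp_iff]
      exact if_congr ⟨fun h => funext fun p => h p.1, fun h i => congrFun h (i, ())⟩ rfl rfl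
    rw [Finset.sum_congr rfl fun K _ => h1 K, Finset.sum_ite_eq' Finset.univ,
      if_pos (Finset.mem_univ _)]
    exact if_congr Iff.rfl rfl rfl
  funext Y x
  obtain ⟨y, w, rfl⟩ := Idx.exists_join Y
  rw [attach_seqComp]
  refine (Idx.sum_join _).trans ?_
  set E : Tensor (fun p : P × ι => r p.2) (fun _ : Unit => (Sys.cl N : Sys σ)) :=
    seqComp sel (fun y x => ∏ p : P, m (fun j => y (p, j)) (fun i => x (p, i)))
  change ∑ z₁, ∑ z₂, (∑ k : Fin (N + 1), E (fun _ => k) z₂ * (conjOp F (rep k) op y z₁ *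
    ∏ q, frameState F ω (rep k) fun j => w (q, j))) * (collective F g a z₁ x *
      ∏ p, frameState F ω g fun j => z₂ (p, j)) = _
  have h3 : ∀ z₁, ∑ z₂, (∑ k : Fin (N + 1), E (fun _ => k) z₂ * (conjOp F (rep k) op y z₁ *
      ∏ q, frameState F ω (rep k) fun j => w (q, j))) * (collective F g a z₁ x *
        ∏ p, frameState F ω g fun j => z₂ (p, j)) =
      (conjOp F (rep (lab g)) op y z₁ * collective F g a z₁ x) *
        ∏ q, frameState F ω (rep (lab g)) fun j => w (q, j) := by
    intro z₁
    simp only [Finset.sum_mul]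
    rw [Finset.sum_comm]
    have h4 : ∀ k : Fin (N + 1), ∑ z₂, E (fun _ => k) z₂ * (conjOp F (rep k) op y z₁ *
        ∏ q, frameState F ω (rep k) fun j => w (q, j)) * (collective F g a z₁ x *
          ∏ p, frameState F ω g fun j => z₂ (p, j)) =
        if k = lab g then conjOp F (rep k) op y z₁ * collective F g a z₁ x *
          ∏ q, frameState F ω (rep k) fun j => w (q, j) else 0 := by
      intro k
      rw [← mul_boole, ← hmeas k, Finset.mul_sum]
      exact Finset.sum_congr rfl fun z₂ _ => by ring
    rw [Finset.sum_congr rfl fun k _ => h4 k, Finset.sum_ite_eq', if_pos (Finset.mem_univ _)]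
  rw [Finset.sum_congr rfl fun z₁ _ => h3 z₁, ← Finset.sum_mul]
  have h5 : frameState F ω (rep (lab g)) = frameState F ω g := by
    funext z
    simp only [frameState, collective, hrep]
  have h6 : ∀ {γ : Type} [Fintype γ] (c : γ → Sys σ),
      collective F g c = collective F (rep (lab g)) c := by
    intro γ _ c
    funext z z'
    simp only [collective, hrep]
  rw [h5]
  congr 1
  -- Conjugating by the rotation that acts on the input makes the gate act as `op` in the rotated
  -- coordinates.
  have h7 := conjOp_seqComp_collective hF (rep (lab g)) (rep (lab g)) op
  rw [inv_mul_cancel, conjOp_one hF] at h7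
  rw [h6, h6, ← h7]
  rfl

/-- A gate without incoming frames simulates an operation, up to an unknown rotation. -/
theorem exists_intertwining_of_isEmpty (hT : T.Closed) (hF : IsSymmetry T F)
    (hω : IsPerfectFrame T F r ω m lab) {op : Tensor a b} (hop : op ∈ T.proc a b) [IsEmpty P] :
    ∃ M ∈ T.proc (Sum.elim a fun p : P × ι => r p.2) (Sum.elim b fun p : Q × ι => r p.2),
      seqComp M (attach F ω 1 a P) = seqComp (attach F ω 1 b Q) op ∧
      ((∀ g, collective F g a = collective F 1 a) → (∀ g, collective F g b = collective F 1 b) →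
        IsEmpty Q → ∀ g, seqComp M (attach F ω g a P) = seqComp (attach F ω g b Q) op) := by
  -- No frame tells an orientation, so the neutral one is used: `op` is applied as it is, next to
  -- unrotated frames.
  have h1 : (fun y x => op (fun j => y (.inl j)) (fun i => x (.inl i)) *
      ∏ q, frameState F ω 1 fun j => y (.inr (q, j)) :
      Tensor (Sum.elim a fun p : P × ι => r p.2) (Sum.elim b fun p : Q × ι => r p.2)) ∈
        T.proc _ _ := by
    refine hT.toReindexable.transport_eq (Equiv.sumEmpty α (P × ι)) (Equiv.refl _) ?_
      (fun _ => rfl) (hT.prepare_frames hop (frameState_mem hF hω 1) Q) _ ?_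
    · rintro (i | i)
      · rfl
      · exact isEmptyElim i.1
    · intro Y X Y' X' hY hX
      rw [show Y' = Y from funext fun j => eq_of_heq (hY j),
        show (fun i => X' (.inl i)) = X from funext fun i => eq_of_heq (hX (.inl i))]
  have h2 : seqComp (fun y x => op (fun j => y (.inl j)) (fun i => x (.inl i)) *
      ∏ q, frameState F ω 1 fun j => y (.inr (q, j)) :
      Tensor (Sum.elim a fun p : P × ι => r p.2) (Sum.elim b fun p : Q × ι => r p.2))
        (attach F ω 1 a P) = seqComp (attach F ω 1 b Q) op := by
    funext Y x
    obtain ⟨y, w, rfl⟩ := Idx.exists_join Y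
    rw [attach_seqComp, collective_one hF, one_seqComp]
    refine (Idx.sum_join _).trans ?_
    simp only [attach, collective_one hF, Finset.univ_eq_empty, Finset.prod_empty, mul_one]
    have h3 : ∀ z : Idx a, ∑ z' : Idx fun p : P × ι => r p.2,
        (op y z * ∏ q, frameState F ω 1 fun j => w (q, j)) * (if z = x then 1 else 0) =
        if z = x then op y x * ∏ q, frameState F ω 1 fun j => w (q, j) else 0 := by
      intro z
      rw [Idx.sum_isEmpty _ fun i => isEmptyElim i.1]
      split_ifs with h
      · rw [h, mul_one]
      · rw [mul_zero]
    exact (Finset.sum_congr rfl fun z _ => h3 z).trans (by simp)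
  -- With trivial action on both sides and no frames at all, `attach` is the same for all
  -- orientations.
  refine ⟨_, h1, h2, fun ha hb _ g => ?_⟩
  rw [show attach F ω g a P = attach F ω 1 a P by
      funext Z x
      simp [attach, ha g],
    show attach F ω g b Q = attach F ω 1 b Q by
      funext Z x
      simp [attach, hb g]]
  exact h2

/-- A gate that simulates an operation for every orientation of the frames. -/
theorem exists_covariant_intertwining [Fintype G] (hT : T.Closed) (hF : IsSymmetry T F)
    {op : Tensor a b}
    {M : Tensor (Sum.elim a fun p : P × ι => r p.2) (Sum.elim b fun p : Q × ι => r p.2)}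
    (hM : M ∈ T.proc _ _)
    (h : ∀ g, seqComp M (attach F ω g a P) = seqComp (attach F ω g b Q) op) :
    ∃ q ∈ (swirl T F).proc (Sum.elim a fun p : P × ι => r p.2)
        (Sum.elim b fun p : Q × ι => r p.2),
      ∀ g, seqComp q (attach F ω g a P) = seqComp (attach F ω g b Q) op := by
  refine ⟨twirlOp F M, twirlOp_mem_swirl hT hF hM, fun g => ?_⟩
  rw [twirlOp_seqComp]
  -- The conjugate by `h` turns orientation `g` into `h⁻¹ * g`, simulates there and rotates back.
  -- Hence every term of the twirl equals the desired composite.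
  simp only [conjOp_attach hF, h, ← seqComp_assoc, collective_attach hF, mul_inv_cancel_left]
  funext y x
  simp

/-- What a simulation of the operation `op` consists of: the simulating operation `q` is a uniform
mixture of operations `Q g` that simulate `op` for the orientation `g` of the frames. -/
def IsSimulation [Fintype G] (T : OpTheory σ) (F : SymAction σ G) (ω : Idx r → ℝ)
    (op : Tensor a b)
    (q : Tensor (Sum.elim a fun p : P × ι => r p.2) (Sum.elim b fun p : Q × ι => r p.2))
    (qs : G → Tensor (Sum.elim a fun p : P × ι => r p.2) (Sum.elim b fun p : Q × ι => r p.2)) :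
    Prop :=
  q ∈ (swirl T F).proc _ _ ∧ (∀ y x, q y x = (Fintype.card G : ℝ)⁻¹ * ∑ g, qs g y x) ∧
    ∀ g, seqComp (qs g) (attach F ω g a P) = seqComp (attach F ω g b Q) op

/-- Every operation has a simulation, which does not depend on the orientation unless the gate is
a source of frames. -/
theorem exists_isSimulation [Fintype G] (hT : T.Closed) (hF : IsSymmetry T F)
    (hω : IsPerfectFrame T F r ω m lab) {op : Tensor a b} (hop : op ∈ T.proc a b)
    (ha : IsEmpty P → ∀ g, collective F g a = collective F 1 a)
    (hb : IsEmpty Q → ∀ g, collective F g b = collective F 1 b) :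
    ∃ (q : Tensor (Sum.elim a fun p : P × ι => r p.2) (Sum.elim b fun p : Q × ι => r p.2))
      (qs : G → Tensor (Sum.elim a fun p : P × ι => r p.2) (Sum.elim b fun p : Q × ι => r p.2)),
      IsSimulation T F ω op q qs ∧ ((Nonempty P ∨ IsEmpty Q) → ∀ g, qs g = q) := by
  have hgood : ∀ M ∈ T.proc (Sum.elim a fun p : P × ι => r p.2)
      (Sum.elim b fun p : Q × ι => r p.2),
      (∀ g, seqComp M (attach F ω g a P) = seqComp (attach F ω g b Q) op) →
      ∃ (q : Tensor (Sum.elim a fun p : P × ι => r p.2) (Sum.elim b fun p : Q × ι => r p.2))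
      (qs : G → Tensor (Sum.elim a fun p : P × ι => r p.2) (Sum.elim b fun p : Q × ι => r p.2)),
      IsSimulation T F ω op q qs ∧ ((Nonempty P ∨ IsEmpty Q) → ∀ g, qs g = q) := by
    intro M hM h
    obtain ⟨q, hq, hq'⟩ := exists_covariant_intertwining hT hF hM h
    exact ⟨q, fun _ => q, ⟨hq, fun y x => by simp, hq'⟩, fun _ _ => rfl⟩
  rcases isEmpty_or_nonempty P with hP | ⟨⟨p₀⟩⟩
  · obtain ⟨M, hM, h1, h2⟩ := exists_intertwining_of_isEmpty (P := P) (Q := Q) hT hF hω hop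
    rcases isEmpty_or_nonempty Q with hQ | hQ
    · exact hgood M hM (h2 (ha hP) (hb hQ) hQ)
    -- A source of frames: `M` simulates for orientation `1`, so its conjugate by `g` simulates for
    -- orientation `g`, and the twirl is the uniform mixture of these conjugates.
    · refine ⟨twirlOp F M, fun g => conjOp F g M, ⟨twirlOp_mem_swirl hT hF hM, fun _ _ => rfl,
        fun g => ?_⟩, ?_⟩
      · rw [conjOp_attach hF, inv_mul_cancel, h1, ← seqComp_assoc, collective_attach hF, mul_one]
      · rintro (h | h)
        · exact absurd hP (not_isEmpty_iff.2 h)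
        · exact absurd h (not_isEmpty_iff.2 hQ)
  · obtain ⟨M, hM, h⟩ := exists_intertwining_of_frame (P := P) (Q := Q) hT hF hω hop p₀
    exact hgood M hM h

end Frame

/-! ## Intertwining of circuits -/

theorem sum_prod_pi {B K : Type} [Fintype B] [Fintype K] {_ : Fintype (B → K)}
    (f : B → K → ℝ) : ∑ w : B → K, ∏ e, f e (w e) = ∏ e, ∑ w, f e w := by
  rw [Finset.prod_univ_sum, Fintype.piFinset_univ]
  refine Finset.sum_congr ?_ fun _ _ => rfl
  ext
  simp

namespace CausalStructure

/-- The wire enters the gate. -/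
def Into (C : CausalStructure) (v : C.Gate) (e : C.GW) : Prop := C.gtgt e = some v

/-- The wire leaves the gate. -/
def From (C : CausalStructure) (v : C.Gate) (e : C.GW) : Prop := C.gsrc e = v

/-- The wire is open. -/
def Ends (C : CausalStructure) (e : C.GW) : Prop := C.gtgt e = none

end CausalStructure

/-- The rank is the number of ancestors. It grows along every link, since by acyclicity a gate is
not its own ancestor. -/
theorem CausalStructure.exists_rank (C : CausalStructure) :
    ∃ ρ : C.Gate → ℕ, ∀ u w : C.Gate, ((∃ e, C.gsrc e = u ∧ C.gtgt e = some w) ∨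
      (∃ l, C.lsrc l = u ∧ w ∈ C.lread l) ∨ (∃ o, C.osrc o = some u ∧ w ∈ C.oread o)) →
        ρ u < ρ w := by
  set R := fun u w : C.Gate => (∃ e, C.gsrc e = u ∧ C.gtgt e = some w) ∨
      (∃ l, C.lsrc l = u ∧ w ∈ C.lread l) ∨ (∃ o, C.osrc o = some u ∧ w ∈ C.oread o) with hR
  refine ⟨fun w => (Finset.univ.filter fun u => Relation.TransGen R u w).card, fun u w h => ?_⟩
  apply Finset.card_lt_card
  rw [Finset.ssubset_iff_of_subset]
  · exact ⟨u, Finset.mem_filter.2 ⟨Finset.mem_univ _, Relation.TransGen.single h⟩,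
      fun h' => C.acyclic u (Finset.mem_filter.1 h').2⟩
  · intro t ht
    simp only [Finset.mem_filter, Finset.mem_univ, true_and] at ht ⊢
    exact ht.tail h

/-! ### Circuits as networks with a node for the settings and a node for the final evaluation. -/

namespace Labelling

variable {σ : Signature} {C : CausalStructure} (L : Labelling σ C)

/-- The systems that are not processed further: open ones, and the observed variables. -/
def IsFinal : L.Atom → Prop
  | .inl p => C.gtgt p.1 = none
  | .inr (.inl _) => False
  | .inr (.inr _) => True

def IsSetting : L.Atom → Prop
  | .inl _ => False
  | .inr (.inl _) => False
  | .inr (.inr o) => C.osrc o = none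

/-- Gates reading a system or a frame wire; `.inr true` stands for the final evaluation. -/
def netIn : C.Gate ⊕ Bool → L.Atom ⊕ C.GW → Prop
  | .inl v, .inl s => L.IsIn v s
  | .inl v, .inr e => C.Into v e
  | .inr true, .inl s => L.IsFinal s
  | .inr true, .inr e => C.Ends e
  | .inr false, _ => False

/-- Gates emitting a system or a frame wire; `.inr false` stands for the choice of settings. -/
def netOut : C.Gate ⊕ Bool → L.Atom ⊕ C.GW → Prop
  | .inl v, .inl s => L.IsOut v s
  | .inl v, .inr e => C.From v e
  | .inr true, _ => False
  | .inr false, .inl s => L.IsSetting s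
  | .inr false, .inr _ => False

def srcGate : L.Atom ⊕ C.GW → C.Gate ⊕ Bool
  | .inl (.inl p) => .inl (C.gsrc p.1)
  | .inl (.inr (.inl l)) => .inl (C.lsrc l)
  | .inl (.inr (.inr o)) => (C.osrc o).elim (.inr false) .inl
  | .inr e => .inl (C.gsrc e)

theorem netOut_iff (v : C.Gate ⊕ Bool) (s : L.Atom ⊕ C.GW) :
    L.netOut v s ↔ L.srcGate s = v := by
  rcases v with v | _ | _ <;> rcases s with (p | l | o) | e <;>
    simp only [netOut, srcGate, IsOut, CausalStructure.From, IsSetting, Sum.inl.injEq, reduceCtorEq] <;>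
    cases C.osrc o <;> simp

/-- The systems of the circuit together with an additional wire along every latent wire. -/
noncomputable def network : Network (C.Gate ⊕ Bool) (L.Atom ⊕ C.GW) where
  src := L.srcGate
  In := L.netIn
  -- The node of the settings precedes all gates and the evaluation follows them; hence the shift by
  -- one and the supremum plus two.
  rank := Sum.elim (fun v => C.exists_rank.choose v + 1)
    (fun b => if b then Finset.univ.sup C.exists_rank.choose + 2 else 0)
  rank_lt := by
    have h := C.exists_rank.choose_spec
    set ρ := C.exists_rank.choose
    have hle : ∀ v, ρ v ≤ Finset.univ.sup ρ := fun v => Finset.le_sup (Finset.mem_univ v)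
    rintro (v | _ | _) ((p | l | o) | e) hs <;>
      simp only [netIn, IsIn, IsFinal, CausalStructure.Into, CausalStructure.Ends, srcGate, Sum.elim_inl, Sum.elim_inr] at hs ⊢
    · exact Nat.succ_lt_succ (h _ _ (Or.inl ⟨p.1, rfl, hs⟩))
    · exact Nat.succ_lt_succ (h _ _ (Or.inr (Or.inl ⟨l, rfl, hs⟩)))
    · rcases ho : C.osrc o with _ | u
      · simp
      · simp only [Option.elim, Sum.elim_inl]
        exact Nat.succ_lt_succ (h _ _ (Or.inr (Or.inr ⟨o, ho, hs⟩)))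
    · exact Nat.succ_lt_succ (h _ _ (Or.inl ⟨e, rfl, hs⟩))
    · have := hle (C.gsrc p.1)
      simp
      omega
    · rcases ho : C.osrc o with _ | u
      · simp
      · have := hle u
        simp
        omega
    · have := hle (C.gsrc e)
      simp
      omega
  cl
    | .inl (.inl _) => False
    | .inl (.inr _) => True
    | .inr _ => False
  unique := by
    rintro ((p | l | o) | e) (v | _ | _) (w | _ | _) hc hv hw <;> simp_all [netIn, IsIn, IsFinal,
      CausalStructure.Into, CausalStructure.Ends]
  read := by
    rintro ((p | l | o) | e) hc
    · rcases h : C.gtgt p.1 with _ | v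
      · exact ⟨.inr true, h⟩
      · exact ⟨.inl v, h⟩
    · simp at hc
    · simp at hc
    · rcases h : C.gtgt e with _ | v
      · exact ⟨.inr true, h⟩
      · exact ⟨.inl v, h⟩

theorem not_netIn_of_netOut {v : C.Gate ⊕ Bool} {s : L.Atom ⊕ C.GW} (h : L.netOut v s) :
    ¬ L.netIn v s := by
  intro h'
  have := L.network.rank_lt v s h'
  rw [show L.network.src s = v from (L.netOut_iff v s).1 h] at this
  exact lt_irrefl _ this

/-- The values of the wires of the network. -/
def NetVal (K : Type) : L.Atom ⊕ C.GW → Type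
  | .inl s => (L.sysOf s).ix
  | .inr _ => K

noncomputable instance NetVal.fintype (K : Type) [Fintype K] : ∀ s, Fintype (L.NetVal K s)
  | .inl s => inferInstanceAs (Fintype (L.sysOf s).ix)
  | .inr _ => inferInstanceAs (Fintype K)

variable {L} {K K' : Type}

def joinVal (x : Idx L.sysOf) (z : C.GW → K) : ∀ s, L.NetVal K s
  | .inl s => x s
  | .inr e => z e

theorem sum_netVal [Fintype K] {_ : Fintype (∀ s, L.NetVal K s)} (f : (∀ s, L.NetVal K s) → ℝ) :
    ∑ Y, f Y = ∑ y, ∑ w, f (joinVal y w) := by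
  refine Eq.trans ?_ (Fintype.sum_prod_type' fun (y : Idx L.sysOf) (w : C.GW → K) =>
    f (joinVal y w))
  exact Fintype.sum_equiv (κ := Idx L.sysOf × (C.GW → K))
    ⟨fun Y => (fun s => Y (.inl s), fun e => Y (.inr e)), fun z => joinVal z.1 z.2,
      fun Y => by funext s; cases s <;> rfl, fun _ => rfl⟩ _ _ fun Y => by
      congr 1
      funext s
      cases s <;> rfl

theorem sum_agreeOff_netVal [Fintype K] {P : L.Atom ⊕ C.GW → Prop}
    {P₁ : L.Atom → Prop} {P₂ : C.GW → Prop} (h₁ : ∀ s, P (.inl s) = P₁ s)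
    (h₂ : ∀ e, P (.inr e) = P₂ e) (Y₀ : ∀ s, L.NetVal K s)
    (f : (∀ s, L.NetVal K s) → ℝ)
    (h : Idx (fun s : {s // P₁ s} => L.sysOf s.1) → ({e // P₂ e} → K) → ℝ)
    (hf : ∀ Y ∈ agreeOff P Y₀, f Y = h (fun s => Y (.inl s.1)) (fun e => Y (.inr e.1))) :
    ∑ Y ∈ agreeOff P Y₀, f Y = ∑ y, ∑ w, h y w := by
  obtain rfl : P₁ = fun s => P (.inl s) := funext fun s => (h₁ s).symm
  obtain rfl : P₂ = fun s => P (.inr s) := funext fun s => (h₂ s).symm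
  rw [Finset.sum_congr rfl hf]
  refine (sum_agreeOff P Y₀ fun y => h (fun s => y ⟨.inl s.1, s.2⟩)
    (fun e => y ⟨.inr e.1, e.2⟩)).trans ?_
  refine Eq.trans ?_ (Fintype.sum_prod_type' h)
  refine Fintype.sum_equiv
    (κ := Idx (fun s : {s // P (.inl s)} => L.sysOf s.1) × ({e // P (.inr e)} → K))
    ⟨fun y => (fun s => y ⟨.inl s.1, s.2⟩, fun e => y ⟨.inr e.1, e.2⟩),
      fun z s => match s with
        | ⟨.inl s, hs⟩ => z.1 ⟨s, hs⟩
        | ⟨.inr e, he⟩ => z.2 ⟨e, he⟩, ?_, ?_⟩ _ _ ?_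
  · intro y
    funext ⟨s, hs⟩
    cases s <;> rfl
  · intro z
    rfl
  · intro y
    rfl

theorem prod_filter_net {P : L.Atom ⊕ C.GW → Prop}
    {P₁ : L.Atom → Prop} {P₂ : C.GW → Prop} (h₁ : ∀ s, P (.inl s) = P₁ s)
    (h₂ : ∀ e, P (.inr e) = P₂ e) (f : L.Atom ⊕ C.GW → ℝ) :
    ∏ s with P s, f s = (∏ s : {s // P₁ s}, f (.inl s.1)) * ∏ e : {e // P₂ e}, f (.inr e.1) := by
  obtain rfl : P₁ = fun s => P (.inl s) := funext fun s => (h₁ s).symm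
  obtain rfl : P₂ = fun s => P (.inr s) := funext fun s => (h₂ s).symm
  rw [Finset.prod_filter, Fintype.prod_sum_type, ← Finset.prod_filter, ← Finset.prod_filter]
  congr 1
  · exact Finset.prod_subtype _ (by simp) _
  · exact Finset.prod_subtype _ (by simp) _

variable (L) in
/-- The type of a gate acting on systems and frame wires. -/
abbrev NetGate (K : Type) (v : C.Gate) : Type :=
  Idx (L.outSys v) → ({e // C.From v e} → K) → Idx (L.inSys v) →
    ({e // C.Into v e} → K) → ℝ

def netMap (T : ∀ s : L.Atom, (L.sysOf s).ix → (L.sysOf s).ix → ℝ) (U : C.GW → K' → K → ℝ) :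
    ∀ s, L.NetVal K' s → L.NetVal K s → ℝ
  | .inl s => T s
  | .inr e => U e

/-- The node of the settings emits every value with weight one; the values are selected by the
covectors `d` at the evaluation node, which also reads all observed wires. -/
noncomputable def netOp (p : ∀ v, L.NetGate K v) (d : ∀ s : L.Atom, (L.sysOf s).ix → ℝ)
    (d' : C.GW → K → ℝ) : C.Gate ⊕ Bool → (∀ s, L.NetVal K s) → ℝ
  | .inl v, X => p v (fun j => X (.inl j.1)) (fun e => X (.inr e.1)) (fun i => X (.inl i.1))
      (fun e => X (.inr e.1))
  | .inr true, X => (∏ s : {s // L.IsFinal s}, d s.1 (X (.inl s.1))) *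
      ∏ e : {e // C.Ends e}, d' e.1 (X (.inr e.1))
  | .inr false, _ => 1

theorem netOp_congr (p : ∀ v, L.NetGate K v) (d : ∀ s : L.Atom, (L.sysOf s).ix → ℝ)
    (d' : C.GW → K → ℝ) (v : C.Gate ⊕ Bool) (X X' : ∀ s, L.NetVal K s)
    (h : ∀ s, L.srcGate s = v ∨ L.netIn v s → X s = X' s) :
    netOp p d d' v X = netOp p d d' v X' := by
  rcases v with v | _ | _
  · have h1 : ∀ s, L.IsOut v s ∨ L.IsIn v s → X (.inl s) = X' (.inl s) := fun s hs =>
      h (.inl s) (hs.imp_left (L.netOut_iff (.inl v) (.inl s)).1)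
    have h2 : ∀ e, C.From v e ∨ C.Into v e → X (.inr e) = X' (.inr e) := fun e he =>
      h (.inr e) (he.imp_left (L.netOut_iff (.inl v) (.inr e)).1)
    simp only [netOp]
    congr 1
    · exact funext fun j => h1 j.1 (Or.inl j.2)
    · exact funext fun j => h2 j.1 (Or.inl j.2)
    · exact funext fun j => h1 j.1 (Or.inr j.2)
    · exact funext fun j => h2 j.1 (Or.inr j.2)
  · rfl
  · simp only [netOp]
    congr 1
    · exact Finset.prod_congr rfl fun s _ => congrArg _ (h (.inl s.1) (Or.inr s.2))
    · exact Finset.prod_congr rfl fun e _ => congrArg _ (h (.inr e.1) (Or.inr e.2))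

theorem prod_netOp (p : ∀ v, L.NetGate K v) (d : ∀ s : L.Atom, (L.sysOf s).ix → ℝ)
    (d' : C.GW → K → ℝ) (x : Idx L.sysOf) (z : C.GW → K) :
    ∏ v, netOp p d d' v (joinVal x z) =
      (∏ v, p v (fun j => x j.1) (fun e => z e.1) (fun i => x i.1) (fun e => z e.1)) *
        ((∏ s : {s // L.IsFinal s}, d s.1 (x s.1)) *
          ∏ e : {e // C.Ends e}, d' e.1 (z e.1)) := by
  rw [Fintype.prod_sum_type, Fintype.prod_bool]
  simp only [netOp, mul_one]
  rfl

section

variable [Fintype K] [Fintype K']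
  (T : ∀ s : L.Atom, (L.sysOf s).ix → (L.sysOf s).ix → ℝ) (U : C.GW → K' → K → ℝ)
  (p : ∀ v, L.NetGate K v) (q : ∀ v, L.NetGate K' v)
  (dp dq : ∀ s : L.Atom, (L.sysOf s).ix → ℝ) (dp' : C.GW → K → ℝ) (dq' : C.GW → K' → ℝ)

/-- By acyclicity no wire is both input and output of a gate. Hence varying the inputs leaves the
outputs at the base point, and conversely, so the network condition is the one for the bare gate. -/
theorem netOp_intertwine_gate (v : C.Gate)
    (hpq : ∀ y w x z, (∑ y', ∑ w', q v y w y' w' *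
        ((∏ s : {s // L.IsIn v s}, T s.1 (y' s) (x s)) *
          ∏ e : {e // C.Into v e}, U e.1 (w' e) (z e))) =
      ∑ x', ∑ z', p v x' z' x z * ((∏ s : {s // L.IsOut v s}, T s.1 (y s) (x' s)) *
        ∏ e : {e // C.From v e}, U e.1 (w e) (z' e)))
    (Y₀ : ∀ s, L.NetVal K' s) (X₀ : ∀ s, L.NetVal K s) :
    ∑ Y ∈ agreeOff (L.netIn (.inl v)) Y₀,
        netOp q dq dq' (.inl v) Y * ∏ s with L.netIn (.inl v) s, netMap T U s (Y s) (X₀ s) =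
      ∑ X ∈ agreeOff (L.netOut (.inl v)) X₀,
        netOp p dp dp' (.inl v) X * ∏ s with L.netOut (.inl v) s, netMap T U s (Y₀ s) (X s) := by
  have hin₁ : ∀ s, L.netIn (.inl v) (.inl s) = L.IsIn v s := fun _ => rfl
  have hin₂ : ∀ e, L.netIn (.inl v) (.inr e) = C.Into v e := fun _ => rfl
  have hout₁ : ∀ s, L.netOut (.inl v) (.inl s) = L.IsOut v s := fun _ => rfl
  have hout₂ : ∀ e, L.netOut (.inl v) (.inr e) = C.From v e := fun _ => rfl
  rw [sum_agreeOff_netVal hin₁ hin₂ Y₀ _ (fun y' w' => q v (fun j => Y₀ (.inl j.1))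
      (fun e => Y₀ (.inr e.1)) y' w' *
        ((∏ s : {s // L.IsIn v s}, T s.1 (y' s) (X₀ (.inl s.1))) *
          ∏ e : {e // C.Into v e}, U e.1 (w' e) (X₀ (.inr e.1)))),
    sum_agreeOff_netVal hout₁ hout₂ X₀ _ (fun x' z' => p v x' z' (fun i => X₀ (.inl i.1))
      (fun e => X₀ (.inr e.1)) *
        ((∏ s : {s // L.IsOut v s}, T s.1 (Y₀ (.inl s.1)) (x' s)) *
          ∏ e : {e // C.From v e}, U e.1 (Y₀ (.inr e.1)) (z' e)))]
  · exact hpq (fun j => Y₀ (.inl j.1)) (fun e => Y₀ (.inr e.1))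
      (fun i => X₀ (.inl i.1)) (fun e => X₀ (.inr e.1))
  · intro X hX
    rw [mem_agreeOff] at hX
    rw [prod_filter_net hout₁ hout₂]
    have h1 : (fun j : {s // L.IsIn v s} => X (.inl j.1)) = fun j : {s // L.IsIn v s} => X₀ (.inl j.1) :=
      funext fun j => hX (.inl j.1) fun h =>
        L.not_netIn_of_netOut (v := .inl v) (s := .inl j.1) h j.2
    have h2 : (fun e : {e // C.Into v e} => X (.inr e.1)) = fun e : {e // C.Into v e} => X₀ (.inr e.1) :=
      funext fun e => hX (.inr e.1) fun h =>
        L.not_netIn_of_netOut (v := .inl v) (s := .inr e.1) h e.2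
    rw [netOp, h1, h2]
    rfl
  · intro Y hY
    rw [mem_agreeOff] at hY
    rw [prod_filter_net hin₁ hin₂]
    have h1 : (fun j : {s // L.IsOut v s} => Y (.inl j.1)) = fun j : {s // L.IsOut v s} => Y₀ (.inl j.1) :=
      funext fun j => hY (.inl j.1) (L.not_netIn_of_netOut (v := .inl v) (s := .inl j.1) j.2)
    have h2 : (fun e : {e // C.From v e} => Y (.inr e.1)) = fun e : {e // C.From v e} => Y₀ (.inr e.1) :=
      funext fun e => hY (.inr e.1) (L.not_netIn_of_netOut (v := .inl v) (s := .inr e.1) e.2)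
    rw [netOp, h1, h2]
    rfl

/-- The evaluation has no outputs, so intertwining means that the wire maps pull the covector of one
side back to that of the other. Both are products, so this can be checked wire by wire. -/
theorem netOp_intertwine_final
    (hd : ∀ s, L.IsFinal s → ∀ x, ∑ y, dq s y * T s y x = dp s x)
    (hd' : ∀ e, C.Ends e → ∀ z, ∑ w, dq' e w * U e w z = dp' e z)
    (Y₀ : ∀ s, L.NetVal K' s) (X₀ : ∀ s, L.NetVal K s) :
    ∑ Y ∈ agreeOff (L.netIn (.inr true)) Y₀,
        netOp q dq dq' (.inr true) Y * ∏ s with L.netIn (.inr true) s, netMap T U s (Y s) (X₀ s) =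
      ∑ X ∈ agreeOff (L.netOut (.inr true)) X₀,
        netOp p dp dp' (.inr true) X *
          ∏ s with L.netOut (.inr true) s, netMap T U s (Y₀ s) (X s) := by
  have hin₁ : ∀ s, L.netIn (.inr true) (.inl s) = L.IsFinal s := fun _ => rfl
  have hin₂ : ∀ e, L.netIn (.inr true) (.inr e) = C.Ends e := fun _ => rfl
  rw [agreeOff_of_forall_not (P := L.netOut (.inr true)) fun s h => h, Finset.sum_singleton,
    Finset.prod_eq_one (s := Finset.univ.filter fun s => L.netOut (.inr true) s)
      fun s hs => absurd (Finset.mem_filter.1 hs).2 fun h => h, mul_one]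
  rw [sum_agreeOff_netVal hin₁ hin₂ Y₀ _ (fun y' w' =>
      (∏ s : {s // L.IsFinal s}, dq s.1 (y' s) * T s.1 (y' s) (X₀ (.inl s.1))) *
        ∏ e : {e // C.Ends e}, dq' e.1 (w' e) * U e.1 (w' e) (X₀ (.inr e.1)))]
  · simp only [← Finset.mul_sum, ← Finset.sum_mul, netOp]
    congr 1
    · rw [Idx.sum_prod_apply fun (s : {s // L.IsFinal s}) y => dq s.1 y * T s.1 y (X₀ (.inl s.1))]
      exact Finset.prod_congr rfl fun s _ => hd s.1 s.2 _
    · refine (sum_prod_pi fun (e : {e // C.Ends e}) w =>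
        dq' e.1 w * U e.1 w (X₀ (.inr e.1))).trans ?_
      exact Finset.prod_congr rfl fun s _ => hd' s.1 s.2 _
  · intro Y _
    rw [prod_filter_net hin₁ hin₂, Finset.prod_mul_distrib, Finset.prod_mul_distrib, netOp]
    rw [mul_mul_mul_comm]
    rfl

/-- If the gates of two circuits with the same shape are intertwined by maps between their wires,
their contractions have the same value. -/
theorem sum_eq_of_intertwine
    (hT : ∀ s : C.LW ⊕ C.OW, ∃ t : (L.sysOf (.inr s)).ix → (L.sysOf (.inr s)).ix,
      ∀ y x, T (.inr s) y x = if y = t x then 1 else 0)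
    (hset : ∀ s, L.IsSetting s → ∀ y, ∑ x, T s y x = 1)
    (hpq : ∀ v y w x z, (∑ y', ∑ w', q v y w y' w' *
        ((∏ s : {s // L.IsIn v s}, T s.1 (y' s) (x s)) *
          ∏ e : {e // C.Into v e}, U e.1 (w' e) (z e))) =
      ∑ x', ∑ z', p v x' z' x z * ((∏ s : {s // L.IsOut v s}, T s.1 (y s) (x' s)) *
        ∏ e : {e // C.From v e}, U e.1 (w e) (z' e)))
    (hd : ∀ s, L.IsFinal s → ∀ x, ∑ y, dq s y * T s y x = dp s x)
    (hd' : ∀ e, C.Ends e → ∀ z, ∑ w, dq' e w * U e w z = dp' e z)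
    (X₀ : Idx L.sysOf) (Z₀ : K) (W₀ : K') :
    (∑ Y : Idx L.sysOf, ∑ W : C.GW → K',
      (∏ v, q v (fun j => Y j.1) (fun e => W e.1) (fun i => Y i.1) (fun e => W e.1)) *
        ((∏ s : {s // L.IsFinal s}, dq s.1 (Y s.1)) *
          ∏ e : {e // C.Ends e}, dq' e.1 (W e.1))) =
    ∑ X : Idx L.sysOf, ∑ Z : C.GW → K,
      (∏ v, p v (fun j => X j.1) (fun e => Z e.1) (fun i => X i.1) (fun e => Z e.1)) *
        ((∏ s : {s // L.IsFinal s}, dp s.1 (X s.1)) *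
          ∏ e : {e // C.Ends e}, dp' e.1 (Z e.1)) := by
  have key := L.network.sum_eq_of_intertwine (netMap T U) ?_ (netOp p dp dp') (netOp q dq dq')
    (netOp_congr p dp dp') (netOp_congr q dq dq') L.netOut L.netOut_iff ?_
    (joinVal X₀ fun _ => Z₀) (joinVal X₀ fun _ => W₀)
  · rw [sum_netVal, sum_netVal] at key
    simpa only [prod_netOp] using key
  · rintro ((_ | s) | e) hs
    · exact hs.elim
    · exact hT s
    · exact hs.elim
  · intro v Y₀ X₀
    rcases v with v | _ | _
    · exact netOp_intertwine_gate T U p q dp dq dp' dq' v (hpq v) Y₀ X₀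
    · rw [agreeOff_of_forall_not (P := L.network.In (.inr false)) fun s h => h]
      simp only [netOp, one_mul]
      rw [sum_agreeOff_prod (L.netOut (.inr false)) X₀ fun s x => netMap T U s (Y₀ s) x]
      rw [Finset.sum_singleton, Finset.prod_eq_one, Finset.prod_eq_one]
      · rintro (s | e) hs
        · exact hset s (Finset.mem_filter.1 hs).2 _
        · exact absurd (Finset.mem_filter.1 hs).2 fun h => h
      · intro s hs
        exact absurd (Finset.mem_filter.1 hs).2 fun h => h
    · exact netOp_intertwine_final T U p q dp dq dp' dq' hd hd' Y₀ X₀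

end

end Labelling

/-! ## Simulation with reference frames -/

theorem swirl_reindexable {σ : Signature} {T : OpTheory σ} (hT : T.Reindexable) {G : Type}
    (F : SymAction σ G) : (swirl T F).Reindexable where
  reindex := by
    intro α β α' β' _ _ _ _ e f a b M hM
    refine ⟨hT.reindex e f a b M hM.1, fun g => ?_⟩
    funext y x
    have h := congrFun (congrFun (hM.2 g) fun j => y (f j)) fun i => x (e i)
    simp only [seqComp] at h ⊢
    refine Eq.trans ?_ (h.trans ?_)
    · refine Fintype.sum_equiv (κ := Idx fun i => a (e i))
        (Equiv.piCongrLeft (fun i => (a i).ix) e).symm _ _ fun z => ?_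
      congr 1
      exact (e.prod_comp fun i => F g (a i) (z i) (x i)).symm
    · refine (Fintype.sum_equiv (κ := Idx fun j => b (f j))
        (Equiv.piCongrLeft (fun j => (b j).ix) f).symm _ _ fun z => ?_).symm
      congr 1
      exact (f.prod_comp fun j => F g (b j) (y j) (z j)).symm

/-! ### Labellings with a frame on every latent wire. -/

namespace Labelling

variable {σ : Signature} {C : CausalStructure} (L : Labelling σ C)

theorem prod_isFinal (d : L.Atom → ℝ) :
    ∏ s : {s // L.IsFinal s}, d s.1 =
      (∏ s : {s // L.IsOpen s}, d s.1) * ∏ o, d (.inr (.inr o)) := by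
  have h1 : ∏ s : {s // L.IsFinal s}, d s.1 = ∏ s with L.IsFinal s, d s :=
    (Finset.prod_subtype _ (by simp) _).symm
  have h2 : ∏ s : {s // L.IsOpen s}, d s.1 = ∏ s with L.IsOpen s, d s :=
    (Finset.prod_subtype _ (by simp) _).symm
  rw [h1, h2, Finset.prod_filter, Finset.prod_filter, Fintype.prod_sum_type,
    Fintype.prod_sum_type, Fintype.prod_sum_type, Fintype.prod_sum_type,
    Finset.prod_eq_one (f := fun l : C.LW => if L.IsFinal (.inr (.inl l)) then _ else _)
      fun _ _ => if_neg fun h => h,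
    Finset.prod_eq_one (f := fun l : C.LW => if L.IsOpen (.inr (.inl l)) then _ else _)
      fun _ _ => if_neg fun h => h,
    Finset.prod_eq_one (f := fun o : C.OW => if L.IsOpen (.inr (.inr o)) then _ else _)
      fun _ _ => if_neg fun h => h, one_mul, one_mul, mul_one]
  congr 1
  exact Finset.prod_congr rfl fun o _ => if_pos trivial

/-- Adding a copy of the composite system `r` to every latent wire. -/
def addFrames {n : ℕ} (r : Fin n → Sys σ) : Labelling σ C where
  k e := L.k e + n
  gsys e i := Sum.elim (L.gsys e) r (finSumFinEquiv.symm i)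
  lcard := L.lcard
  ocard := L.ocard

variable {n : ℕ} (r : Fin n → Sys σ)

def frameTo : (L.addFrames r).Atom → L.Atom ⊕ (C.GW × Fin n)
  | .inl p => Sum.map (fun j => .inl ⟨p.1, j⟩) (fun j => (p.1, j)) (finSumFinEquiv.symm p.2)
  | .inr o => .inl (.inr o)

def frameFrom : L.Atom ⊕ (C.GW × Fin n) → (L.addFrames r).Atom
  | .inl (.inl p) => .inl ⟨p.1, finSumFinEquiv (.inl p.2)⟩
  | .inl (.inr o) => .inr o
  | .inr p => .inl ⟨p.1, finSumFinEquiv (.inr p.2)⟩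

def frameEquiv : (L.addFrames r).Atom ≃ L.Atom ⊕ (C.GW × Fin n) where
  toFun := L.frameTo r
  invFun := L.frameFrom r
  left_inv := by
    rintro (⟨e, i⟩ | o)
    · rcases h : finSumFinEquiv.symm i with j | j
      · rw [show L.frameTo r (.inl ⟨e, i⟩) = .inl (.inl ⟨e, j⟩) from congrArg (Sum.map _ _) h]
        exact congrArg (fun i : Fin (L.k e + n) => (.inl ⟨e, i⟩ : (L.addFrames r).Atom))
          ((Equiv.symm_apply_eq _).1 h).symm
      · rw [show L.frameTo r (.inl ⟨e, i⟩) = .inr (e, j) from congrArg (Sum.map _ _) h]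
        exact congrArg (fun i : Fin (L.k e + n) => (.inl ⟨e, i⟩ : (L.addFrames r).Atom))
          ((Equiv.symm_apply_eq _).1 h).symm
    · rfl
  right_inv := by
    rintro ((p | o) | p)
    · exact congrArg (Sum.map _ _) (finSumFinEquiv.symm_apply_apply (.inl p.2))
    · rfl
    · exact congrArg (Sum.map _ _) (finSumFinEquiv.symm_apply_apply (.inr p.2))

theorem sysOf_addFrames (s : (L.addFrames r).Atom) :
    (L.addFrames r).sysOf s =
      Sum.elim L.sysOf (fun p : C.GW × Fin n => r p.2) (L.frameEquiv r s) := by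
  rcases s with ⟨e, i⟩ | l | o
  · change Sum.elim (L.gsys e) r (finSumFinEquiv.symm i) = Sum.elim L.sysOf _
      (Sum.map (fun j => .inl ⟨e, j⟩) (fun j => (e, j)) (finSumFinEquiv.symm i))
    cases finSumFinEquiv.symm i <;> rfl
  · rfl
  · rfl

/-- The properties concerned (entering a gate, leaving it, being open) depend on the wire and not on
the position on it, so a frame has them exactly when its wire does. `P₂` is needed because a wire
may carry no original system. -/
theorem frameEquiv_pred (P : (L.addFrames r).Atom → Prop) (P₁ : L.Atom → Prop) (P₂ : C.GW → Prop)
    (h₁ : ∀ e i i', P (.inl ⟨e, i⟩) ↔ P₁ (.inl ⟨e, i'⟩)) (h₂ : ∀ e i, P (.inl ⟨e, i⟩) ↔ P₂ e)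
    (h₃ : ∀ o, P (.inr o) ↔ P₁ (.inr o)) (s : (L.addFrames r).Atom) :
    P s ↔ Sum.elim P₁ (fun p : C.GW × Fin n => P₂ p.1) (L.frameEquiv r s) := by
  rcases s with ⟨e, i⟩ | o
  · change _ ↔ Sum.elim P₁ _
      (Sum.map (fun j => .inl ⟨e, j⟩) (fun j => (e, j)) (finSumFinEquiv.symm i))
    cases finSumFinEquiv.symm i
    · exact h₁ _ _ _
    · exact h₂ _ _
  · exact h₃ o

/-- The systems on the wires with frames that have some property, split into original systems and
frames. -/
theorem exists_splitEquiv (P : (L.addFrames r).Atom → Prop) (P₁ : L.Atom → Prop)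
    (P₂ : C.GW → Prop)
    (h₁ : ∀ e i i', P (.inl ⟨e, i⟩) ↔ P₁ (.inl ⟨e, i'⟩)) (h₂ : ∀ e i, P (.inl ⟨e, i⟩) ↔ P₂ e)
    (h₃ : ∀ o, P (.inr o) ↔ P₁ (.inr o)) :
    ∃ ε : {s // P s} ≃ {s // P₁ s} ⊕ ({e // P₂ e} × Fin n),
      ∀ s, Sum.map Subtype.val (Prod.map Subtype.val id) (ε s) = L.frameEquiv r s.1 := by
  refine ⟨((L.frameEquiv r).subtypeEquiv (L.frameEquiv_pred r P P₁ P₂ h₁ h₂ h₃)).trans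
    (Equiv.subtypeSum.trans (Equiv.sumCongr (Equiv.refl _)
      (Equiv.prodSubtypeFstEquivSubtypeProd (p := P₂)))), ?_⟩
  rintro ⟨s, hs⟩
  simp only [Equiv.trans_apply]
  generalize hz : ((L.frameEquiv r).subtypeEquiv
    (L.frameEquiv_pred r P P₁ P₂ h₁ h₂ h₃)) ⟨s, hs⟩ = z
  have : L.frameEquiv r s = z.1 := by rw [← hz]; rfl
  rw [this]
  rcases z with ⟨z | z, hz'⟩ <;> rfl

end Labelling

/-! ### From simulated gates to simulated correlations. -/

section Simulation

variable {σ : Signature} {T : OpTheory σ} {G : Type} [Group G] {F : SymAction σ G}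
  {C : CausalStructure} {n : ℕ} {r : Fin n → Sys σ} {N : ℕ} {ω : Idx r → ℝ}
  {m : Tensor r (fun _ : Unit => (Sys.cl N : Sys σ))} {lab : G → Fin (N + 1)}

/-- The final evaluation: observed variables are compared with `x`, open systems are discarded. -/
noncomputable def Circuit.final (c : Circuit T C) (x : ∀ o, Fin (c.ocard o + 1)) :
    ∀ s : c.Atom, (c.sysOf s).ix → ℝ
  | .inl p => T.disc (c.gsys p.1 p.2)
  | .inr (.inl _) => fun _ => 1
  | .inr (.inr o) => fun y => if y = x o then 1 else 0

theorem Circuit.prod_final (c : Circuit T C) (x : ∀ o, Fin (c.ocard o + 1)) (X : Idx c.sysOf) :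
    ∏ s : {s // c.IsFinal s}, c.final x s.1 (X s.1) =
      if ∀ o, X (.inr (.inr o)) = x o then
        ∏ s : {s // c.IsOpen s}, T.disc (c.sysOf s.1) (X s.1) else 0 := by
  rw [c.prod_isFinal fun s => c.final x s (X s)]
  have h1 : ∏ s : {s // c.IsOpen s}, c.final x s.1 (X s.1) =
      ∏ s : {s // c.IsOpen s}, T.disc (c.sysOf s.1) (X s.1) := by
    refine Finset.prod_congr rfl fun s _ => ?_
    rcases s with ⟨p | s, hs⟩
    · rfl
    · exact hs.elim
  rw [h1]
  simp only [Circuit.final]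
  rw [Finset.prod_ite_zero]
  simp

/-- Replacing all gates by gates that simulate them for the orientation `g` of the frames does not
change the behaviour. -/
theorem Circuit.behaviour_eq_of_attach (c : Circuit T C) (hF : IsSymmetry T F)
    (hd : ∀ g A x, ∑ y, T.disc A y * F g A y x = T.disc A x)
    (hω : IsPerfectFrame T F r ω m lab) (g : G)
    (q : ∀ v, Tensor (Sum.elim (c.inSys v) fun p : {e // C.Into v e} × Fin n => r p.2)
      (Sum.elim (c.outSys v) fun p : {e // C.From v e} × Fin n => r p.2))
    (hq : ∀ v, seqComp (q v) (attach F ω g _ _) = seqComp (attach F ω g _ _) (c.op v))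
    (x : ∀ o, Fin (c.ocard o + 1)) :
    (∑ Y : Idx c.sysOf, ∑ W : C.GW → Idx r,
      (∏ v, q v (Idx.join (fun j => Y j.1) (fun p => W p.1.1 p.2))
        (Idx.join (fun i => Y i.1) (fun p => W p.1.1 p.2))) *
        ((∏ s : {s // c.IsFinal s}, c.final x s.1 (Y s.1)) *
          ∏ e : {e // C.Ends e}, ∏ j, T.disc (r j) (W e.1 j))) = c.behaviour x := by
  by_cases hX : IsEmpty (Idx c.sysOf)
  · rw [Circuit.behaviour, Finset.univ_eq_empty, Finset.sum_empty, Finset.sum_empty]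
  obtain ⟨X₀⟩ := not_isEmpty_iff.1 hX
  -- The frame state is normalized, so its system has at least one label.
  obtain ⟨W₀⟩ : Nonempty (Idx r) := by
    by_contra h
    have : IsEmpty (Idx r) := not_nonempty_iff.1 h
    have h1 := hω.disc_eq
    simp at h1
  -- The original circuit gets frame wires with one value only. The wire maps rotate the systems by
  -- `g` and insert the frame state of orientation `g`; discarding absorbs both.
  have key := Labelling.sum_eq_of_intertwine (L := c.toLabelling) (K := Unit) (K' := Idx r)
    (fun s => F g (c.sysOf s)) (fun _ w _ => frameState F ω g w)
    (fun v y _ x _ => c.op v y x)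
    (fun v y w x z => q v (Idx.join y (fun p => w p.1 p.2)) (Idx.join x (fun p => z p.1 p.2)))
    (c.final x) (c.final x) (fun _ _ => 1) (fun _ w => ∏ j, T.disc (r j) (w j))
    ?_ ?_ ?_ ?_ ?_ X₀ () W₀
  · refine key.trans ?_
    rw [Circuit.behaviour]
    refine Finset.sum_congr rfl fun X _ => ?_
    rw [Fintype.sum_unique]
    simp only [Finset.prod_const_one, mul_one]
    rw [c.prod_final]
    split_ifs
    · rfl
    · rw [mul_zero]
  · rintro (l | o)
    · exact ⟨id, hF.trivial_classical g _⟩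
    · exact ⟨id, hF.trivial_classical g _⟩
  · rintro (p | l | o) hs y
    · exact hs.elim
    · exact hs.elim
    · have := hF.trivial_classical g (c.ocard o) y
      exact (Finset.sum_congr rfl fun x _ => this x).trans
        ((Finset.sum_ite_eq _ _ _).trans (if_pos (Finset.mem_univ _)))
  · intro v y w x z
    have h := congrFun (congrFun (hq v) (Idx.join y fun p => w p.1 p.2)) x
    refine Eq.trans ?_
      (h.trans ((attach_seqComp g (c.op v) y (fun p => w p.1 p.2) x).trans ?_))
    · refine ((Idx.sum_join _).trans (Finset.sum_congr rfl fun y' _ => ?_)).symm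
      exact Fintype.sum_equiv (ι := Idx (fun p : {e // C.Into v e} × Fin n => r p.2))
        (κ := {e // C.Into v e} → Idx r)
        ⟨fun Z p j => Z (p, j), fun Z p => Z p.1 p.2, fun _ => rfl, fun _ => rfl⟩ _ _ fun _ => rfl
    · rw [seqComp, Finset.sum_mul]
      refine Finset.sum_congr rfl fun x' _ => ?_
      rw [Fintype.sum_unique, ← mul_assoc, mul_comm (c.op v x' x)]
      rfl
  · rintro (p | l | o) hs x'
    · exact hd g _ x'
    · exact hs.elim
    · refine (Finset.sum_congr rfl fun y _ => by
        rw [show F g (c.sysOf (.inr (.inr o))) y x' = if y = x' then 1 else 0 from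
          hF.trivial_classical g _ y x', mul_ite, mul_one, mul_zero]).trans ?_
      simp
  · intro e _ z
    exact sum_disc_frameState hω hd g

theorem OpTheory.disc_congr (T : OpTheory σ) {A B : Sys σ} (h : A = B) {x : A.ix} {y : B.ix}
    (hxy : HEq x y) : T.disc A x = T.disc B y := by
  subst h
  rw [eq_of_heq hxy]

omit [Group G] in
/-- A circuit of the symmetrized world built from gates acting on systems and frames. -/
theorem Circuit.exists_addFrames (hT : T.Reindexable) (c : Circuit T C)
    (q : ∀ v, Tensor (Sum.elim (c.inSys v) fun p : {e // C.Into v e} × Fin n => r p.2)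
      (Sum.elim (c.outSys v) fun p : {e // C.From v e} × Fin n => r p.2))
    (hq : ∀ v, q v ∈ (swirl T F).proc _ _) :
    ∃ c' : Circuit (swirl T F) C, ∃ h : c'.ocard = c.ocard, ∀ x : ∀ o, Fin (c'.ocard o + 1),
      c'.behaviour x = ∑ Y : Idx c.sysOf, ∑ W : C.GW → Idx r,
      (∏ v, q v (Idx.join (fun j => Y j.1) (fun p => W p.1.1 p.2))
        (Idx.join (fun i => Y i.1) (fun p => W p.1.1 p.2))) *
        ((∏ s : {s // c.IsFinal s}, c.final (fun o => h ▸ x o) s.1 (Y s.1)) *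
          ∏ e : {e // C.Ends e}, ∏ j, T.disc (r j) (W e.1 j)) := by
  have hin : ∀ v, ∃ ε : {s // (c.addFrames r).IsIn v s} ≃
      {s // c.IsIn v s} ⊕ ({e // C.Into v e} × Fin n),
      ∀ s, Sum.map Subtype.val (Prod.map Subtype.val id) (ε s) = c.frameEquiv r s.1 := fun v =>
    c.exists_splitEquiv r _ _ _ (fun _ _ _ => Iff.rfl) (fun _ _ => Iff.rfl)
      (by rintro (l | o) <;> exact Iff.rfl)
  have hout : ∀ v, ∃ ε : {s // (c.addFrames r).IsOut v s} ≃
      {s // c.IsOut v s} ⊕ ({e // C.From v e} × Fin n),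
      ∀ s, Sum.map Subtype.val (Prod.map Subtype.val id) (ε s) = c.frameEquiv r s.1 := fun v =>
    c.exists_splitEquiv r _ _ _ (fun _ _ _ => Iff.rfl) (fun _ _ => Iff.rfl)
      (by rintro (l | o) <;> exact Iff.rfl)
  obtain ⟨εo, hεo⟩ : ∃ ε : {s // (c.addFrames r).IsOpen s} ≃
      {s // c.IsOpen s} ⊕ ({e // C.Ends e} × Fin n),
      ∀ s, Sum.map Subtype.val (Prod.map Subtype.val id) (ε s) = c.frameEquiv r s.1 :=
    c.exists_splitEquiv r _ _ _ (fun _ _ _ => Iff.rfl) (fun _ _ => Iff.rfl) (fun _ => Iff.rfl)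
  choose εi hεi using hin
  choose εu hεu using hout
  have hsys : ∀ {P₁ : c.Atom → Prop} {P₂ : C.GW → Prop}
      (t : {s // P₁ s} ⊕ ({e // P₂ e} × Fin n)),
      Sum.elim c.sysOf (fun p : C.GW × Fin n => r p.2)
        (Sum.map Subtype.val (Prod.map Subtype.val id) t) =
      Sum.elim (fun s : {s // P₁ s} => c.sysOf s.1)
        (fun p : {e // P₂ e} × Fin n => r p.2) t := by
    rintro P₁ P₂ (t | t) <;> rfl
  have hval : ∀ {P₁ : c.Atom → Prop} {P₂ : C.GW → Prop} (Y : Idx c.sysOf)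
      (W : Idx fun p : C.GW × Fin n => r p.2) (t : {s // P₁ s} ⊕ ({e // P₂ e} × Fin n)),
      HEq (Idx.join Y W (Sum.map Subtype.val (Prod.map Subtype.val id) t))
        (Idx.join (a := fun s : {s // P₁ s} => c.sysOf s.1)
          (b := fun p : {e // P₂ e} × Fin n => r p.2) (fun s => Y s.1)
          (fun p => W (p.1.1, p.2)) t) := by
    rintro P₁ P₂ Y W (t | t) <;> rfl
  have hops := fun v => (swirl_reindexable hT F).transport (εi v) (εu v)
    (a' := (c.addFrames r).inSys v) (b' := (c.addFrames r).outSys v)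
    (fun s => by
      change (c.addFrames r).sysOf s.1 = _
      rw [c.sysOf_addFrames r, ← hεi]
      exact hsys _)
    (fun s => by
      change (c.addFrames r).sysOf s.1 = _
      rw [c.sysOf_addFrames r, ← hεu]
      exact hsys _) (hq v)
  choose op hop hop' using hops
  obtain ⟨Θ, hΘ⟩ := Idx.exists_equiv (c.frameEquiv r) (c.sysOf_addFrames r)
  refine ⟨⟨c.addFrames r, op, hop⟩, rfl, fun x => ?_⟩
  let f : Idx (Sum.elim c.sysOf fun p : C.GW × Fin n => r p.2) → ℝ := fun Z =>
    (∏ v, q v (Idx.join (fun j => Z (.inl j.1)) (fun p => Z (.inr (p.1.1, p.2))))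
        (Idx.join (fun i => Z (.inl i.1)) (fun p => Z (.inr (p.1.1, p.2))))) *
        ((∏ s : {s // c.IsFinal s}, c.final x s.1 (Z (.inl s.1))) *
          ∏ e : {e // C.Ends e}, ∏ j, T.disc (r j) (Z (.inr (e.1, j))))
  refine Eq.trans (b := ∑ Z, f Z) ?_ ?_
  · rw [Circuit.behaviour]
    refine Fintype.sum_equiv Θ _ _ fun X => ?_
    have hX := hΘ X
    obtain ⟨Y, W, hZ⟩ := Idx.exists_join (Θ X)
    rw [hZ] at hX ⊢
    have h1 : ∀ v, op v (fun j => X j.1) (fun i => X i.1) =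
        q v (Idx.join (fun j => Y j.1) (fun p => W (p.1.1, p.2)))
          (Idx.join (fun i => Y i.1) (fun p => W (p.1.1, p.2))) := by
      intro v
      refine hop' v _ _ _ _ (fun j => ?_) (fun i => ?_)
      · refine (hX j.1).trans ?_
        rw [← hεu]
        exact hval Y W _
      · refine (hX i.1).trans ?_
        rw [← hεi]
        exact hval Y W _
    have h2 : ∏ s : {s // (c.addFrames r).IsOpen s}, T.disc ((c.addFrames r).sysOf s.1) (X s.1) =
        (∏ s : {s // c.IsOpen s}, T.disc (c.sysOf s.1) (Y s.1)) *
          ∏ e : {e // C.Ends e}, ∏ j, T.disc (r j) (W (e.1, j)) := by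
      refine (Fintype.prod_equiv εo _ (fun t => T.disc
        (Sum.elim c.sysOf (fun p : C.GW × Fin n => r p.2)
          (Sum.map Subtype.val (Prod.map Subtype.val id) t))
        (Idx.join Y W (Sum.map Subtype.val (Prod.map Subtype.val id) t))) fun s => ?_).trans ?_
      · exact T.disc_congr ((c.sysOf_addFrames r s.1).trans (congrArg _ (hεo s).symm))
          ((hX s.1).trans (congr_arg_heq (Idx.join Y W) (hεo s).symm))
      · rw [Fintype.prod_sum_type, Fintype.prod_prod_type]
        rfl
    have h3 : (∀ o, X (.inr (.inr o)) = x o) ↔ ∀ o, Y (.inr (.inr o)) = x o := by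
      refine forall_congr' fun o => ?_
      rw [show X (.inr (.inr o)) = Y (.inr (.inr o)) from eq_of_heq (hX (.inr (.inr o)))]
      rfl
    change (if ∀ o, X (.inr (.inr o)) = x o then (∏ v, op v (fun j => X j.1) (fun i => X i.1)) *
      ∏ s : {s // (c.addFrames r).IsOpen s}, T.disc ((c.addFrames r).sysOf s.1) (X s.1) else 0) =
      (∏ v, q v (Idx.join (fun j => Y j.1) (fun p => W (p.1.1, p.2)))
        (Idx.join (fun i => Y i.1) (fun p => W (p.1.1, p.2)))) *
        ((∏ s : {s // c.IsFinal s}, c.final x s.1 (Y s.1)) *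
          ∏ e : {e // C.Ends e}, ∏ j, T.disc (r j) (W (e.1, j)))
    rw [c.prod_final x Y, Finset.prod_congr rfl fun v _ => h1 v]
    by_cases hx : ∀ o, Y (.inr (.inr o)) = x o
    · rw [if_pos hx]
      refine (if_pos (h3.2 hx)).trans ?_
      rw [h2]
    · rw [if_neg hx, zero_mul, mul_zero]
      exact if_neg fun h => hx (h3.1 h)
  · rw [Idx.sum_join]
    refine Finset.sum_congr rfl fun Y _ => ?_
    exact Fintype.sum_equiv (ι := Idx (fun p : C.GW × Fin n => r p.2))
        (κ := C.GW → Idx r)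
        ⟨fun Z p j => Z (p, j), fun Z p => Z p.1 p.2, fun _ => rfl, fun _ => rfl⟩ _ _ fun _ => rfl

/-- A product is linear in each factor, so a mixture in at most one factor can be pulled out. With
two mixed factors independent choices would appear. -/
theorem prod_eq_average {V G : Type} [Fintype V] [Fintype G] [Nonempty G] (q : V → ℝ)
    (qs : G → V → ℝ) (hq : ∀ v, q v = (Fintype.card G : ℝ)⁻¹ * ∑ g, qs g v) (bad : V → Prop)
    (hbad : ∀ v w, bad v → bad w → v = w) (hgood : ∀ v, ¬ bad v → ∀ g, qs g v = q v) :
    ∏ v, q v = (Fintype.card G : ℝ)⁻¹ * ∑ g, ∏ v, qs g v := by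
  by_cases h : ∃ r, bad r
  · obtain ⟨r, hr⟩ := h
    have h1 : ∀ g, ∏ v, qs g v = qs g r * ∏ v ∈ Finset.univ.erase r, q v := by
      intro g
      rw [← Finset.mul_prod_erase _ _ (Finset.mem_univ r)]
      congr 1
      exact Finset.prod_congr rfl fun v hv =>
        hgood v (fun hb => Finset.ne_of_mem_erase hv (hbad _ _ hb hr)) g
    simp only [h1, ← Finset.sum_mul]
    rw [← mul_assoc, ← hq, Finset.mul_prod_erase _ _ (Finset.mem_univ r)]
  · push Not at h
    have h1 : ∀ g, ∏ v, qs g v = ∏ v, q v := fun g =>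
      Finset.prod_congr rfl fun v _ => hgood v (h v) g
    simp [h1]

/-- If all frames can be handed on from a single source, all correlations can be simulated. -/
theorem correlations_subset_swirl [Fintype G] (hT : T.Closed) (hF : IsSymmetry T F)
    (hd : ∀ g A x, ∑ y, T.disc A y * F g A y x = T.disc A x)
    (hω : IsPerfectFrame T F r ω m lab)
    (hroot : ∀ e e', (∀ f, C.gtgt f ≠ some (C.gsrc e)) → (∀ f, C.gtgt f ≠ some (C.gsrc e')) →
      C.gsrc e = C.gsrc e') :
    Correlations T C ⊆ Correlations (swirl T F) C := by
  rintro _ ⟨c, rfl⟩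
  -- A gate with no latent system wires on one side has only classical systems there, on which the
  -- symmetry is trivial.
  have hclass : ∀ {α : Type} [Fintype α] (s : α → c.Atom), (∀ i p, s i ≠ .inl p) → ∀ g,
      collective F g (fun i => c.sysOf (s i)) = collective F 1 (fun i => c.sysOf (s i)) := by
    intro α _ s hs g
    funext y x
    refine Finset.prod_congr rfl fun i _ => ?_
    have : ∀ t : c.Atom, (∀ p, t ≠ .inl p) → F g (c.sysOf t) = F 1 (c.sysOf t) := by
      rintro (p | l | o) ht
      · exact absurd rfl (ht p)
      all_goals
        funext y x
        exact (hF.trivial_classical g _ y x).trans (hF.trivial_classical 1 _ y x).symm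
    rw [this _ (hs i)]
  have hsim := fun v => exists_isSimulation (P := {e // C.Into v e}) (Q := {e // C.From v e})
    hT hF hω (c.op_mem v)
    (fun hP => hclass (fun s : {s // c.IsIn v s} => s.1) fun i p hp => by
      have := i.2
      rw [hp] at this
      exact hP.elim ⟨p.1, this⟩)
    (fun hQ => hclass (fun s : {s // c.IsOut v s} => s.1) fun i p hp => by
      have := i.2
      rw [hp] at this
      exact hQ.elim ⟨p.1, this⟩)
  choose q qs hq hqs using hsim
  obtain ⟨c', hc', hb⟩ := c.exists_addFrames hT.toReindexable q fun v => (hq v).1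
  -- The numbers of values agree only propositionally, so the dependent pairs are compared after
  -- substitution.
  have hcong : ∀ (oc : C.OW → ℕ) (b : (∀ o, Fin (oc o + 1)) → ℝ) (h : oc = c.ocard),
      (∀ x, b x = c.behaviour fun o => h ▸ x o) →
        (⟨oc, b⟩ : Σ card : C.OW → ℕ, ((∀ o, Fin (card o + 1)) → ℝ)) = ⟨c.ocard, c.behaviour⟩ := by
    rintro _ b rfl h
    rw [show b = c.behaviour from funext h]
  refine ⟨c', hcong _ _ hc' fun x => (hb x).trans ?_⟩
  have havg : ∀ (Y : Idx c.sysOf) (W : C.GW → Idx r),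
      ∏ v, q v (Idx.join (fun j => Y j.1) (fun p => W p.1.1 p.2))
        (Idx.join (fun i => Y i.1) (fun p => W p.1.1 p.2)) =
      (Fintype.card G : ℝ)⁻¹ * ∑ g, ∏ v, qs v g
        (Idx.join (fun j => Y j.1) (fun p => W p.1.1 p.2))
        (Idx.join (fun i => Y i.1) (fun p => W p.1.1 p.2)) := by
    intro Y W
    refine prod_eq_average _ (fun g v => qs v g _ _) (fun v => (hq v).2.1 _ _)
      -- The sources of frames; by `hroot` there is at most one.
      (fun v => (∀ f, C.gtgt f ≠ some v) ∧ ∃ e, C.gsrc e = v) ?_ ?_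
    · rintro _ _ ⟨h1, e, rfl⟩ ⟨h2, e', rfl⟩
      exact hroot e e' h1 h2
    · intro v hv g
      rw [hqs v ?_ g]
      by_contra h
      rw [not_or, not_nonempty_iff, not_isEmpty_iff] at h
      obtain ⟨h1, ⟨e, he⟩⟩ := h
      exact hv ⟨fun f hf => h1.elim ⟨f, hf⟩, e, he⟩
  simp only [havg, mul_assoc, ← Finset.mul_sum, Finset.sum_mul]
  -- For each fixed orientation the network has the original behaviour, so the average runs over
  -- equal terms.
  have hg := fun g => c.behaviour_eq_of_attach hF hd hω g (fun v => qs v g)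
    (fun v => (hq v).2.2 g) fun o => hc' ▸ x o
  rw [Finset.sum_congr rfl fun Y _ => Finset.sum_comm, Finset.sum_comm,
    Finset.sum_congr rfl fun g _ => hg g]
  simp

end Simulation

/-! ## Shared reference frames -/

theorem OpTheory.IsGPT.disc_classical {σ : Signature} {T : OpTheory σ} (hT : T.IsGPT) (n : ℕ)
    (k : (Sys.cl n : Sys σ).ix) : T.disc (Sys.cl n) k = 1 := by
  have h := (hT.classical (fun _ : Unit => n) (fun i : Empty => (i.elim : ℕ)) fun _ _ => 1).2
    ⟨fun _ _ => zero_le_one, fun x => Idx.sum_isEmpty _ fun i => i.elim⟩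
  have h1 := congrFun (congrFun ((hT.discard _ _ _).1 h) fun i => i.elim) fun _ => k
  simpa using h1.symm

theorem OpTheory.IsGPT.sum_disc_seqComp {σ : Signature} {T : OpTheory σ} (hT : T.IsGPT)
    {α β : Type} [Fintype α] [Fintype β] {a : α → Sys σ} {b : β → Sys σ} {M : Tensor a b}
    (hM : M ∈ T.proc a b) (x : Idx a) :
    ∑ y, M y x * ∏ j, T.disc (b j) (y j) = ∏ i, T.disc (a i) (x i) := by
  have h1 := (hT.discard b (fun i : Empty => (i.elim : Sys σ)) _).2 rfl
  have h2 := (hT.discard a (fun i : Empty => (i.elim : Sys σ)) _).1 (hT.seq _ _ _ _ _ h1 hM)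
  have h3 := congrFun (congrFun h2 fun i => i.elim) x
  simpa only [seqComp, mul_comm] using h3

theorem Idx.prod_boole {σ : Signature} {α : Type} [Fintype α] {a : α → Sys σ} (y x : Idx a) :
    ∏ i, (if y i = x i then (1 : ℝ) else 0) = if y = x then 1 else 0 := by
  rw [Finset.prod_ite_zero]
  simp [Idx.ext_iff]

/-- The direct causal influences. -/
def CausalStructure.Link (C : CausalStructure) (u w : C.Gate) : Prop :=
  (∃ e, C.gsrc e = u ∧ C.gtgt e = some w) ∨ (∃ l, C.lsrc l = u ∧ w ∈ C.lread l) ∨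
    (∃ o, C.osrc o = some u ∧ w ∈ C.oread o)

namespace Labelling

variable {σ : Signature} {C : CausalStructure} (L : Labelling σ C)

theorem isOut_unique {u v : C.Gate} {s : L.Atom} (hu : L.IsOut u s) (hv : L.IsOut v s) :
    u = v := by
  have h1 := (L.netOut_iff (.inl u) (.inl s)).1 hu
  have h2 := (L.netOut_iff (.inl v) (.inl s)).1 hv
  exact Sum.inl_injective (h1.symm.trans h2)

theorem link_of_isOut {u v : C.Gate} {s : L.Atom} (hu : L.IsOut u s) (hv : L.IsIn v s) :
    C.Link u v := by
  rcases s with p | l | o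
  · exact Or.inl ⟨p.1, hu, hv⟩
  · exact Or.inr (Or.inl ⟨l, hu, hv⟩)
  · exact Or.inr (Or.inr ⟨o, hu, hv⟩)

theorem prod_onWire (f : C.GW) (d : L.Atom → ℝ) :
    ∏ s with L.OnWire f s, d s = ∏ i, d (.inl ⟨f, i⟩) := by
  rw [Finset.prod_filter, Fintype.prod_sum_type, Fintype.prod_sigma,
    Finset.prod_eq_one (f := fun s : C.LW ⊕ C.OW => if L.OnWire f (.inr s) then _ else _)
      fun _ _ => if_neg fun h => h, mul_one, Fintype.prod_eq_single f]
  · exact Finset.prod_congr rfl fun i _ => if_pos rfl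
  · intro e he
    exact Finset.prod_eq_one fun i _ => if_neg he

theorem prod_isOpen {f f' : C.GW} (hf : C.gtgt f = none) (hf' : C.gtgt f' = none) (hff' : f ≠ f')
    (d : L.Atom → ℝ) :
    ∏ s : {s // L.IsOpen s}, d s.1 =
      ((∏ i, d (.inl ⟨f, i⟩)) * ∏ i, d (.inl ⟨f', i⟩)) *
        ∏ s : {s // L.IsOpen s ∧ ¬ L.OnWire f s ∧ ¬ L.OnWire f' s}, d s.1 := by
  have h1 : ∏ s : {s // L.IsOpen s}, d s.1 = ∏ s with L.IsOpen s, d s :=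
    (Finset.prod_subtype _ (by simp) _).symm
  have h2 : ∏ s : {s // L.IsOpen s ∧ ¬ L.OnWire f s ∧ ¬ L.OnWire f' s}, d s.1 =
      ∏ s with L.IsOpen s ∧ ¬ L.OnWire f s ∧ ¬ L.OnWire f' s, d s :=
    (Finset.prod_subtype _ (by simp) _).symm
  have hopen : ∀ e, C.gtgt e = none → ∀ s, L.OnWire e s → L.IsOpen s := by
    rintro e he (p | s) hs
    · exact (congrArg C.gtgt hs).trans he
    · exact hs.elim
  rw [h1, h2, ← L.prod_onWire f, ← L.prod_onWire f',
    ← Finset.prod_filter_mul_prod_filter_not (Finset.univ.filter L.IsOpen) (L.OnWire f),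
    ← Finset.prod_filter_mul_prod_filter_not
      ((Finset.univ.filter L.IsOpen).filter fun s => ¬ L.OnWire f s) (L.OnWire f'), mul_assoc]
  congr 1
  · refine Finset.prod_congr ?_ fun _ _ => rfl
    ext s
    simp only [Finset.mem_filter, Finset.mem_univ, true_and, and_iff_right_iff_imp]
    exact hopen f hf s
  congr 1
  · refine Finset.prod_congr ?_ fun _ _ => rfl
    ext s
    simp only [Finset.mem_filter, Finset.mem_univ, true_and, and_iff_right_iff_imp]
    refine fun hs => ⟨hopen f' hf' s hs, ?_⟩
    rcases s with p | s
    · exact fun h => hff' (h.symm.trans hs)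
    · exact hs.elim
  · refine Finset.prod_congr ?_ fun _ _ => rfl
    ext s
    simp [and_assoc]

end Labelling

/-! ### Rotating the output of a root gate and erasing everything after it. -/

section Tokens

variable {σ : Signature} {T : OpTheory σ} {G : Type} [Group G] {F : SymAction σ G}
  {C : CausalStructure} (c : Circuit (swirl T F) C)

/-- `s` leaves a gate influenced by the gate `v₀`. -/
def Circuit.After (v₀ : C.Gate) (s : c.Atom) : Prop :=
  ∃ v, Relation.TransGen C.Link v₀ v ∧ c.IsOut v s

/-- Rotation of the outputs of `v₀`, erasure of all that comes later. -/
noncomputable def Circuit.rotErase (X₀ : Idx c.sysOf) (v₀ : C.Gate) (g : G) (s : c.Atom)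
    (y x : (c.sysOf s).ix) : ℝ :=
  if c.After v₀ s then (if y = X₀ s then 1 else 0) * T.disc (c.sysOf s) x
  else if c.IsOut v₀ s then F g (c.sysOf s) y x else if y = x then 1 else 0

/-- Discarding, after an erasure. -/
noncomputable def Circuit.erasedDisc (v₀ : C.Gate) (s : c.Atom) (y : (c.sysOf s).ix) : ℝ :=
  if c.After v₀ s then 1 else T.disc (c.sysOf s) y

omit [Group G] in
theorem Circuit.sum_erasedDisc (hd : ∀ g A x, ∑ y, T.disc A y * F g A y x = T.disc A x)
    (X₀ : Idx c.sysOf) (v₀ : C.Gate) (g : G) (s : c.Atom) (x : (c.sysOf s).ix) :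
    ∑ y, c.erasedDisc v₀ s y * c.rotErase X₀ v₀ g s y x = T.disc (c.sysOf s) x := by
  by_cases h1 : c.After v₀ s
  · simp [erasedDisc, rotErase, h1]
  · by_cases h2 : c.IsOut v₀ s
    · simp [erasedDisc, rotErase, h1, h2, hd]
    · simp [erasedDisc, rotErase, h1, h2]

/-- The gates after the erasure. -/
noncomputable def Circuit.erasedGate (X₀ : Idx c.sysOf) (v₀ v : C.Gate) :
    Tensor (c.inSys v) (c.outSys v) := fun y x =>
  if Relation.TransGen C.Link v₀ v then
    (∏ s : {s // c.IsOut v s}, if y s = X₀ s.1 then 1 else 0) *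
      ∏ s : {s // c.IsIn v s}, c.erasedDisc v₀ s.1 (x s)
  else c.op v y x

omit [Group G] in
theorem Circuit.not_after_of_isOut {v₀ v : C.Gate} (hv : ¬ Relation.TransGen C.Link v₀ v)
    {s : c.Atom} (hs : c.IsOut v s) : ¬ c.After v₀ s := by
  rintro ⟨u, hu, hus⟩
  exact hv (c.isOut_unique hus hs ▸ hu)

omit [Group G] in
theorem Circuit.not_after_of_isIn {v₀ v : C.Gate} (hv : ¬ Relation.TransGen C.Link v₀ v)
    {s : c.Atom} (hs : c.IsIn v s) : ¬ c.After v₀ s := by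
  rintro ⟨u, hu, hus⟩
  exact hv (hu.tail (c.link_of_isOut hus hs))

/-- There are three kinds of gates. After `v₀`, causality lets the outputs be discarded and replaced
by the filler `X₀`. At `v₀` the inputs are classical, so covariance says that rotating all outputs
has no effect. All other gates see only identity maps. -/
theorem Circuit.erasedGate_intertwine (hT : T.IsGPT) (hF : IsSymmetry T F) (X₀ : Idx c.sysOf)
    {v₀ : C.Gate} (hv₀ : ∀ e, C.gtgt e ≠ some v₀) (g : G) (v : C.Gate) (y : Idx (c.outSys v))
    (x : Idx (c.inSys v)) :
    ∑ y', c.erasedGate X₀ v₀ v y y' *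
        ∏ s : {s // c.IsIn v s}, c.rotErase X₀ v₀ g s.1 (y' s) (x s) =
      ∑ x', c.op v x' x * ∏ s : {s // c.IsOut v s}, c.rotErase X₀ v₀ g s.1 (y s) (x' s) := by
  by_cases hv : Relation.TransGen C.Link v₀ v
  · simp only [erasedGate, if_pos hv, mul_assoc, ← Finset.prod_mul_distrib, ← Finset.mul_sum]
    have h2 : ∑ y' : Idx (c.inSys v), ∏ s : {s // c.IsIn v s},
        c.erasedDisc v₀ s.1 (y' s) * c.rotErase X₀ v₀ g s.1 (y' s) (x s) =
        ∏ s : {s // c.IsIn v s}, T.disc (c.inSys v s) (x s) :=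
      (Idx.sum_prod_apply (a := c.inSys v) fun s y =>
        c.erasedDisc v₀ s.1 y * c.rotErase X₀ v₀ g s.1 y (x s)).trans
        (Finset.prod_congr rfl fun s _ =>
          c.sum_erasedDisc (hF.sum_disc hT) X₀ v₀ g s.1 (x s))
    rw [h2]
    have h1 : ∀ x' : Idx (c.outSys v),
        ∏ s : {s // c.IsOut v s}, c.rotErase X₀ v₀ g s.1 (y s) (x' s) =
        (∏ s : {s // c.IsOut v s}, if y s = X₀ s.1 then 1 else 0) *
          ∏ s : {s // c.IsOut v s}, T.disc (c.outSys v s) (x' s) := by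
      intro x'
      rw [← Finset.prod_mul_distrib]
      refine Finset.prod_congr rfl fun s _ => ?_
      exact if_pos ⟨v, hv, s.2⟩
    rw [Finset.sum_congr rfl fun x' _ => by rw [h1, mul_left_comm], ← Finset.mul_sum,
      hT.sum_disc_seqComp (c.op_mem v).1 x]
  · have hin : ∀ y', ∏ s : {s // c.IsIn v s}, c.rotErase X₀ v₀ g s.1 (y' s) (x s) =
        if y' = x then 1 else 0 := by
      intro y'
      rw [← Idx.prod_boole]
      refine Finset.prod_congr rfl fun s _ => ?_
      exact (if_neg (c.not_after_of_isIn hv s.2)).trans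
        (if_neg fun h => hv (.single (c.link_of_isOut h s.2)))
    rw [Finset.sum_congr rfl fun y' _ => by rw [hin y', mul_boole], Finset.sum_ite_eq',
      if_pos (Finset.mem_univ _), erasedGate, if_neg hv]
    by_cases hvv : v = v₀
    · subst hvv
      have hout : ∀ x', ∏ s : {s // c.IsOut v s}, c.rotErase X₀ v g s.1 (y s) (x' s) =
          collective F g (c.outSys v) y x' := by
        intro x'
        refine Finset.prod_congr rfl fun s _ => ?_
        exact (if_neg (c.not_after_of_isOut hv s.2)).trans (if_pos s.2)
      have hcl : collective F g (c.inSys v) = fun y x => if y = x then 1 else 0 := by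
        funext y x
        rw [← Idx.prod_boole]
        refine Finset.prod_congr rfl fun s _ => ?_
        rcases s with ⟨p | l | o, hs⟩
        · exact absurd hs (hv₀ p.1)
        · exact hF.trivial_classical g _ _ _
        · exact hF.trivial_classical g _ _ _
      have h := congrFun (congrFun ((c.op_mem v).2 g) y) x
      rw [hcl, seqComp_one] at h
      rw [h, seqComp]
      exact Finset.sum_congr rfl fun x' _ => by rw [hout, mul_comm]
    · have hout : ∀ x', ∏ s : {s // c.IsOut v s}, c.rotErase X₀ v₀ g s.1 (y s) (x' s) =
          if y = x' then 1 else 0 := by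
        intro x'
        rw [← Idx.prod_boole]
        refine Finset.prod_congr rfl fun s _ => ?_
        exact (if_neg (c.not_after_of_isOut hv s.2)).trans
          (if_neg fun h => hvv (c.isOut_unique s.2 h))
      rw [Finset.sum_congr rfl fun x' _ => by rw [hout x', mul_boole], Finset.sum_ite_eq,
        if_pos (Finset.mem_univ _)]

/-- Evaluation of the observed variables: settings are compared with `x`. -/
noncomputable def Circuit.settingWeight (x : ∀ o, Fin (c.ocard o + 1)) (o : C.OW)
    (k : Fin (c.ocard o + 1)) : ℝ :=
  if C.osrc o = none then if k = x o then 1 else 0 else 1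

/-- Evaluation of the joint state on `f` and `f'` in the basis state given by `Y`, rotating `f'`. -/
noncomputable def Circuit.jointEval (x : ∀ o, Fin (c.ocard o + 1)) (f f' : C.GW)
    (Y : Idx c.sysOf) (g : G) : ∀ s : c.Atom, (c.sysOf s).ix → ℝ
  | .inl p => fun t =>
    if p.1 = f then if Y (.inl p) = t then 1 else 0
    else if p.1 = f' then F g (c.gsys p.1 p.2) (Y (.inl p)) t
    else T.disc (c.gsys p.1 p.2) t
  | .inr (.inl _) => fun _ => 1
  | .inr (.inr o) => c.settingWeight x o

/-- In contrast to `jointEval` it does not involve a group element: the rotation of `f'` has gone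
into the wire maps. -/
noncomputable def Circuit.erasedEval (x : ∀ o, Fin (c.ocard o + 1)) (f f' : C.GW)
    (Y : Idx c.sysOf) (v₀ : C.Gate) : ∀ s : c.Atom, (c.sysOf s).ix → ℝ
  | .inl p => fun t =>
    if p.1 = f then if Y (.inl p) = t then 1 else 0
    else if p.1 = f' then if Y (.inl p) = t then 1 else 0
    else c.erasedDisc v₀ (.inl p) t
  | .inr (.inl _) => fun _ => 1
  | .inr (.inr o) => c.settingWeight x o

omit [Group G] in
theorem Circuit.prod_jointEval (x : ∀ o, Fin (c.ocard o + 1)) {f f' : C.GW}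
    (hf : C.gtgt f = none) (hf' : C.gtgt f' = none) (hff' : f ≠ f')
    (Y : Idx c.sysOf) (g : G) (X : Idx c.sysOf) :
    ∏ s : {s // c.IsFinal s}, c.jointEval x f f' Y g s.1 (X s.1) =
      if (∀ o, C.osrc o = none → X (.inr (.inr o)) = x o) ∧
          (∀ i, X (.inl ⟨f, i⟩) = Y (.inl ⟨f, i⟩)) then
        collective F g (c.gsys f') (fun i => Y (.inl ⟨f', i⟩)) (fun i => X (.inl ⟨f', i⟩)) *
          ∏ s : {s : c.Atom // c.IsOpen s ∧ ¬ c.OnWire f s ∧ ¬ c.OnWire f' s},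
            T.disc (c.sysOf s.1) (X s.1) else 0 := by
  rw [c.prod_isFinal fun s => c.jointEval x f f' Y g s (X s), 
    c.prod_isOpen hf hf' hff' fun s => c.jointEval x f f' Y g s (X s)]
  have h1 : ∏ o, c.jointEval x f f' Y g (.inr (.inr o)) (X (.inr (.inr o))) =
      if ∀ o, C.osrc o = none → X (.inr (.inr o)) = x o then 1 else 0 := by
    have : ∀ o, c.jointEval x f f' Y g (.inr (.inr o)) (X (.inr (.inr o))) =
        if C.osrc o = none → X (.inr (.inr o)) = x o then 1 else 0 := by
      intro o
      simp only [jointEval, settingWeight]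
      by_cases ho : C.osrc o = none
      · simp only [ho, if_true, true_imp_iff]
        congr
      · simp [ho]
    rw [Finset.prod_congr rfl fun o _ => this o, Finset.prod_ite_zero]
    simp
  have h2 : ∏ i, c.jointEval x f f' Y g (.inl ⟨f, i⟩) (X (.inl ⟨f, i⟩)) =
      if ∀ i, X (.inl ⟨f, i⟩) = Y (.inl ⟨f, i⟩) then 1 else 0 := by
    simp only [jointEval, if_true]
    rw [Finset.prod_ite_zero]
    simp [eq_comm]
  have h3 : ∏ i, c.jointEval x f f' Y g (.inl ⟨f', i⟩) (X (.inl ⟨f', i⟩)) =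
      collective F g (c.gsys f') (fun i => Y (.inl ⟨f', i⟩)) (fun i => X (.inl ⟨f', i⟩)) := by
    simp only [jointEval, if_neg hff'.symm, if_true]
    rfl
  have h4 : ∏ s : {s : c.Atom // c.IsOpen s ∧ ¬ c.OnWire f s ∧ ¬ c.OnWire f' s},
      c.jointEval x f f' Y g s.1 (X s.1) =
      ∏ s : {s : c.Atom // c.IsOpen s ∧ ¬ c.OnWire f s ∧ ¬ c.OnWire f' s},
        T.disc (c.sysOf s.1) (X s.1) := by
    refine Finset.prod_congr rfl fun s _ => ?_
    rcases s with ⟨p | s, h, h', h''⟩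
    · exact (if_neg h').trans (if_neg h'')
    · exact h.elim
  rw [h1, h2, h3, h4]
  by_cases hx : ∀ o, C.osrc o = none → X (.inr (.inr o)) = x o <;>
    by_cases hy : ∀ i, X (.inl ⟨f, i⟩) = Y (.inl ⟨f, i⟩)
  · rw [if_pos hx, if_pos hy, if_pos ⟨hx, hy⟩]
    ring
  · rw [if_neg hy, if_neg (not_and_of_not_right _ hy)]
    ring
  · rw [if_neg hx, if_neg (not_and_of_not_left _ hx)]
    ring
  · rw [if_neg hx, if_neg (not_and_of_not_left _ hx)]
    ring

omit [Group G] in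
theorem Circuit.sum_jointEval (x : ∀ o, Fin (c.ocard o + 1)) {f f' : C.GW}
    (hf : C.gtgt f = none) (hf' : C.gtgt f' = none) (hff' : f ≠ f')
    (Y : Idx c.sysOf) (g : G) :
    ∑ X, c.term X * ∏ s : {s // c.IsFinal s}, c.jointEval x f f' Y g s.1 (X s.1) =
      ∑ z', collective F g (c.gsys f') (fun i => Y (.inl ⟨f', i⟩)) z' *
        c.jointState x f f' (fun i => Y (.inl ⟨f, i⟩)) z' := by
  simp only [jointState, Finset.mul_sum]
  rw [Finset.sum_comm]
  refine Finset.sum_congr rfl fun X _ => ?_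
  rw [c.prod_jointEval x hf hf' hff' Y g X]
  refine Eq.trans ?_
    (Finset.sum_eq_single (fun i => X (.inl ⟨f', i⟩) : Idx (c.gsys f')) ?_ ?_).symm
  · by_cases h : (∀ o, C.osrc o = none → X (.inr (.inr o)) = x o) ∧
      (∀ i, X (.inl ⟨f, i⟩) = Y (.inl ⟨f, i⟩))
    · rw [if_pos h, if_pos ⟨h.1, h.2, fun _ => rfl⟩]
      exact mul_left_comm _ _ _
    · rw [if_neg h, if_neg fun h' => h ⟨h'.1, h'.2.1⟩, mul_zero, mul_zero]
  · intro z _ hz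
    rw [if_neg, mul_zero]
    rintro ⟨_, _, h⟩
    exact hz (funext fun i => (h i).symm)
  · exact fun h => absurd (@Finset.mem_univ _ (Idx.fintype _) _) h

/-- A token of a gate that receives no system of the theory is invariant, also jointly with a token
that is not influenced by the gate. -/
theorem Circuit.jointState_invariant (hT : T.IsGPT) (hF : IsSymmetry T F)
    (x : ∀ o, Fin (c.ocard o + 1)) {f f' : C.GW}
    (hf : C.gtgt f = none) (hf' : C.gtgt f' = none) (hsrc : C.gsrc f ≠ C.gsrc f')
    (hv₀ : ∀ e, C.gtgt e ≠ some (C.gsrc f'))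
    (hdesc : ¬ Relation.TransGen C.Link (C.gsrc f') (C.gsrc f)) (g : G)
    (y : Idx (c.gsys f)) (y' : Idx (c.gsys f')) :
    ∑ z', collective F g (c.gsys f') y' z' * c.jointState x f f' y z' =
      c.jointState x f f' y y' := by
  have hff' : f ≠ f' := fun h => hsrc (congrArg _ h)
  by_cases hX : IsEmpty (Idx c.sysOf)
  · simp [jointState]
  obtain ⟨X₀⟩ := not_isEmpty_iff.1 hX
  -- The evaluation is stated for a labelling of all systems, so `y` and `y'` are extended by the
  -- filler `X₀`.
  obtain ⟨Y, hY, hY'⟩ : ∃ Y : Idx c.sysOf, (fun i => Y (.inl ⟨f, i⟩)) = y ∧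
      (fun i => Y (.inl ⟨f', i⟩)) = y' := by
    refine ⟨fun s => match s with
      | .inl ⟨e, i⟩ => if h : e = f then (h.symm ▸ y : Idx (c.gsys e)) i
          else if h' : e = f' then (h'.symm ▸ y' : Idx (c.gsys e)) i else X₀ (.inl ⟨e, i⟩)
      | .inr s => X₀ (.inr s), ?_, ?_⟩
    · funext i
      exact dif_pos rfl
    · funext i
      exact (dif_neg hff'.symm).trans (dif_pos rfl)
  have hself : ¬ Relation.TransGen C.Link (C.gsrc f') (C.gsrc f') := C.acyclic _
  have hdisc : ∀ (A : Sys σ) (n : ℕ), A = Sys.cl n → ∀ k, T.disc A k = 1 := by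
    rintro _ n rfl k
    exact hT.disc_classical n k
  have hcl : ∀ (A : Sys σ) (n : ℕ), A = Sys.cl n → ∀ (g : G) (y x : A.ix),
      F g A y x = if y = x then 1 else 0 := by
    rintro _ n rfl g y x
    exact hF.trivial_classical g n y x
  -- The right-hand side does not contain `g`; this is the invariance.
  have key : ∀ g, ∑ X, c.term X * ∏ s : {s // c.IsFinal s}, c.jointEval x f f' Y g s.1 (X s.1) =
      ∑ X : Idx c.sysOf, (∏ v, c.erasedGate X₀ (C.gsrc f') v (fun j => X j.1) (fun i => X i.1)) *
        ∏ s : {s // c.IsFinal s}, c.erasedEval x f f' Y (C.gsrc f') s.1 (X s.1) := by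
    intro g
    have hsetting : ∀ o, C.osrc o = none → ∀ y x : (c.sysOf (.inr (.inr o))).ix,
        c.rotErase X₀ (C.gsrc f') g (.inr (.inr o)) y x = if y = x then 1 else 0 := by
      intro o ho y x
      refine (if_neg ?_).trans (if_neg ?_)
      · rintro ⟨v, _, hv⟩
        exact Option.some_ne_none v (hv.symm.trans ho)
      · exact fun hv => Option.some_ne_none _ (Eq.symm hv |>.trans ho)
    have h := Labelling.sum_eq_of_intertwine (L := c.toLabelling) (K := Unit) (K' := Unit)
      (c.rotErase X₀ (C.gsrc f') g) (fun _ _ _ => 1)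
      (fun v y _ x _ => c.op v y x) (fun v y _ x _ => c.erasedGate X₀ (C.gsrc f') v y x)
      (c.jointEval x f f' Y g) (c.erasedEval x f f' Y (C.gsrc f')) (fun _ _ => 1) (fun _ _ => 1)
      ?_ ?_ ?_ ?_ ?_ X₀ () ()
    · simp only [Fintype.sum_unique, Finset.prod_const_one, mul_one] at h
      exact h.symm
    -- Discarding is one on classical systems, so there an erasure is a constant function and every
    -- other wire map the identity.
    · have hdet : ∀ (s : c.Atom) (n : ℕ), c.sysOf s = Sys.cl n →
          ∃ t : (c.sysOf s).ix → (c.sysOf s).ix, ∀ y x,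
            c.rotErase X₀ (C.gsrc f') g s y x = if y = t x then 1 else 0 := by
        intro s n hs
        by_cases h1 : c.After (C.gsrc f') s
        · refine ⟨fun _ => X₀ s, fun y x => ?_⟩
          rw [Circuit.rotErase, if_pos h1, hdisc _ n hs, mul_one]
        · refine ⟨id, fun y x => ?_⟩
          rw [Circuit.rotErase, if_neg h1, hcl _ n hs, ite_self]
          rfl
      rintro (l | o)
      · exact hdet (.inr (.inl l)) _ rfl
      · exact hdet (.inr (.inr o)) _ rfl
    · rintro (p | l | o) hs y
      · exact hs.elim
      · exact hs.elim
      · refine (Finset.sum_congr rfl fun x _ => hsetting o hs y x).trans ?_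
        rw [Finset.sum_ite_eq, if_pos (Finset.mem_univ _)]
    · intro v y _ x _
      simp only [Fintype.sum_unique, Finset.prod_const_one, mul_one]
      exact c.erasedGate_intertwine hT hF X₀ hv₀ g v y x
    · rintro (p | l | o) hs t
      · by_cases h1 : p.1 = f
        · have hrot : ∀ y, c.rotErase X₀ (C.gsrc f') g (.inl p) y t = if y = t then 1 else 0 := by
            refine fun y => (if_neg ?_).trans (if_neg ?_)
            · rintro ⟨v, hv, hv'⟩
              exact hdesc ((hv'.symm.trans (congrArg C.gsrc h1)) ▸ hv)
            · exact fun hv => hsrc ((congrArg C.gsrc h1).symm.trans hv)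
          refine (Finset.sum_congr rfl fun y _ => congrArg _ (hrot y)).trans ?_
          simp only [mul_boole]
          rw [Finset.sum_ite_eq', if_pos (Finset.mem_univ _)]
          exact (if_pos h1).trans (if_pos h1).symm
        · by_cases h2 : p.1 = f'
          · have hrot : ∀ y, c.rotErase X₀ (C.gsrc f') g (.inl p) y t =
                F g (c.gsys p.1 p.2) y t := by
              refine fun y => (if_neg ?_).trans (if_pos (congrArg C.gsrc h2))
              rintro ⟨v, hv, hv'⟩
              exact hself ((hv'.symm.trans (congrArg C.gsrc h2)) ▸ hv)
            have hev : ∀ y, c.erasedEval x f f' Y (C.gsrc f') (.inl p) y =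
                if Y (.inl p) = y then 1 else 0 := fun y => (if_neg h1).trans (if_pos h2)
            refine (Finset.sum_congr rfl fun y _ => congrArg₂ _ (hev y) (hrot y)).trans ?_
            simp only [boole_mul]
            rw [Finset.sum_ite_eq, if_pos (Finset.mem_univ _)]
            exact ((if_neg h1).trans (if_pos h2)).symm
          · refine Eq.trans (Finset.sum_congr rfl fun y _ => congrArg (· * _) ?_) <|
              (c.sum_erasedDisc (hF.sum_disc hT) X₀ (C.gsrc f') g (.inl p) t).trans
              ((if_neg h1).trans (if_neg h2)).symm
            exact (if_neg h1).trans (if_neg h2)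
      · exact hs.elim
      · by_cases ho : C.osrc o = none
        · refine (Finset.sum_congr rfl fun y _ => congrArg _ (hsetting o ho y t)).trans ?_
          simp only [mul_boole]
          rw [Finset.sum_ite_eq', if_pos (Finset.mem_univ _)]
          rfl
        -- Observed outputs are averaged over with weight one, which is discarding; hence they may
        -- be erased.
        · have hw : ∀ k, c.settingWeight x o k = 1 := fun k => if_neg ho
          have he : ∀ y, c.erasedEval x f f' Y (C.gsrc f') (.inr (.inr o)) y = 1 := hw
          have hj : c.jointEval x f f' Y g (.inr (.inr o)) t = 1 := hw t
          rw [hj]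
          have := c.sum_erasedDisc (hF.sum_disc hT) X₀ (C.gsrc f') g (.inr (.inr o)) t
          rw [hdisc (c.sysOf (.inr (.inr o))) _ rfl] at this
          refine Eq.trans (Finset.sum_congr rfl fun y _ => congrArg (· * _) ?_) this
          rw [he, Circuit.erasedDisc, hdisc (c.sysOf (.inr (.inr o))) _ rfl, ite_self]
    · intro e _ z
      simp
  -- Comparison of `g` with the neutral element, for which the evaluation gives the joint state
  -- itself.
  have h1 := (c.sum_jointEval x hf hf' hff' Y g).symm.trans
    ((key g).trans ((key 1).symm.trans (c.sum_jointEval x hf hf' hff' Y 1)))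
  rw [hY, hY', collective_one hF] at h1
  rw [h1]
  simp

end Tokens

/-! ### Shared frame states and uniqueness of the root gate. -/

section SharedFrame

variable {σ : Signature} {T : OpTheory σ} {G : Type} {F : SymAction σ G}
  {C : CausalStructure}

theorem Circuit.jointState_comm (c : Circuit T C) (x : ∀ o, Fin (c.ocard o + 1)) (f f' : C.GW)
    (y : Idx (c.gsys f)) (y' : Idx (c.gsys f')) :
    c.jointState x f f' y y' = c.jointState x f' f y' y := by
  refine Finset.sum_congr rfl fun X _ => ?_
  have h : ∏ s : {s : c.Atom // c.IsOpen s ∧ ¬ c.OnWire f s ∧ ¬ c.OnWire f' s},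
        T.disc (c.sysOf s.1) (X s.1) =
      ∏ s : {s : c.Atom // c.IsOpen s ∧ ¬ c.OnWire f' s ∧ ¬ c.OnWire f s},
        T.disc (c.sysOf s.1) (X s.1) :=
    Fintype.prod_equiv (Equiv.subtypeEquivRight fun s => and_congr_right fun _ => and_comm) _ _
      fun _ => rfl
  rw [h]
  exact if_congr (and_congr_right fun _ => and_comm) rfl rfl

variable [Group G] {α β : Type} [Fintype α] [Fintype β] {a : α → Sys σ} {b : β → Sys σ}
  {ρ : Idx a → Idx b → ℝ}

omit [Group G] in
-- Invariance of the second party reduces the twirl to an average over rotations of the first party,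
-- and these commute with the relational action.
theorem not_isSharedFrame_of_right [Fintype G]
    (h : ∀ g y y', ∑ z', collective F g b y' z' * ρ y z' = ρ y y') : ¬ IsSharedFrame F ρ := by
  rintro ⟨g, hg⟩
  have h1 : ∀ y y', twirl F ρ y y' =
      ∑ k : G, ∑ z, (Fintype.card G : ℝ)⁻¹ * (collective F k a y z * ρ z y') := by
    intro y y'
    simp only [twirl, Finset.mul_sum]
    refine Finset.sum_congr rfl fun k _ => Finset.sum_congr rfl fun z _ => ?_
    rw [← h k z y', Finset.mul_sum, Finset.mul_sum]
    simp only [mul_assoc]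
  refine hg (funext fun y => funext fun y' => ?_)
  simp only [relational, h1, Finset.mul_sum]
  rw [Finset.sum_comm]
  refine Finset.sum_congr rfl fun k _ => ?_
  rw [Finset.sum_comm]
  refine Finset.sum_congr rfl fun z _ => ?_
  rw [← h g z y', Finset.mul_sum, Finset.mul_sum]
  exact Finset.sum_congr rfl fun z' _ => by ring

/-- Invariance of the first party reduces the twirl to an average over rotations of the second
party; the relational action only permutes the terms of this average. -/
theorem not_isSharedFrame_of_left [Fintype G] (hF : IsSymmetry T F)
    (h : ∀ g y y', ∑ z, collective F g a y z * ρ z y' = ρ y y') : ¬ IsSharedFrame F ρ := by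
  rintro ⟨g, hg⟩
  have h1 : ∀ y y', twirl F ρ y y' =
      ∑ k : G, ∑ z', (Fintype.card G : ℝ)⁻¹ * (collective F k b y' z' * ρ y z') := by
    intro y y'
    simp only [twirl, Finset.mul_sum]
    refine Finset.sum_congr rfl fun k _ => ?_
    rw [Finset.sum_comm]
    refine Finset.sum_congr rfl fun z' _ => ?_
    rw [← h k y z', Finset.mul_sum, Finset.mul_sum]
    exact Finset.sum_congr rfl fun z _ => by ring
  refine hg (funext fun y => funext fun y' => ?_)
  rw [relational, h1, ← Equiv.sum_comp (Equiv.mulLeft g)]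
  simp only [h1, Equiv.coe_mulLeft, ← collective_mul hF, seqComp, Finset.mul_sum, Finset.sum_mul]
  rw [Finset.sum_comm]
  refine Finset.sum_congr rfl fun k _ => ?_
  rw [Finset.sum_comm]
  exact Finset.sum_congr rfl fun z _ => Finset.sum_congr rfl fun w _ => by ring

/-- Latent systems prepared by two different root gates cannot be given tokens in a shared frame
state. -/
theorem AllowsSharedFrame.root_unique [Fintype G] (hT : T.IsGPT) (hF : IsSymmetry T F)
    (h : AllowsSharedFrame T F C) (e e' : C.GW) (he : ∀ f, C.gtgt f ≠ some (C.gsrc e))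
    (he' : ∀ f, C.gtgt f ≠ some (C.gsrc e')) : C.gsrc e = C.gsrc e' := by
  by_contra hne
  obtain ⟨c, x, hc⟩ := h
  have hroot : ∀ e, (∀ f, C.gtgt f ≠ some (C.gsrc e)) →
      ∀ f, C.withTokens.gtgt f ≠ some (C.withTokens.gsrc (.inr e)) := by
    rintro e he (f | f)
    · exact he f
    · exact Option.some_ne_none _ ∘ Eq.symm
  have hshare := hc e e' fun h => hne (congrArg _ h)
  -- By acyclicity one of the two gates is not influenced by the other, and the token of the
  -- uninfluencing one is invariant: the token of `e` in the first case, that of `e'` in the second.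
  by_cases hd : Relation.TransGen C.withTokens.Link (C.withTokens.gsrc (.inr e'))
      (C.withTokens.gsrc (.inr e))
  · refine not_isSharedFrame_of_left hF (fun g y y' => ?_) hshare
    refine (Finset.sum_congr rfl fun z _ => congrArg _ (c.jointState_comm x _ _ z y')).trans <|
      Eq.trans ?_ (c.jointState_comm x _ _ y y').symm
    exact c.jointState_invariant hT hF x (f := .inr e') (f' := .inr e) rfl rfl (Ne.symm hne) (hroot e he)
      (fun hd' => C.withTokens.acyclic _ (hd.trans hd')) g y' y
  · exact not_isSharedFrame_of_right (fun g y y' => c.jointState_invariant hT hF x rfl rfl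
      (f := .inr e) (f' := .inr e') hne (hroot e' he') hd g y y') hshare

theorem OpTheory.IsGPT.classical_state (hT : T.IsGPT) [IsEmpty α] {N : ℕ}
    {M : Tensor a (fun _ : Unit => (Sys.cl N : Sys σ))} (hM : M ∈ T.proc a _) (x : Idx a) :
    (∀ k : Fin (N + 1), 0 ≤ M (fun _ => k) x) ∧ ∑ k : Fin (N + 1), M (fun _ => k) x = 1 := by
  -- A family without members is a family of classical systems, so the operation is a stochastic
  -- map.
  obtain rfl : a = fun _ => Sys.cl 0 := funext isEmptyElim
  obtain ⟨h1, h2⟩ := (hT.classical (fun _ => 0) (fun _ : Unit => N) M).1 hM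
  refine ⟨fun k => h1 _ _, ?_⟩
  rw [← h2 x, Idx.sum_unit]
  rfl

/-- The given data fix the probability of the outcomes `lab g` only. As the outcomes form a
probability distribution and `lab h` is certain on the state rotated by `h`, all other outcomes have
probability zero. -/
theorem HasPerfectFrame.exists_isPerfectFrame (hT : T.IsGPT) (hF : IsSymmetry T F)
    (h : HasPerfectFrame T F) :
    ∃ (n : ℕ) (r : Fin n → Sys σ) (N : ℕ) (ω : Idx r → ℝ)
      (m : Tensor r (fun _ : Unit => (Sys.cl N : Sys σ))) (lab : G → Fin (N + 1)),
      IsPerfectFrame T F r ω m lab := by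
  obtain ⟨n, r, N, ω, hω, m, hm, lab, h⟩ := h
  have hω' : (fun y _ => ω y fun i => i.elim) = ω := by
    funext y x
    exact congrArg _ (funext fun i => i.elim)
  have hrot : ∀ g, seqComp m (seqComp (collective F g r) ω) ∈ T.proc _ _ := by
    intro g
    refine hT.seq _ _ _ _ _ hm ?_
    have h1 := hF.conj g _ _ _ hω
    have h2 : collective F g⁻¹ (fun i : Empty => (i.elim : Sys σ)) =
        fun y x => if y = x then 1 else 0 := by
      funext y x
      exact (if_pos (funext fun i : Empty => i.elim)).symm
    rwa [h2, seqComp_one] at h1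
  have hone : ∀ g, seqComp m (seqComp (collective F g r) ω) (fun _ => lab g) (fun i => i.elim) = 1 :=
    fun g => (h g g).trans (if_pos rfl)
  refine ⟨n, r, N, fun y => ω y fun i => i.elim, m, lab, hω'.symm ▸ hω, hm, fun g k => ?_,
    fun g g' hgg => ?_, ?_⟩
  · obtain ⟨h1, h2⟩ := hT.classical_state (hrot g) fun i => i.elim
    split_ifs with hk
    · rw [hk]
      exact hone g
    · have h3 := Finset.sum_erase_add Finset.univ (fun k : Fin (N + 1) =>
        seqComp m (seqComp (collective F g r) ω) (fun _ => k) fun i => i.elim)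
        (Finset.mem_univ (lab g))
      rw [h2, hone, add_eq_right] at h3
      exact (Finset.sum_eq_zero_iff_of_nonneg fun k _ => h1 k).1 h3 k
        (Finset.mem_erase.2 ⟨hk, Finset.mem_univ _⟩)
  · by_contra hne
    have h1 := h g g'
    rw [if_neg hne, hgg, hone] at h1
    exact one_ne_zero h1
  · have h1 := hT.sum_disc_seqComp hω fun i => i.elim
    simpa [mul_comm] using h1

/-- If all pairs of latent systems can be given tokens in a shared frame state, there is no gap. -/
theorem AllowsSharedFrame.correlations_subset [Fintype G] (hT : T.IsGPT) (hF : IsSymmetry T F)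
    (hframe : HasPerfectFrame T F) (h : AllowsSharedFrame T F C) :
    Correlations T C ⊆ Correlations (swirl T F) C := by
  obtain ⟨n, r, N, ω, m, lab, hω⟩ := hframe.exists_isPerfectFrame hT hF
  exact correlations_subset_swirl hT.closed hF (hF.sum_disc hT) hω (h.root_unique hT hF)

end SharedFrame

/-! ## Quantum theory -/

/-! ### Splitting sums over labels of composite systems. -/

section PiSums

variable {R : Type} [AddCommMonoid R]

theorem Idx.sum_reindex {σ : Signature} {α α' : Type} [Fintype α] [Fintype α'] (e : α ≃ α')
    {a : α' → Sys σ} (f : Idx (fun i => a (e i)) → R) :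
    ∑ x : Idx a, f (fun i => x (e i)) = ∑ x, f x :=
  Fintype.sum_equiv (Equiv.piCongrLeft (fun j => (a j).ix) e).symm _ _ fun _ => rfl

theorem HIdx.sum_reindex {α α' : Type} [Fintype α] [Fintype α'] (e : α ≃ α')
    {a : α' → Sys qSig} (f : HIdx (fun i => a (e i)) → R) :
    ∑ x : HIdx a, f (fun i => x (e i)) = ∑ x, f x :=
  Fintype.sum_equiv (Equiv.piCongrLeft (fun j => Fin (lev (a j) + 1)) e).symm _ _ fun _ => rfl

theorem Idx.sum_elim {σ : Signature} {α β : Type} [Fintype α] [Fintype β] {a : α → Sys σ}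
    {b : β → Sys σ} (f : Idx a → Idx b → R) :
    ∑ x : Idx (Sum.elim a b), f (fun i => x (.inl i)) (fun i => x (.inr i)) =
      ∑ x, ∑ y, f x y :=
  (Fintype.sum_equiv (ι := Idx (Sum.elim a b)) (κ := Idx a × Idx b)
    (Equiv.sumPiEquivProdPi fun s => (Sum.elim a b s).ix) _
    (fun z => f z.1 z.2) fun _ => rfl).trans (Fintype.sum_prod_type _)

theorem HIdx.sum_elim {α β : Type} [Fintype α] [Fintype β] {a : α → Sys qSig}
    {b : β → Sys qSig} (f : HIdx a → HIdx b → R) :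
    ∑ x : HIdx (Sum.elim a b), f (fun i => x (.inl i)) (fun i => x (.inr i)) =
      ∑ x, ∑ y, f x y :=
  (Fintype.sum_equiv (ι := HIdx (Sum.elim a b)) (κ := HIdx a × HIdx b)
    (Equiv.sumPiEquivProdPi fun s => Fin (lev (Sum.elim a b s) + 1)) _
    (fun z => f z.1 z.2) fun _ => rfl).trans (Fintype.sum_prod_type _)

theorem HIdx.sum_option {α : Type} [Fintype α] {n : ℕ} {a : α → Sys qSig}
    (f : Fin (n + 1) → HIdx a → R) :
    ∑ x : HIdx (fun o : Option α => o.elim (Sys.cl n) a), f (x none) (fun i => x (some i)) =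
      ∑ k, ∑ x, f k x :=
  (Fintype.sum_equiv (ι := HIdx (fun o : Option α => o.elim (Sys.cl n) a))
    (κ := Fin (n + 1) × HIdx a) (Equiv.piOptionEquivProd (β := fun o : Option α =>
    Fin (lev (o.elim (Sys.cl n) a) + 1))) _
    (fun z => f z.1 z.2) fun _ => rfl).trans (Fintype.sum_prod_type _)

theorem HIdx.sum_option₂ {α : Type} [Fintype α] {n : ℕ} {a : α → Sys qSig}
    (f : Fin (n + 1) → HIdx a → Fin (n + 1) → HIdx a → R) :
    ∑ x : HIdx (fun o : Option α => o.elim (Sys.cl n) a),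
      ∑ y : HIdx (fun o : Option α => o.elim (Sys.cl n) a),
      f (x none) (fun i => x (some i)) (y none) (fun i => y (some i)) =
      ∑ k, ∑ x, ∑ l, ∑ y, f k x l y :=
  (Finset.sum_congr rfl fun x _ => HIdx.sum_option (f (x none) fun i => x (some i))).trans
    (HIdx.sum_option fun k x => ∑ l, ∑ y, f k x l y)

end PiSums

/-! ### Basis operators of quantum theory, and closure under composition. -/

namespace QT

theorem basisOp_cl (n : ℕ) (k r c : Fin (n + 1)) :
    basisOp (Sys.cl n) k r c = if k = r ∧ k = c then 1 else 0 := by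
  change Matrix.single k k (1 : ℂ) r c = _
  rw [Matrix.single_apply]

theorem basisOp_gpt (q : ℕ) (i j r c : Fin (q + 1)) :
    basisOp (Sys.gpt q) (i, j) r c = if i = j then if i = r ∧ i = c then 1 else 0
      else if i < j then (Real.sqrt 2 : ℂ)⁻¹ *
        ((if i = r ∧ j = c then 1 else 0) + if j = r ∧ i = c then 1 else 0)
      else Complex.I * (Real.sqrt 2 : ℂ)⁻¹ *
        ((if i = r ∧ j = c then 1 else 0) - if j = r ∧ i = c then 1 else 0) := by
  change (if i = j then Matrix.single i i (1 : ℂ)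
    else if i < j then ((Real.sqrt 2 : ℂ)⁻¹) • (Matrix.single i j 1 + Matrix.single j i 1)
    else (Complex.I * (Real.sqrt 2 : ℂ)⁻¹) • (Matrix.single i j 1 - Matrix.single j i 1) :
      Matrix (Fin (q + 1)) (Fin (q + 1)) ℂ) r c = _
  by_cases h : i = j
  · rw [if_pos h, if_pos h, Matrix.single_apply]
  · have h1 : ∀ z : ℂ, (z • (Matrix.single i j 1 + Matrix.single j i 1) :
        Matrix (Fin (q + 1)) (Fin (q + 1)) ℂ) r c =
        z * ((if i = r ∧ j = c then 1 else 0) + if j = r ∧ i = c then 1 else 0) := by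
      intro z
      rw [Matrix.smul_apply, Matrix.add_apply, Matrix.single_apply, Matrix.single_apply, smul_eq_mul]
    have h2 : ∀ z : ℂ, (z • (Matrix.single i j 1 - Matrix.single j i 1) :
        Matrix (Fin (q + 1)) (Fin (q + 1)) ℂ) r c =
        z * ((if i = r ∧ j = c then 1 else 0) - if j = r ∧ i = c then 1 else 0) := by
      intro z
      rw [Matrix.smul_apply, Matrix.sub_apply, Matrix.single_apply, Matrix.single_apply, smul_eq_mul]
    rw [if_neg h, if_neg h]
    by_cases h' : i < j
    · rw [if_pos h', if_pos h']
      exact h1 _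
    · rw [if_neg h', if_neg h']
      exact h2 _

theorem trace_basisOp_cl (n : ℕ) (k : Fin (n + 1)) : (basisOp (Sys.cl n) k).trace = 1 := by
  have h : ∑ r : Fin (n + 1), basisOp (Sys.cl n) k r r = 1 := by
    refine (Finset.sum_congr rfl fun r _ => basisOp_cl n k r r).trans ?_
    simp
  exact h

theorem trace_basisOp_gpt (q : ℕ) (i j : Fin (q + 1)) :
    (basisOp (Sys.gpt q) (i, j)).trace = if i = j then 1 else 0 := by
  have h : ∑ r : Fin (q + 1), basisOp (Sys.gpt q) (i, j) r r = if i = j then 1 else 0 := by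
    refine (Finset.sum_congr rfl fun r _ => basisOp_gpt q i j r r).trans ?_
    by_cases hij : i = j
    · simp [hij]
    · have h1 : ∀ r : Fin (q + 1), ¬ (i = r ∧ j = r) := fun r h => hij (h.1.trans h.2.symm)
      have h2 : ∀ r : Fin (q + 1), ¬ (j = r ∧ i = r) := fun r h => h1 r h.symm
      simp [hij, h1, h2]
  exact h

theorem disc_cl (n : ℕ) (k : (Sys.cl n : Sys qSig).ix) : QT.disc (Sys.cl n) k = 1 :=
  congrArg Complex.re (trace_basisOp_cl n k)

theorem disc_gpt (q : ℕ) (i j : Fin (q + 1)) :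
    QT.disc (Sys.gpt q) (i, j) = if i = j then 1 else 0 := by
  refine (congrArg Complex.re (trace_basisOp_gpt q i j)).trans ?_
  split_ifs <;> rfl

theorem trace_basisOp (A : Sys qSig) (x : A.ix) :
    (basisOp A x).trace = (QT.disc A x : ℝ) := by
  rcases A with n | q
  · rw [disc_cl]
    exact (trace_basisOp_cl n x).trans Complex.ofReal_one.symm
  · obtain ⟨i, j⟩ := x
    refine (trace_basisOp_gpt q i j).trans (Eq.trans ?_ (congrArg _ (disc_gpt q i j)).symm)
    split_ifs <;> simp

theorem trace_tensorOp {α : Type} [Fintype α] (a : α → Sys qSig) (x : Idx a) :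
    (tensorOp a x).trace = (∏ i, QT.disc (a i) (x i) : ℝ) := by
  rw [Complex.ofReal_prod]
  simp only [← trace_basisOp]
  exact (Fintype.prod_sum fun i (k : Fin (lev (a i) + 1)) => basisOp (a i) (x i) k k).symm

/-- Entrywise form in which any finite type may index the Kraus operators, so that products, sums
and sets of labels can be used directly. The trace condition is real, as the basis operators have
real traces. -/
theorem mem_proc_iff {α β : Type} [Fintype α] [Fintype β] {a : α → Sys qSig} {b : β → Sys qSig}
    {M : Tensor a b} : M ∈ QT.proc a b ↔
      (∃ (ι : Type) (_ : Fintype ι) (K : ι → HIdx b → HIdx a → ℂ), ∀ x r r',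
        ∑ y, (M y x : ℂ) * tensorOp b y r r' =
          ∑ l, ∑ c, ∑ c', K l r c * tensorOp a x c c' * star (K l r' c')) ∧
      ∀ x, ∑ y, M y x * ∏ j, QT.disc (b j) (y j) = ∏ i, QT.disc (a i) (x i) := by
  have hmul : ∀ (K : Matrix (HIdx b) (HIdx a) ℂ) x r r',
      (K * tensorOp a x * K.conjTranspose) r r' =
        ∑ c, ∑ c', K r c * tensorOp a x c c' * star (K r' c') := by
    intro K x r r'
    rw [Finset.sum_comm]
    simp only [Matrix.mul_apply, Finset.sum_mul, Matrix.conjTranspose_apply]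
  refine and_congr ⟨?_, ?_⟩ ?_
  · rintro ⟨m, K, hK⟩
    refine ⟨Fin m, inferInstance, K, fun x r r' => ?_⟩
    have h := congrFun (congrFun (hK x) r) r'
    simpa only [Matrix.sum_apply, Matrix.smul_apply, smul_eq_mul, hmul] using h
  · rintro ⟨ι, _, K, hK⟩
    refine ⟨Fintype.card ι, fun l => Matrix.of (K ((Fintype.equivFin ι).symm l)), fun x => ?_⟩
    ext r r'
    simp only [Matrix.sum_apply, Matrix.smul_apply, smul_eq_mul, hmul]
    rw [hK, ← Equiv.sum_comp (Fintype.equivFin ι).symm]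
    rfl
  · refine forall_congr' fun x => ?_
    simp only [trace_tensorOp]
    exact_mod_cast Iff.rfl

theorem reindexable : QT.Reindexable where
  reindex {α β α' β' _ _ _ _} e f a b M hM := by
    rw [mem_proc_iff] at hM ⊢
    obtain ⟨⟨ι, _, K, hK⟩, htr⟩ := hM
    have ht : ∀ {α α' : Type} [Fintype α] [Fintype α'] (e : α ≃ α') (a : α' → Sys qSig) (x : Idx a)
        (r r' : HIdx a), tensorOp a x r r' = tensorOp (fun i => a (e i)) (fun i => x (e i))
          (fun i => r (e i)) (fun i => r' (e i)) := fun e a x r r' =>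
      (Equiv.prod_comp e fun i => basisOp (a i) (x i) (r i) (r' i)).symm
    refine ⟨⟨ι, inferInstance, fun l r c => K l (fun j => r (f j)) fun i => c (e i),
      fun x r r' => ?_⟩, fun x => ?_⟩
    · simp only [ht f b, ht e a]
      refine (Idx.sum_reindex f fun y =>
        (M y (fun i => x (e i)) : ℂ) * tensorOp (fun j => b (f j)) y (fun j => r (f j))
          fun j => r' (f j)).trans ?_
      refine (hK _ _ _).trans (Finset.sum_congr rfl fun l _ => ?_)
      refine Eq.trans ?_ (HIdx.sum_reindex e fun c =>
        ∑ c' : HIdx a, K l (fun j => r (f j)) c * tensorOp (fun i => a (e i)) (fun i => x (e i)) c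
          (fun i => c' (e i)) * star (K l (fun j => r' (f j)) fun i => c' (e i))).symm
      exact Finset.sum_congr rfl fun c _ => (HIdx.sum_reindex e fun c' =>
          K l (fun j => r (f j)) c * tensorOp (fun i => a (e i)) (fun i => x (e i)) c
          c' * star (K l (fun j => r' (f j)) c')).symm
    · rw [← Equiv.prod_comp e, ← htr fun i => x (e i)]
      simp only [← Equiv.prod_comp f]
      exact Idx.sum_reindex f fun y =>
        M y (fun i => x (e i)) * ∏ j, QT.disc (b (f j)) (y j)

theorem ident_mem {α : Type} [Fintype α] (a : α → Sys qSig) :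
    (fun y x => if y = x then 1 else 0 : Tensor a a) ∈ QT.proc a a := by
  refine mem_proc_iff.2 ⟨⟨Unit, inferInstance, fun _ r c => if r = c then 1 else 0,
    fun x r r' => ?_⟩, fun x => ?_⟩
  · simp [apply_ite Complex.ofReal]
  · simp

theorem seq_mem {α β γ : Type} [Fintype α] [Fintype β] [Fintype γ]
    (a : α → Sys qSig) (b : β → Sys qSig) (c : γ → Sys qSig) (N : Tensor b c) (M : Tensor a b)
    (hN : N ∈ QT.proc b c) (hM : M ∈ QT.proc a b) : seqComp N M ∈ QT.proc a c := by
  obtain ⟨⟨m, K, hK⟩, htr⟩ := hM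
  obtain ⟨⟨n, L, hL⟩, hty⟩ := hN
  have key : ∀ x, ∑ z, (seqComp N M z x : ℂ) • tensorOp c z =
      ∑ p : Fin n × Fin m, (L p.1 * K p.2) * tensorOp a x * (L p.1 * K p.2).conjTranspose := by
    intro x
    simp only [seqComp, Complex.ofReal_sum, Complex.ofReal_mul, Finset.sum_smul]
    rw [Finset.sum_comm]
    simp only [mul_comm (N _ _ : ℂ), mul_smul, ← Finset.smul_sum, hL]
    rw [Fintype.sum_prod_type]
    simp only [Finset.smul_sum]
    rw [Finset.sum_comm]
    refine Finset.sum_congr rfl fun l _ => ?_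
    simp only [Matrix.conjTranspose_mul, Matrix.mul_assoc, ← Matrix.mul_sum]
    simp only [← Matrix.mul_assoc, ← Matrix.sum_mul]
    rw [← hK x]
    simp only [Matrix.mul_sum, Matrix.sum_mul, Matrix.mul_smul, Matrix.smul_mul]
  refine ⟨⟨Fintype.card (Fin n × Fin m), fun l => L ((Fintype.equivFin _).symm l).1 *
    K ((Fintype.equivFin _).symm l).2, fun x => ?_⟩, fun x => ?_⟩
  · rw [key, ← Equiv.sum_comp (Fintype.equivFin (Fin n × Fin m)).symm]
  · simp only [seqComp, Complex.ofReal_sum, Complex.ofReal_mul, Finset.sum_mul]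
    rw [Finset.sum_comm, ← htr x]
    simp only [← hty, Finset.mul_sum]
    exact Finset.sum_congr rfl fun y _ => Finset.sum_congr rfl fun z _ => by ring

theorem par_mem {α β α' β' : Type} [Fintype α] [Fintype β] [Fintype α'] [Fintype β']
    (a : α → Sys qSig) (b : β → Sys qSig) (a' : α' → Sys qSig) (b' : β' → Sys qSig)
    (M : Tensor a b) (M' : Tensor a' b') (hM : M ∈ QT.proc a b) (hM' : M' ∈ QT.proc a' b') :
    parComp M M' ∈ QT.proc (Sum.elim a a') (Sum.elim b b') := by
  rw [mem_proc_iff] at *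
  obtain ⟨⟨ι, _, K, hK⟩, htr⟩ := hM
  obtain ⟨⟨ι', _, K', hK'⟩, htr'⟩ := hM'
  have ht : ∀ {α α' : Type} [Fintype α] [Fintype α'] (a : α → Sys qSig) (a' : α' → Sys qSig)
      (x : Idx (Sum.elim a a')) (r r' : HIdx (Sum.elim a a')),
      tensorOp (Sum.elim a a') x r r' =
        tensorOp a (fun i => x (.inl i)) (fun i => r (.inl i)) (fun i => r' (.inl i)) *
        tensorOp a' (fun i => x (.inr i)) (fun i => r (.inr i)) (fun i => r' (.inr i)) :=
    fun a a' x r r' => Fintype.prod_sum_type _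
  refine ⟨⟨ι × ι', inferInstance, fun l r c => K l.1 (fun j => r (.inl j)) (fun i => c (.inl i)) *
      K' l.2 (fun j => r (.inr j)) (fun i => c (.inr i)), fun x r r' => ?_⟩, fun x => ?_⟩
  · simp only [ht, parComp, Complex.ofReal_mul, Fintype.sum_prod_type]
    refine (Idx.sum_elim fun y y' =>
      (M y _ : ℂ) * (M' y' _ : ℂ) * (tensorOp b y _ _ * tensorOp b' y' _ _)).trans ?_
    have h1 : ∀ l l', ∑ c : HIdx (Sum.elim a a'), ∑ c' : HIdx (Sum.elim a a'),
        K l (fun j => r (.inl j)) (fun i => c (.inl i)) *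
        K' l' (fun j => r (.inr j)) (fun i => c (.inr i)) *
        (tensorOp a (fun i => x (.inl i)) (fun i => c (.inl i)) (fun i => c' (.inl i)) *
        tensorOp a' (fun i => x (.inr i)) (fun i => c (.inr i)) (fun i => c' (.inr i))) *
        star (K l (fun j => r' (.inl j)) (fun i => c' (.inl i)) *
        K' l' (fun j => r' (.inr j)) (fun i => c' (.inr i))) =
        (∑ c, ∑ c', K l (fun j => r (.inl j)) c * tensorOp a (fun i => x (.inl i)) c c' *
          star (K l (fun j => r' (.inl j)) c')) *
        ∑ c, ∑ c', K' l' (fun j => r (.inr j)) c * tensorOp a' (fun i => x (.inr i)) c c' *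
          star (K' l' (fun j => r' (.inr j)) c') := by
      intro l l'
      rw [Finset.sum_mul_sum]
      refine (HIdx.sum_elim fun c d =>
        ∑ c' : HIdx (Sum.elim a a'), K l (fun j => r (.inl j)) c * K' l' (fun j => r (.inr j)) d *
        (tensorOp a (fun i => x (.inl i)) c (fun i => c' (.inl i)) *
        tensorOp a' (fun i => x (.inr i)) d (fun i => c' (.inr i))) *
        star (K l (fun j => r' (.inl j)) (fun i => c' (.inl i)) *
        K' l' (fun j => r' (.inr j)) (fun i => c' (.inr i)))).trans ?_
      refine Finset.sum_congr rfl fun c _ => Finset.sum_congr rfl fun d _ => ?_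
      rw [Finset.sum_mul_sum]
      refine (HIdx.sum_elim fun c' d' =>
        K l (fun j => r (.inl j)) c * K' l' (fun j => r (.inr j)) d *
        (tensorOp a (fun i => x (.inl i)) c c' * tensorOp a' (fun i => x (.inr i)) d d') *
        star (K l (fun j => r' (.inl j)) c' * K' l' (fun j => r' (.inr j)) d')).trans ?_
      refine Finset.sum_congr rfl fun c' _ => Finset.sum_congr rfl fun d' _ => ?_
      rw [star_mul']
      ring
    refine Eq.trans ?_ (Finset.sum_congr rfl fun l _ => Finset.sum_congr rfl fun l' _ =>
      (h1 l l').symm)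
    rw [← Finset.sum_mul_sum]
    refine Eq.trans ?_ (congrArg₂ (· * ·) (hK _ _ _) (hK' _ _ _))
    rw [Finset.sum_mul_sum]
    exact Finset.sum_congr rfl fun y _ => Finset.sum_congr rfl fun y' _ => by ring
  · rw [Fintype.prod_sum_type]
    refine Eq.trans ?_ (congrArg₂ (· * ·) (htr fun i => x (.inl i)) (htr' fun i => x (.inr i)))
    rw [Finset.sum_mul_sum]
    simp only [Fintype.prod_sum_type, parComp]
    refine (Idx.sum_elim fun y y' =>
      M y _ * M' y' _ * ((∏ j, QT.disc (b j) (y j)) * ∏ j, QT.disc (b' j) (y' j))).trans ?_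
    exact Finset.sum_congr rfl fun y _ => Finset.sum_congr rfl fun y' _ => by ring

end QT

/-! ### Stochastic maps and classical control in quantum theory. -/

namespace QT

/-- Labels of a classical system, as computational basis labels. -/
def clEquiv {α : Type} (n : α → ℕ) :
    Idx (fun i => (Sys.cl (n i) : Sys qSig)) ≃ HIdx (fun i => (Sys.cl (n i) : Sys qSig)) :=
  Equiv.refl _

theorem prod_boole_pi {α : Type} [Fintype α] {P : α → Type} (x r c : ∀ i, P i)
    {_ : ∀ i, Decidable (x i = r i ∧ x i = c i)} {_ : Decidable (x = r)} {_ : Decidable (x = c)} :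
    ∏ i, (if x i = r i ∧ x i = c i then (1 : ℂ) else 0) =
      if x = r then if x = c then 1 else 0 else 0 := by
  rw [← ite_and]
  by_cases h : x = r ∧ x = c
  · rw [if_pos h]
    exact Finset.prod_eq_one fun i _ => if_pos ⟨congrFun h.1 i, congrFun h.2 i⟩
  · rw [if_neg h]
    have : ∃ i, ¬ (x i = r i ∧ x i = c i) := by
      by_contra! h'
      exact h ⟨funext fun i => (h' i).1, funext fun i => (h' i).2⟩
    obtain ⟨i, hi⟩ := this
    exact Finset.prod_eq_zero (Finset.mem_univ i) (if_neg hi)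

theorem tensorOp_cl {α : Type} [Fintype α] (n : α → ℕ)
    (x : Idx (fun i => (Sys.cl (n i) : Sys qSig))) (r c : HIdx (fun i => (Sys.cl (n i) : Sys qSig))) :
    tensorOp (fun i => Sys.cl (n i)) x r c =
      if clEquiv n x = r then if clEquiv n x = c then 1 else 0 else 0 := by
  refine (Finset.prod_congr rfl fun i _ => basisOp_cl (n i) (x i) (r i) (c i)).trans ?_
  exact prod_boole_pi (P := fun i => Fin (n i + 1)) x r c

/-- The Kraus operators are `√M(y,x) |y⟩⟨x|`, one for each pair of labels. -/
theorem stochastic_mem {α β : Type} [Fintype α] [Fintype β] (n : α → ℕ) (m : β → ℕ)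
    (M : Tensor (fun i => (Sys.cl (n i) : Sys qSig)) (fun j => (Sys.cl (m j) : Sys qSig)))
    (h0 : ∀ y x, 0 ≤ M y x) (h1 : ∀ x, ∑ y, M y x = 1) :
    M ∈ QT.proc (fun i => Sys.cl (n i)) (fun j => Sys.cl (m j)) := by
  refine mem_proc_iff.2 ⟨⟨Idx (fun j => (Sys.cl (m j) : Sys qSig)) ×
    Idx (fun i => (Sys.cl (n i) : Sys qSig)), inferInstance,
    fun l r c => if clEquiv m l.1 = r then if clEquiv n l.2 = c then (Real.sqrt (M l.1 l.2) : ℂ)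
      else 0 else 0, fun x r r' => ?_⟩, fun x => ?_⟩
  · simp only [tensorOp_cl, mul_ite, mul_one, mul_zero, ite_mul, zero_mul]
    simp only [Finset.sum_ite_eq, Finset.sum_ite_irrel, Finset.sum_const_zero, Finset.mem_univ,
      if_true]
    rw [Fintype.sum_prod_type]
    refine Finset.sum_congr rfl fun y _ => ?_
    simp only [EmbeddingLike.apply_eq_iff_eq]
    by_cases hr : clEquiv m y = r
    · by_cases hr' : clEquiv m y = r'
      · simp [hr, apply_ite (starRingEnd ℂ), ← Complex.ofReal_mul, Real.mul_self_sqrt (h0 _ _)]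
      · simp only [if_neg hr', star_zero, mul_zero, ite_self, Finset.sum_const_zero]
    · simp [hr]
  · simp only [disc_cl, Finset.prod_const_one, mul_one]
    exact h1 x

/-- The operator `B` of a classical control value is a product of two Kronecker deltas, so both sums
over the control collapse to `j₀`. This evaluates a Kraus operator of the form `⟨k| ⊗ K`. -/
theorem sum_controlled {n : ℕ} {H : Type} [Fintype H] (δ : Fin (n + 1) → Fin (n + 1) → ℂ)
    (hδ : ∀ k j, δ k j = if k = j then 1 else 0) (K K' : H → ℂ) (S : H → H → ℂ)
    (k j₀ : Fin (n + 1)) (B : Fin (n + 1) → Fin (n + 1) → ℂ)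
    (hB : ∀ j j', B j j' = δ j₀ j * δ j₀ j') :
    ∑ j, ∑ c, ∑ j', ∑ c', δ k j * K c * (B j j' * S c c') *
        star (δ k j' * K' c') =
      δ k j₀ * ∑ c, ∑ c', K c * S c c' * star (K' c') := by
  simp only [hB, hδ]
  rw [Finset.sum_eq_single j₀ (fun j _ hj => by simp [hj.symm]) (by simp), Finset.mul_sum]
  refine Finset.sum_congr rfl fun c _ => ?_
  rw [Finset.sum_eq_single j₀ (fun j _ hj => by simp [hj.symm]) (by simp), Finset.mul_sum]
  refine Finset.sum_congr rfl fun c' _ => ?_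
  by_cases hk : k = j₀ <;> simp [hk]

/-- The Kraus operators are `⟨k| ⊗ K`, where `K` runs over the Kraus operators of `M k`. -/
theorem control_mem {α β : Type} [Fintype α] [Fintype β] (n : ℕ) (a : α → Sys qSig)
    (b : β → Sys qSig) (M : Fin (n + 1) → Tensor a b) (hM : ∀ k, M k ∈ QT.proc a b) :
    (fun y x => M (x none) y (fun i => x (some i)) :
      Tensor (fun o : Option α => o.elim (Sys.cl n) a) b) ∈
        QT.proc (fun o : Option α => o.elim (Sys.cl n) a) b := by
  simp only [mem_proc_iff] at hM
  choose hK htr using hM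
  choose ι hι K hK using hK
  obtain ⟨δ, hδ⟩ : ∃ δ : Fin (n + 1) → Fin (n + 1) → ℂ, ∀ k j, δ k j = if k = j then 1 else 0 :=
    ⟨_, fun _ _ => rfl⟩
  have hδδ : ∀ k j j' : Fin (n + 1), (if k = j ∧ k = j' then (1 : ℂ) else 0) = δ k j * δ k j' := by
    intro k j j'
    rw [hδ, hδ, ite_and, ite_mul, one_mul, zero_mul]
  refine mem_proc_iff.2 ⟨⟨Σ k, ι k, inferInstance,
    fun l r c => δ l.1 (c none) * K l.1 l.2 r (fun i => c (some i)),
    fun x r r' => ?_⟩, fun x => ?_⟩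
  · rw [Fintype.sum_sigma]
    have h2 : ∀ k l, ∑ c : HIdx (fun o : Option α => o.elim (Sys.cl n) a),
        ∑ c' : HIdx (fun o : Option α => o.elim (Sys.cl n) a),
        δ k (c none) * K k l r (fun i => c (some i)) *
        tensorOp (fun o : Option α => o.elim (Sys.cl n) a) x c c' *
        star (δ k (c' none) * K k l r' (fun i => c' (some i))) =
        δ k (x none) * ∑ c, ∑ c', K k l r c * tensorOp a (fun i => x (some i)) c c' *
          star (K k l r' c') := by
      intro k l
      refine Eq.trans ?_ (sum_controlled δ hδ (K k l r) (K k l r') (tensorOp a fun i => x (some i))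
        k (x none) (basisOp (Sys.cl n) (x none)) fun j j' =>
          (basisOp_cl n (x none) j j').trans (hδδ (x none) j j'))
      refine Eq.trans ?_ (HIdx.sum_option₂ fun j c j' c' => δ k j * K k l r c *
        (basisOp (Sys.cl n) (x none) j j' * tensorOp a (fun i => x (some i)) c c') *
        star (δ k j' * K k l r' c'))
      refine Finset.sum_congr rfl fun c _ => Finset.sum_congr rfl fun c' _ => ?_
      exact congrArg (fun z => δ k (c none) * K k l r (fun i => c (some i)) * z *
        star (δ k (c' none) * K k l r' (fun i => c' (some i)))) (Fintype.prod_option _)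
    refine Eq.trans ?_ (Finset.sum_congr rfl fun k _ => Finset.sum_congr rfl fun l _ =>
      (h2 k l).symm)
    have h3 : ∀ (j₀ : Fin (n + 1)) (x' : Idx a), ∑ y, (M j₀ y x' : ℂ) * tensorOp b y r r' =
        ∑ k, ∑ l, δ k j₀ * ∑ c, ∑ c', K k l r c * tensorOp a x' c c' * star (K k l r' c') := by
      intro j₀ x'
      rw [Finset.sum_eq_single j₀ (fun j _ hj => by simp [hδ, hj]) (by simp)]
      simp only [hδ, if_true, one_mul]
      exact hK j₀ _ r r'
    exact h3 (x none) _
  · refine (htr _ _).trans ?_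
    rw [Fintype.prod_option]
    refine Eq.trans ?_ (congrArg (· * _) (disc_cl n (x none)).symm)
    exact (one_mul _).symm

theorem closed : QT.Closed where
  toReindexable := reindexable
  ident := ident_mem
  seq := seq_mem
  par := par_mem
  stochastic := stochastic_mem
  control := control_mem

end QT

/-! ## Real quantum theory as a swirled world -/

namespace QT

/-- The sign of a basis operator under transposition, to the power `g`. -/
noncomputable def transposeSign (g : ℤˣ) : ∀ A : Sys qSig, A.ix → ℝ
  | .cl _, _ => 1
  | .gpt _, (i, j) => if j < i then ((g : ℤ) : ℝ) else 1

/-- The symmetry of quantum theory generated by the transposition. -/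
noncomputable def transposition : SymAction qSig ℤˣ := fun g A y x =>
  if y = x then transposeSign g A x else 0

theorem transposeSign_one (A : Sys qSig) (x : A.ix) : transposeSign 1 A x = 1 := by
  rcases A with n | q
  · rfl
  · obtain ⟨i, j⟩ := x
    simp [transposeSign]

theorem transposeSign_mul (g h : ℤˣ) (A : Sys qSig) (x : A.ix) :
    transposeSign (g * h) A x = transposeSign g A x * transposeSign h A x := by
  rcases A with n | q
  · exact (one_mul _).symm
  · obtain ⟨i, j⟩ := x
    simp only [transposeSign]
    split_ifs <;> simp

/-- A sign occurs only for off-diagonal basis operators, which are traceless. -/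
theorem transposeSign_mul_disc (g : ℤˣ) (A : Sys qSig) (x : A.ix) :
    transposeSign g A x * QT.disc A x = QT.disc A x := by
  rcases A with n | q
  · exact one_mul _
  · obtain ⟨i, j⟩ := x
    have h : QT.disc (Sys.gpt q) (i, j) = _ := disc_gpt q i j
    by_cases hij : i = j
    · have h' : transposeSign g (Sys.gpt q) (i, j) = 1 := if_neg (by simp [hij])
      rw [h', one_mul]
    · rw [h.trans (if_neg hij), mul_zero]

/-- On Hermitian operators transposition is entrywise conjugation. The basis consists of real
symmetric operators and, for `j < i`, purely imaginary ones, so conjugation is diagonal in it. -/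
theorem star_basisOp (A : Sys qSig) (x : A.ix) (r c : Fin (lev A + 1)) :
    star (basisOp A x r c) = transposeSign (-1) A x * basisOp A x r c := by
  rcases A with n | q
  · have h : basisOp (Sys.cl n) x r c = _ := basisOp_cl n x r c
    rw [h, transposeSign]
    split_ifs <;> simp
  · obtain ⟨i, j⟩ := x
    have h : basisOp (Sys.gpt q) (i, j) r c = _ := basisOp_gpt q i j r c
    rw [h, transposeSign]
    rcases lt_trichotomy i j with hij | hij | hij
    · rw [if_neg hij.ne, if_pos hij, if_neg hij.asymm]
      split_ifs <;> simp
    · rw [if_pos hij, if_neg (show ¬ j < i from hij.le.not_gt)]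
      split_ifs <;> simp
    · rw [if_neg hij.ne', if_neg hij.asymm, if_pos hij]
      split_ifs <;> simp

theorem collective_transposition (g : ℤˣ) {α : Type} [Fintype α] (a : α → Sys qSig) (y x : Idx a) :
    collective transposition g a y x = if y = x then ∏ i, transposeSign g (a i) (x i) else 0 := by
  simp only [collective, transposition, Finset.prod_ite_zero, Idx.ext_iff, Finset.mem_univ,
    true_imp_iff]

theorem star_tensorOp {α : Type} [Fintype α] (a : α → Sys qSig) (x : Idx a) (r c : HIdx a) :
    star (tensorOp a x r c) =
      ((∏ i, transposeSign (-1) (a i) (x i) : ℝ) : ℂ) * tensorOp a x r c := by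
  simp only [tensorOp, Matrix.of_apply, star_prod, star_basisOp, Finset.prod_mul_distrib,
    Complex.ofReal_prod]

theorem sum_transposition_disc (g : ℤˣ) (A : Sys qSig) (x : A.ix) :
    ∑ y, QT.disc A y * transposition g A y x = QT.disc A x := by
  simp only [transposition, mul_ite, mul_zero, Finset.sum_ite_eq', Finset.mem_univ, if_true]
  rw [mul_comm, transposeSign_mul_disc]

section Sign

variable {α β : Type} [Fintype α] [Fintype β] {a : α → Sys qSig} {b : β → Sys qSig}

omit [Fintype β] in
theorem seqComp_transposition (g : ℤˣ) (M : Tensor a b) :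
    seqComp M (collective transposition g a) =
      fun y x => M y x * ∏ i, transposeSign g (a i) (x i) := by
  funext y x
  simp [seqComp, collective_transposition]

omit [Fintype α] in
theorem transposition_seqComp (g : ℤˣ) (M : Tensor a b) :
    seqComp (collective transposition g b) M =
      fun y x => (∏ j, transposeSign g (b j) (y j)) * M y x := by
  funext y x
  simp [seqComp, collective_transposition]

theorem prod_transposeSign_sq (g : ℤˣ) (x : Idx a) :
    (∏ i, transposeSign g (a i) (x i)) * ∏ i, transposeSign g (a i) (x i) = 1 := by
  simp [← Finset.prod_mul_distrib, ← transposeSign_mul, transposeSign_one]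

/-- Conjugating an operation by transposition amounts to complex conjugation of its Kraus operators;
traces are unaffected. -/
theorem isSymmetry_transposition : IsSymmetry QT transposition where
  one A y x := by simp [transposition, transposeSign_one]
  mul g h A y x := by
    simp only [transposition, mul_ite, mul_zero, Finset.sum_ite_eq', Finset.mem_univ, if_true,
      ite_mul, zero_mul, transposeSign_mul]
  trivial_classical g n y x := rfl
  conj g α β _ _ a b M hM := by
    rw [seqComp_transposition, transposition_seqComp]
    rcases Int.units_eq_one_or g with rfl | rfl
    · simpa [transposeSign_one] using hM
    · have hinv : (-1 : ℤˣ)⁻¹ = -1 := rfl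
      rw [hinv]
      rw [mem_proc_iff] at hM ⊢
      obtain ⟨⟨ι, _, K, hK⟩, htr⟩ := hM
      refine ⟨⟨ι, inferInstance, fun l r c => star (K l r c), fun x r r' => ?_⟩, fun x => ?_⟩
      -- The Kraus identity is conjugated entrywise, which puts signs on both sides; multiplying by
      -- the sign of the input label moves it to the output side.
      · have h1 := congrArg (((∏ i, transposeSign (-1) (a i) (x i) : ℝ) : ℂ) * star ·) (hK x r r')
        simp only [star_sum, star_mul', star_tensorOp, Finset.mul_sum] at h1
        refine Eq.trans ?_ (h1.trans ?_)
        · refine Finset.sum_congr rfl fun y _ => ?_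
          simp
          ring
        · refine Finset.sum_congr rfl fun l _ => Finset.sum_congr rfl fun c _ =>
            Finset.sum_congr rfl fun c' _ => ?_
          have h2 : ((∏ i, transposeSign (-1) (a i) (x i) : ℝ) : ℂ) *
            ((∏ i, transposeSign (-1) (a i) (x i) : ℝ) : ℂ) = 1 := by
            exact_mod_cast prod_transposeSign_sq (-1) x
          linear_combination (star (K l r c) * tensorOp a x c c' * star (star (K l r' c'))) * h2
      · have h2 : (∏ i, transposeSign (-1) (a i) (x i)) * ∏ i, QT.disc (a i) (x i) =
            ∏ i, QT.disc (a i) (x i) := by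
          simp only [← Finset.prod_mul_distrib, transposeSign_mul_disc]
        have h3 : ∀ y : Idx b, (∏ i, transposeSign (-1) (b i) (y i)) * ∏ i, QT.disc (b i) (y i) =
            ∏ i, QT.disc (b i) (y i) := fun y => by
          simp only [← Finset.prod_mul_distrib, transposeSign_mul_disc]
        rw [← h2, ← htr x, Finset.mul_sum]
        refine Finset.sum_congr rfl fun y _ => ?_
        linear_combination (M y x * ∏ i, transposeSign (-1) (a i) (x i)) * h3 y

/-- By covariance a nonzero entry `M y x` joins labels of equal sign. Conjugation multiplies its
term in the Choi matrix by the product of both signs, which is then one. -/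
theorem swirl_subset_real (M : Tensor a b) (hM : M ∈ (swirl QT transposition).proc a b) :
    M ∈ RQT.proc a b := by
  refine ⟨hM.1, fun r c => ?_⟩
  have h : ∀ y x, M y x * ∏ i, transposeSign (-1) (a i) (x i) =
      (∏ j, transposeSign (-1) (b j) (y j)) * M y x := fun y x => by
    have h := hM.2 (-1)
    rw [seqComp_transposition, transposition_seqComp] at h
    exact congrFun (congrFun h y) x
  simp only [choi, Matrix.sum_apply, Matrix.smul_apply, smul_eq_mul, Matrix.kroneckerMap_apply,
    Matrix.transpose_apply, star_sum, star_mul', star_tensorOp]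
  refine Finset.sum_congr rfl fun y _ => Finset.sum_congr rfl fun x _ => ?_
  have h1 : (M y x : ℂ) * ((∏ i, transposeSign (-1) (a i) (x i) : ℝ) : ℂ) =
      ((∏ j, transposeSign (-1) (b j) (y j) : ℝ) : ℂ) * M y x := by exact_mod_cast h y x
  have h2 : ((∏ i, transposeSign (-1) (a i) (x i) : ℝ) : ℂ) *
    ((∏ i, transposeSign (-1) (a i) (x i) : ℝ) : ℂ) = 1 := by
    exact_mod_cast prod_transposeSign_sq (-1) x
  have h3 : star (M y x : ℂ) = M y x := Complex.conj_ofReal _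
  rw [h3]
  linear_combination (-(((∏ i, transposeSign (-1) (a i) (x i) : ℝ) : ℂ)) *
    tensorOp b y r.1 c.1 * tensorOp a x c.2 r.2) * h1 +
    (M y x : ℂ) * tensorOp b y r.1 c.1 * tensorOp a x c.2 r.2 * h2

end Sign

theorem correlations_swirl_subset (C : CausalStructure) :
    Correlations (swirl QT transposition) C ⊆ Correlations RQT C := by
  rintro _ ⟨c, rfl⟩
  exact ⟨⟨c.toLabelling, c.op, fun v => swirl_subset_real _ (c.op_mem v)⟩, rfl⟩

end QT

/-! ### The qubit states `|±i⟩` as a perfect frame for the transposition. -/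

namespace QT

/-- The coordinates of the state `|+i⟩⟨+i|` of a qubit. -/
noncomputable def frameCoord (x : Fin 2 × Fin 2) : ℝ :=
  if x.1 = x.2 then 2⁻¹ else if x.1 < x.2 then 0 else (Real.sqrt 2)⁻¹

/-- The vectors `|+i⟩` and `|-i⟩`. -/
noncomputable def frameVec (g : ℤˣ) (r : Fin 2) : ℂ :=
  if r = 0 then (Real.sqrt 2 : ℂ)⁻¹ else ((g : ℤ) : ℂ) * Complex.I * (Real.sqrt 2 : ℂ)⁻¹

theorem inv_sqrt_two_sq : ((Real.sqrt 2 : ℂ)⁻¹) * (Real.sqrt 2 : ℂ)⁻¹ = 2⁻¹ := by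
  rw [← mul_inv, ← Complex.ofReal_mul, Real.mul_self_sqrt (by norm_num)]
  norm_num

theorem sum_frameCoord_basisOp (r c : Fin 2) :
    ∑ x : Fin 2 × Fin 2, (frameCoord x : ℂ) * basisOp (Sys.gpt (1 : ℕ)) x r c =
      frameVec 1 r * star (frameVec 1 c) := by
  have h := inv_sqrt_two_sq
  have hI := Complex.I_mul_I
  refine (Finset.sum_congr rfl fun x _ => congrArg _ (basisOp_gpt 1 x.1 x.2 r c)).trans ?_
  fin_cases r <;> fin_cases c <;>
    simp [Fintype.sum_prod_type, Fin.sum_univ_two, frameCoord, frameVec, h]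
  · ring
  · linear_combination (Real.sqrt 2 : ℂ)⁻¹ ^ 2 * hI - h

/-- In an orthonormal operator basis the expectation values of the basis operators are the
coordinates of the state, and transposition exchanges `|+i⟩` and `|-i⟩`. -/
theorem frameVec_basisOp_frameVec (g : ℤˣ) (x : Fin 2 × Fin 2) :
    ∑ r : Fin 2, ∑ c : Fin 2,
      star (frameVec g r) * basisOp (Sys.gpt (1 : ℕ)) x r c * star (star (frameVec g c)) =
      (transposeSign g (Sys.gpt (1 : ℕ)) x * frameCoord x : ℝ) := by
  have h := inv_sqrt_two_sq
  have hI := Complex.I_mul_I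
  refine (Finset.sum_congr rfl fun r _ => Finset.sum_congr rfl fun c _ => congrArg (_ * · * _)
    (basisOp_gpt 1 x.1 x.2 r c)).trans ?_
  obtain ⟨i, j⟩ := x
  rcases Int.units_eq_one_or g with rfl | rfl <;> fin_cases i <;> fin_cases j <;>
    simp [Fin.sum_univ_two, frameCoord, frameVec, h, transposeSign]
  · linear_combination -(Complex.I * (Real.sqrt 2 : ℂ)⁻¹) * h
  · linear_combination -2 * (Real.sqrt 2 : ℂ)⁻¹ ^ 3 * hI + 2 * (Real.sqrt 2 : ℂ)⁻¹ * h
  · linear_combination -(Real.sqrt 2 : ℂ)⁻¹ ^ 2 * hI + h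
  · linear_combination Complex.I * (Real.sqrt 2 : ℂ)⁻¹ * h
  · linear_combination 2 * (Real.sqrt 2 : ℂ)⁻¹ ^ 3 * hI - 2 * (Real.sqrt 2 : ℂ)⁻¹ * h
  · linear_combination -(Real.sqrt 2 : ℂ)⁻¹ ^ 2 * hI + h

/-- These are Hilbert–Schmidt products of the projectors onto the orthogonal vectors `|±i⟩`. -/
theorem sum_frameCoord_mul (g h : ℤˣ) :
    ∑ x : Fin 2 × Fin 2, transposeSign g (Sys.gpt (1 : ℕ)) x * frameCoord x *
      (transposeSign h (Sys.gpt (1 : ℕ)) x * frameCoord x) = if g = h then 1 else 0 := by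
  have hs : (Real.sqrt 2)⁻¹ * (Real.sqrt 2)⁻¹ = 2⁻¹ := by
    rw [← mul_inv, Real.mul_self_sqrt (by norm_num)]
  rcases Int.units_eq_one_or g with rfl | rfl <;> rcases Int.units_eq_one_or h with rfl | rfl <;>
    simp [Fintype.sum_prod_type, Fin.sum_univ_two, frameCoord, transposeSign, hs]
  all_goals norm_num

theorem sum_disc_frameCoord :
    ∑ x : Fin 2 × Fin 2, QT.disc (Sys.gpt (1 : ℕ)) x * frameCoord x = 1 := by
  refine (Finset.sum_congr rfl fun x _ => congrArg (· * _) (disc_gpt 1 x.1 x.2)).trans ?_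
  simp [Fintype.sum_prod_type, Fin.sum_univ_two, frameCoord]
  norm_num

/-- The orientation flagged by an outcome. -/
def frameSign (k : Fin 2) : ℤˣ := if k = 0 then 1 else -1

/-- The two projectors sum to the identity, whose coordinates are the traces of the basis operators;
thus the measurement is complete. -/
theorem sum_frameSign (x : Fin 2 × Fin 2) :
    ∑ k, transposeSign (frameSign k) (Sys.gpt (1 : ℕ)) x * frameCoord x =
      QT.disc (Sys.gpt (1 : ℕ)) x := by
  obtain ⟨i, j⟩ := x
  refine Eq.trans ?_ (disc_gpt 1 i j).symm
  fin_cases i <;> fin_cases j <;>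
    simp [Fin.sum_univ_two, frameCoord, frameSign, transposeSign]

theorem _root_.Idx.sum_unique {R : Type} [AddCommMonoid R] {α : Type} [Fintype α] [Unique α]
    {A : Sys qSig} (f : Idx (fun _ : α => A) → R) : ∑ x, f x = ∑ k, f fun _ => k := by
  have h : ∀ x : Idx (fun _ : α => A), x = fun _ => x default := fun x =>
    funext fun i => congrArg (fun j => (x j : A.ix)) (Unique.eq_default i)
  exact Fintype.sum_equiv (ι := Idx (fun _ : α => A)) ⟨fun x => x default, fun k _ => k,
    fun x => (h x).symm, fun _ => rfl⟩ f _ fun x => congrArg f (h x)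

theorem _root_.HIdx.sum_unique {R : Type} [AddCommMonoid R] {α : Type} [Fintype α] [Unique α]
    {A : Sys qSig} (f : HIdx (fun _ : α => A) → R) : ∑ x, f x = ∑ k, f fun _ => k := by
  have h : ∀ x : HIdx (fun _ : α => A), x = fun _ => x default := fun x =>
    funext fun i => congrArg (fun j => (x j : Fin (lev A + 1))) (Unique.eq_default i)
  exact Fintype.sum_equiv (ι := HIdx (fun _ : α => A)) ⟨fun x => x default, fun k _ => k,
    fun x => (h x).symm, fun _ => rfl⟩ f _ fun x => congrArg f (h x)

theorem tensorOp_unique {α : Type} [Fintype α] [Unique α] (a : α → Sys qSig) (x : Idx a)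
    (r c : HIdx a) :
    tensorOp a x r c = basisOp (a default) (x default) (r default) (c default) :=
  Fintype.prod_unique fun i => basisOp (a i) (x i) (r i) (c i)

theorem tensorOp_isEmpty {α : Type} [Fintype α] [IsEmpty α] (a : α → Sys qSig) (x : Idx a)
    (r c : HIdx a) : tensorOp a x r c = 1 :=
  Fintype.prod_empty fun i => basisOp (a i) (x i) (r i) (c i)

/-- The qubit. -/
abbrev qubit : Sys qSig := Sys.gpt (1 : ℕ)

theorem frameState_mem : (fun y _ => frameCoord (y 0) :
    Tensor (fun i : Empty => (i.elim : Sys qSig)) (fun _ : Fin 1 => qubit)) ∈ QT.proc _ _ := by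
  refine mem_proc_iff.2 ⟨⟨Unit, inferInstance, fun _ r _ => frameVec 1 (r 0), fun x r r' => ?_⟩,
    fun x => ?_⟩
  · have : Unique (HIdx fun i : Empty => (i.elim : Sys qSig)) :=
      inferInstanceAs (Unique (∀ i : Empty, _))
    rw [Idx.sum_unique]
    simp only [tensorOp_isEmpty, Fintype.sum_unique, mul_one]
    refine Eq.trans ?_ (sum_frameCoord_basisOp (r 0) (r' 0))
    exact Finset.sum_congr rfl fun k _ => congrArg _ (tensorOp_unique _ _ r r')
  · rw [Idx.sum_unique]
    refine Eq.trans ?_ (sum_disc_frameCoord.trans (Fintype.prod_empty _).symm)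
    refine Finset.sum_congr rfl fun k _ => ?_
    rw [mul_comm]
    exact congrArg (· * _) (Fin.prod_univ_one _)

/-- The measurement of the orientation. -/
noncomputable def frameMeas : Tensor (fun _ : Fin 1 => qubit) (fun _ : Unit => (Sys.cl 1 : Sys qSig)) :=
  fun k z => transposeSign (frameSign (k ())) qubit (z 0) * frameCoord (z 0)

theorem frameMeas_mem : frameMeas ∈ QT.proc (fun _ : Fin 1 => qubit) _ := by
  obtain ⟨δ, hδ⟩ : ∃ δ : Fin 2 → Fin 2 → ℂ, ∀ k j, δ k j = if k = j then 1 else 0 :=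
    ⟨_, fun _ _ => rfl⟩
  have hb : ∀ k r r' : Fin 2, basisOp (Sys.cl 1) k r r' = δ k r * δ k r' := by
    intro k r r'
    refine (basisOp_cl 1 k r r').trans ?_
    rw [hδ, hδ, ite_and, ite_mul, one_mul, zero_mul]
  have hstar : ∀ k j, star (δ k j) = δ k j := by
    intro k j
    rw [hδ]
    split_ifs <;> simp
  -- The Kraus operators are `|0⟩⟨+i|` and `|1⟩⟨-i|`.
  refine mem_proc_iff.2 ⟨⟨Fin 2, inferInstance,
    fun k r c => δ k (r ()) * star (frameVec (frameSign k) (c 0)), fun x r r' => ?_⟩, fun x => ?_⟩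
  · have halg : ∀ d d' v t v' : ℂ, star d' = d' →
        d * star v * t * star (d' * star v') = d * d' * (star v * t * star (star v')) := by
      intro d d' v t v' h
      rw [star_mul', h]
      ring
    have h1 : ∀ k : Fin 2, ∑ c : HIdx (fun _ : Fin 1 => qubit), ∑ c' : HIdx (fun _ : Fin 1 => qubit),
        δ k (r ()) * star (frameVec (frameSign k) (c 0)) * tensorOp (fun _ : Fin 1 => qubit) x c c' *
          star (δ k (r' ()) * star (frameVec (frameSign k) (c' 0))) =
        δ k (r ()) * δ k (r' ()) *
          (transposeSign (frameSign k) qubit (x 0) * frameCoord (x 0) : ℝ) := by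
      intro k
      refine Eq.trans ?_ (congrArg (δ k (r ()) * δ k (r' ()) * ·)
        (frameVec_basisOp_frameVec (frameSign k) (x 0)))
      simp only [Finset.mul_sum]
      refine (HIdx.sum_unique _).trans (Finset.sum_congr rfl fun c _ =>
        (HIdx.sum_unique _).trans (Finset.sum_congr rfl fun c' _ => ?_))
      have h2 : tensorOp (fun _ : Fin 1 => qubit) x (fun _ => c) (fun _ => c') =
          basisOp qubit (x 0) c c' := tensorOp_unique _ _ _ _
      rw [h2]
      exact halg _ _ _ _ _ (hstar _ _)
    refine Eq.trans ?_ (Finset.sum_congr rfl fun k _ => (h1 k).symm)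
    refine (Idx.sum_unique _).trans (Finset.sum_congr rfl fun k _ => ?_)
    refine (mul_comm _ _).trans (congrArg₂ (· * ·) ?_ rfl)
    exact (tensorOp_unique _ _ r r').trans (hb k (r ()) (r' ()))
  · refine Eq.trans ?_ ((sum_frameSign (x 0)).trans
      (Fin.prod_univ_one fun i => QT.disc qubit (x i)).symm)
    simp only [disc_cl, Finset.prod_const_one, mul_one]
    exact Idx.sum_unique _

theorem isPerfectFrame_qubit : IsPerfectFrame QT transposition (fun _ : Fin 1 => qubit)
    (fun y => frameCoord (y 0)) frameMeas (fun g : ℤˣ => if g = 1 then 0 else 1) where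
  state_mem := frameState_mem
  meas_mem := frameMeas_mem
  meas_eq g k := by
    have h1 : ∀ z : Idx (fun _ : Fin 1 => qubit),
        ∑ w, collective transposition g (fun _ : Fin 1 => qubit) z w * frameCoord (w 0) =
          transposeSign g qubit (z 0) * frameCoord (z 0) := by
      intro z
      simp [collective_transposition]
    simp only [h1]
    rw [Idx.sum_unique]
    refine (sum_frameCoord_mul (frameSign k) g).trans (if_congr ?_ rfl rfl)
    rcases Int.units_eq_one_or g with rfl | rfl <;> fin_cases k <;> simp [frameSign]
  eq_of_lab g h hgh := by
    congr 1
    rcases Int.units_eq_one_or g with rfl | rfl <;>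
      rcases Int.units_eq_one_or h with rfl | rfl <;> simp_all
  disc_eq := by
    rw [Idx.sum_unique]
    refine Eq.trans (Finset.sum_congr rfl fun k _ => ?_) sum_disc_frameCoord
    exact congrArg (· * _) (Fin.prod_univ_one _)

/-- All latent wires leave the gate `none`, so the source is unique by definition. -/
theorem correlations_bell_subset (n : ℕ) :
    Correlations QT (bell n) ⊆ Correlations RQT (bell n) :=
  (correlations_subset_swirl closed isSymmetry_transposition sum_transposition_disc
    isPerfectFrame_qubit fun _ _ _ _ => rfl).trans (correlations_swirl_subset _)

end QT

theorem mainTheorem10 :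
    (∀ (σ : Signature) (T : OpTheory σ) (G : Type) [Group G] [Fintype G] (F : SymAction σ G)
      (C : CausalStructure), T.IsGPT → IsSymmetry T F → ¬ IsPhysical T F → HasPerfectFrame T F →
      C.OneDistrict → HasGap (swirl T F) T C → ¬ AllowsSharedFrame T F C) ∧
    (∀ n : ℕ, ¬ HasGap RQT QT (bell n)) := by
  refine ⟨fun σ T G _ _ F C hT hF _ hframe _ hgap hshared => ?_, fun n hgap => ?_⟩
  · exact hgap.2 (hshared.correlations_subset hT hF hframe)
  · exact hgap.2 (QT.correlations_bell_subset n)
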